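/- For $\epsilon\in\mathbb{R}$ let $$Y_\epsilon := \{\gamma\in W^{2,2}(\mathbb{S}^1;\mathbb{S}^2) : |\gamma'|\equiv 1,\ \gamma\cdot e_3\ge \epsilon\},\qquad F(\gamma) := \int_{\mathbb{S}^1}\kappa^2\,ds,$$ where $\mathbb{S}^1=\mathbb{R}/2\pi\mathbb{Z}$ carries its arc length $ds$, $\mathbb{S}^2\subset\mathbb{R}^3$ is the unit sphere, the curves $\gamma$ are identified with their continuous representatives, and $\kappa=\gamma''\cdot(\gamma\times\gamma')$ is the geodesic curvature of $\gamma$. There exist universal constants $c_0>0$ and $\epsilon_0>0$ such that for every $0<\epsilon<\epsilon_0$ and every minimizer $\gamma$ of $F$ over $Y_\epsilon$, each connected component of the non-contact set $\{s\in\mathbb{S}^1 : \gamma(s)\cdot e_3>\epsilon\}$ is an open interval of the circle $\mathbb{S}^1$ of length at least $c_0$. In particular, the non-contact set consists of finitely many intervals. -/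

import Mathlib

open MeasureTheory
open scoped ContDiff

namespace Elastica

/-- The unit circle `ℝ / 2πℤ`, with arc length `volume` of total mass `2π`. -/
abbrev Circ : Type := AddCircle (2 * Real.pi)

instance factTwoPiPos : Fact (0 < 2 * Real.pi) := ⟨Real.two_pi_pos⟩

/-- Euclidean three-space. -/
abbrev E3 : Type := EuclideanSpace ℝ (Fin 3)

/-- `v` is a weak derivative of `u` on the circle: both are integrable and
`∫ φ' u = - ∫ φ v` for every smooth test function `φ` on the circle, with derivative `φ'`.
Functions on the circle are differentiated by lifting them to `ℝ`. -/
def IsWeakDeriv (u v : Circ → E3) : Prop :=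
  Integrable u ∧ Integrable v ∧
    ∀ φ φ' : Circ → ℝ, ContDiff ℝ ∞ (fun s : ℝ => φ (s : Circ)) →
      (∀ s : ℝ, HasDerivAt (fun t : ℝ => φ (t : Circ)) (φ' (s : Circ)) s) →
      ∫ x, φ' x • u x = - ∫ x, φ x • v x

/-- `u` has a weak derivative. -/
def HasWeakDeriv (u : Circ → E3) : Prop := ∃ v, IsWeakDeriv u v

open Classical in
/-- The weak derivative of `u` (well defined up to null sets; `0` if there is none). -/
noncomputable def weakDeriv (u : Circ → E3) : Circ → E3 :=
  if h : HasWeakDeriv u then h.choose else 0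

theorem isWeakDeriv_weakDeriv {u : Circ → E3} (h : HasWeakDeriv u) :
    IsWeakDeriv u (weakDeriv u) := by
  unfold weakDeriv
  rw [dif_pos h]
  exact h.choose_spec

/-- The Sobolev space `W^{2,2}` on the circle, with values in `ℝ³`. -/
def MemW22 (u : Circ → E3) : Prop :=
  MemLp u 2 ∧
  HasWeakDeriv u ∧ MemLp (weakDeriv u) 2 ∧
  HasWeakDeriv (weakDeriv u) ∧ MemLp (weakDeriv (weakDeriv u)) 2

/-- The geodesic curvature `κ = γ'' · (γ × γ')` of a unit-speed curve on the sphere. -/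
noncomputable def geodesicCurvature (γ : Circ → E3) (x : Circ) : ℝ :=
  (weakDeriv (weakDeriv γ) x).ofLp ⬝ᵥ crossProduct (γ x).ofLp (weakDeriv γ x).ofLp

/-- The Euler–Bernoulli energy `F(γ) = ∫ κ² ds` of a unit-speed curve. -/
noncomputable def energy (γ : Circ → E3) : ℝ := ∫ x, geodesicCurvature γ x ^ 2

/-- `Y_ε`: the closed unit-speed `W^{2,2}` curves (continuous representatives) on the unit sphere,
of length `2π`, that stay in the half-space `{x₃ ≥ ε}`. -/
def Y (ε : ℝ) : Set (Circ → E3) :=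
  {γ | Continuous γ ∧ MemW22 γ ∧ (∀ x, γ x ∈ Metric.sphere (0 : E3) 1) ∧
    (∀ᵐ x, ‖weakDeriv γ x‖ = 1) ∧ ∀ x, ε ≤ γ x 2}

/-- `γ` minimizes the energy over `Y_ε`. -/
def IsMinimizer (ε : ℝ) (γ : Circ → E3) : Prop := γ ∈ Y ε ∧ IsMinOn energy (Y ε) γ

/-- The non-contact set `{γ · e₃ > ε}`. -/
def nonContactSet (ε : ℝ) (γ : Circ → E3) : Set Circ := {x | ε < γ x 2}

/-- The connected components of a subset of the circle. -/
def components (U : Set Circ) : Set (Set Circ) := {I | ∃ x ∈ U, I = connectedComponentIn U x}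

/-- `I` is an open interval of length `l` of the circle. -/
def IsOpenArc (I : Set Circ) (l : ℝ) : Prop :=
  0 < l ∧ l ≤ 2 * Real.pi ∧
    ∃ a : ℝ, I = (fun s : ℝ => (s : Circ)) '' Set.Ioo a (a + l)

end Elastica

/-! Write u = γ·e₃ for the height of the curve. Where 1 − u² − u'² > 0 the curve is a graph over the
equator: it turns around the vertical axis with angular speed √(1 − u² − u'²)/(1 − u²), and its
energy is ∫ (u'' + u)²/(1 − u² − u'²). Conversely, a periodic height whose total rotation is 2π
comes from a closed curve (`exists_curve`). The problem thus becomes an obstacle problem u ≥ ε for a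
scalar periodic function under one scalar constraint.

The heights ε(10 + b cos 2s), with b chosen to meet the constraint, have energy O(ε²). Hence a
minimizer has ∫ (u'' + u)² ≤ 18000 ε², which forces |u|, |u'| ≤ δ with δ = 18000 ε
(`IsMinimizer.nearEquator`). As the rotation is 2π + ½ ∫ (u² − u'²) + O(δ⁴), the constraint yields ∫
(u² − u'²) = O(δ⁴).

Perturbations dominated by a multiple of u − ε are admissible with both signs, so they satisfy a
Lagrange multiplier equation (`IsHeightMinimizer.euler_lagrange`). Let M and L be the variation of
the rotation and half the variation of the energy in the direction u − ε. Then M ≈ −ε ∫ u and L ≈ ∫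
(u'' + u)² − ε ∫ u up to O(δ⁴). Consequently −M and L − M are at least 6ε², while |M| and |L| are
O(εδ) (`NearEquator.multiplier_bounds`): the constraint is nondegenerate and the multiplier is
bounded independently of ε.

Without contact, the constant 1 could be tested, giving (L − M) ∫ u = O(δ⁵) although the left side
is at least 36 ε³; so contact occurs (`NearEquator.exists_contact`). Between two contact points u −
ε and u' vanish at the ends, and the restriction of u − ε to that interval may be tested. The
quadratic term (−M/2) ∫ u''² then dominates all others, by Poincaré inequalities, when the interval
is short. This gives u'' = 0 and u = ε there (`NearEquator.length_component`). The threshold depends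
only on δ/ε, hence not on ε. Finiteness follows because the components are disjoint arcs in a circle
of finite length. -/

namespace Elastica

/-! ### Calculus of absolutely continuous functions on the line. -/

/-- `f` is an indefinite integral of the locally integrable function `g`. -/
def IsPrimitive (f g : ℝ → ℝ) : Prop :=
  (∀ a b, IntervalIntegrable g volume a b) ∧ ∀ a b, ∫ x in a..b, g x = f b - f a

namespace IsPrimitive

variable {f g f₁ g₁ : ℝ → ℝ}

theorem absCont (h : IsPrimitive f g) (a b : ℝ) : AbsolutelyContinuousOnInterval f a b := by
  have h1 := (h.1 a b).absolutelyContinuousOnInterval_intervalIntegral (c := a) (by simp)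
  have h2 : AbsolutelyContinuousOnInterval (fun _ : ℝ => f a) a b :=
    (LipschitzWith.const (f a)).lipschitzOnWith.absolutelyContinuousOnInterval
  have h3 := h1.fun_add h2
  have : (fun x => (∫ v in a..x, g v) + f a) = f := by
    funext x; rw [h.2]; ring
  rwa [this] at h3

theorem continuous (h : IsPrimitive f g) : Continuous f := by
  have : f = fun x => (∫ v in (0 : ℝ)..x, g v) + f 0 := by
    funext x; rw [h.2]; ring
  rw [this]
  exact (intervalIntegral.continuous_primitive (fun a b => h.1 a b) 0).add continuous_const

theorem ae_hasDerivAt (h : IsPrimitive f g) : ∀ᵐ x, HasDerivAt f (g x) x := by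
  -- Lebesgue differentiation is applied on each `[-n, n]`; the countable union of exceptional sets
  -- is null.
  have h1 : ∀ n : ℕ, ∀ᵐ x, x ∈ Set.uIcc (-(n : ℝ)) n →
      HasDerivAt (fun x => ∫ t in (0 : ℝ)..x, g t) (g x) x := by
    intro n
    filter_upwards [(h.1 (-(n : ℝ)) n).ae_hasDerivAt_integral] with x hx hx'
    refine hx hx' 0 ?_
    rw [Set.uIcc_of_le (by linarith [Nat.cast_nonneg (α := ℝ) n])]
    constructor <;> simp
  have h2 := ae_all_iff.2 h1
  filter_upwards [h2] with x hx
  obtain ⟨n, hn⟩ := exists_nat_ge |x|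
  have h3 := hx n (by
    rw [Set.uIcc_of_le (by linarith [Nat.cast_nonneg (α := ℝ) n])]
    exact abs_le.1 hn)
  have : f = fun x => (∫ v in (0 : ℝ)..x, g v) + f 0 := by
    funext x; rw [h.2]; ring
  rw [this]
  exact h3.add_const _

/-- The working criterion: every closure property below combines stability of absolute continuity
with a pointwise derivative rule almost everywhere. -/
theorem of_absCont (h : ∀ a b, AbsolutelyContinuousOnInterval f a b)
    (h' : ∀ᵐ x, HasDerivAt f (g x) x) : IsPrimitive f g := by
  have e : deriv f =ᵐ[volume] g := by
    filter_upwards [h'] with x hx using hx.deriv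
  refine ⟨fun a b => ?_, fun a b => ?_⟩
  · exact (h a b).intervalIntegrable_deriv.congr_ae (ae_restrict_of_ae e)
  · rw [← (h a b).integral_deriv_eq_sub]
    apply intervalIntegral.integral_congr_ae
    filter_upwards [e] with x hx _ using hx.symm

theorem of_hasDerivAt (h : ∀ x, HasDerivAt f (g x) x) (hg : Continuous g) : IsPrimitive f g :=
  ⟨fun a b => hg.intervalIntegrable a b, fun a b =>
    intervalIntegral.integral_eq_sub_of_hasDerivAt (fun x _ => h x) (hg.intervalIntegrable a b)⟩

theorem hasDerivAt (h : IsPrimitive f g) (hg : Continuous g) (x : ℝ) : HasDerivAt f (g x) x := by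
  have : f = fun x => (∫ v in (0 : ℝ)..x, g v) + f 0 := by
    funext x; rw [h.2]; ring
  rw [this]
  exact (hg.integral_hasStrictDerivAt 0 x).hasDerivAt.add_const _

theorem const (c : ℝ) : IsPrimitive (fun _ => c) (fun _ => 0) :=
  of_hasDerivAt (fun x => hasDerivAt_const x c) continuous_const

theorem add (h : IsPrimitive f g) (h₁ : IsPrimitive f₁ g₁) :
    IsPrimitive (fun x => f x + f₁ x) (fun x => g x + g₁ x) := by
  refine of_absCont (fun a b => (h.absCont a b).fun_add (h₁.absCont a b)) ?_
  filter_upwards [h.ae_hasDerivAt, h₁.ae_hasDerivAt] with x hx hx₁ using hx.add hx₁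

theorem mul (h : IsPrimitive f g) (h₁ : IsPrimitive f₁ g₁) :
    IsPrimitive (fun x => f x * f₁ x) (fun x => g x * f₁ x + f x * g₁ x) := by
  refine of_absCont (fun a b => (h.absCont a b).fun_mul (h₁.absCont a b)) ?_
  filter_upwards [h.ae_hasDerivAt, h₁.ae_hasDerivAt] with x hx hx₁ using hx.mul hx₁

theorem congr (h : IsPrimitive f g) (e : ∀ᵐ x, g x = g₁ x) : IsPrimitive f g₁ := by
  refine of_absCont h.absCont ?_
  filter_upwards [h.ae_hasDerivAt, e] with x hx ex
  rwa [← ex]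

theorem const_mul (c : ℝ) (h : IsPrimitive f g) :
    IsPrimitive (fun x => c * f x) (fun x => c * g x) := by
  simpa using (const c).mul h

/-- The Lipschitz bound is required only at values of `f`, so that functions such as the inverse and
the square root, singular at `0`, can be composed with an `f` bounded below. -/
theorem comp {Φ Φ' : ℝ → ℝ} (h : IsPrimitive f g) (K : ℝ)
    (hL : ∀ x y, |Φ (f x) - Φ (f y)| ≤ K * |f x - f y|)
    (hd : ∀ x, HasDerivAt Φ (Φ' (f x)) (f x)) :
    IsPrimitive (fun x => Φ (f x)) (fun x => Φ' (f x) * g x) := by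
  refine of_absCont (fun a b => ?_) ?_
  · have hac := h.absCont a b
    rw [absolutelyContinuousOnInterval_iff] at hac ⊢
    intro ε hε
    have hK : 0 < |K| + 1 := by positivity
    obtain ⟨δ, hδ, hac⟩ := hac (ε / (|K| + 1)) (by positivity)
    refine ⟨δ, hδ, fun E hE hs => ?_⟩
    have h1 := hac E hE hs
    calc ∑ i ∈ Finset.range E.1, dist (Φ (f (E.2 i).1)) (Φ (f (E.2 i).2))
        ≤ ∑ i ∈ Finset.range E.1, (|K| + 1) * dist (f (E.2 i).1) (f (E.2 i).2) := by
          refine Finset.sum_le_sum fun i _ => ?_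
          rw [Real.dist_eq, Real.dist_eq]
          refine (hL _ _).trans ?_
          gcongr
          linarith [le_abs_self K]
      _ = (|K| + 1) * ∑ i ∈ Finset.range E.1, dist (f (E.2 i).1) (f (E.2 i).2) := by
          rw [Finset.mul_sum]
      _ < (|K| + 1) * (ε / (|K| + 1)) := by gcongr
      _ = ε := by field_simp
  · filter_upwards [h.ae_hasDerivAt] with x hx using (hd x).comp x hx

theorem inv (h : IsPrimitive f g) {c : ℝ} (hc : 0 < c) (hf : ∀ x, c ≤ f x) :
    IsPrimitive (fun x => (f x)⁻¹) (fun x => -((f x) ^ 2)⁻¹ * g x) := by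
  refine h.comp (Φ := fun y => y⁻¹) (Φ' := fun y => -(y ^ 2)⁻¹) ((c * c)⁻¹) (fun x y => ?_)
    (fun x => hasDerivAt_inv (by linarith [hf x]))
  have hx := hf x
  have hy := hf y
  have hx0 : 0 < f x := by linarith
  have hy0 : 0 < f y := by linarith
  have : (f x)⁻¹ - (f y)⁻¹ = -((f x * f y)⁻¹ * (f x - f y)) := by field_simp; ring
  rw [this, abs_neg, abs_mul, abs_of_pos (by positivity)]
  gcongr

theorem sqrt (h : IsPrimitive f g) {c : ℝ} (hc : 0 < c) (hf : ∀ x, c ≤ f x) :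
    IsPrimitive (fun x => √(f x)) (fun x => 1 / (2 * √(f x)) * g x) := by
  refine h.comp (Φ := fun y => √y) (Φ' := fun y => 1 / (2 * √y)) ((√c)⁻¹) (fun x y => ?_)
    (fun x => Real.hasDerivAt_sqrt (by linarith [hf x]))
  have hx := Real.sqrt_le_sqrt (hf x)
  have hy := Real.sqrt_le_sqrt (hf y)
  have hc' := Real.sqrt_pos.2 hc
  have e : f x - f y = (√(f x) - √(f y)) * (√(f x) + √(f y)) := by
    have := Real.mul_self_sqrt (hc.le.trans (hf x))
    have := Real.mul_self_sqrt (hc.le.trans (hf y))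
    linarith
  rw [e, abs_mul, abs_of_pos (show 0 < √(f x) + √(f y) by linarith)]
  rw [inv_mul_eq_div, le_div_iff₀ hc']
  gcongr
  linarith

theorem integral_mul (h : IsPrimitive f g) (h₁ : IsPrimitive f₁ g₁) (a b : ℝ) :
    ∫ x in a..b, f x * g₁ x = f b * f₁ b - f a * f₁ a - ∫ x in a..b, g x * f₁ x := by
  have i1 : IntervalIntegrable (fun x => g x * f₁ x) volume a b :=
    (h.1 a b).mul_continuousOn h₁.continuous.continuousOn
  have i2 : IntervalIntegrable (fun x => f x * g₁ x) volume a b :=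
    (h₁.1 a b).continuousOn_mul h.continuous.continuousOn
  have := (h.mul h₁).2 a b
  rw [intervalIntegral.integral_add i1 i2] at this
  linarith

/-- One period suffices: periodicity of `f` makes the integral of `g` over a period vanish, so whole
periods contribute nothing. -/
theorem of_base {T t : ℝ} (hT : 0 < T) (pf : Function.Periodic f T) (pg : Function.Periodic g T)
    (hi : IntervalIntegrable g volume t (t + T))
    (h : ∀ x ∈ Set.Icc t (t + T), ∫ y in t..x, g y = f x - f t) : IsPrimitive f g := by
  have hI : ∀ a b, IntervalIntegrable g volume a b := pg.intervalIntegrable hT.ne' hi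
  have h0 : ∫ y in t..t + T, g y = 0 := by
    rw [h _ ⟨by linarith, le_rfl⟩, pf t, sub_self]
  have key : ∀ x, ∫ y in t..x, g y = f x - f t := by
    intro x
    obtain ⟨n, hn, -⟩ := existsUnique_sub_zsmul_mem_Ico hT x t
    set y := x - n • T with hy
    have hx : x = y + n • T := by rw [hy]; ring
    rw [hx, ← intervalIntegral.integral_add_adjacent_intervals (hI t y) (hI y _),
      pg.intervalIntegral_add_zsmul_eq n y hI, pg.intervalIntegral_add_eq y t, h0,
      h y ⟨hn.1, hn.2.le⟩, (pf.zsmul n) y]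
    simp
  refine ⟨hI, fun a b => ?_⟩
  rw [← intervalIntegral.integral_interval_sub_left (hI t b) (hI t a), key, key]
  ring

end IsPrimitive

/-- A `2π`-periodic function `u` with derivative `p` and weak second derivative `q`, locally square
integrable. -/
structure IsPer2 (u p q : ℝ → ℝ) : Prop where
  per_u : Function.Periodic u (2 * Real.pi)
  per_p : Function.Periodic p (2 * Real.pi)
  per_q : Function.Periodic q (2 * Real.pi)
  deriv_u : ∀ x, HasDerivAt u (p x) x
  prim : IsPrimitive p q
  sq : ∀ a b, IntervalIntegrable (fun x => q x ^ 2) volume a b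

end Elastica

/-! ### Transfer between the circle and periodic functions on the line. -/

namespace Elastica

/-- The representative in `(0, 2π]` of a point of the circle. -/
noncomputable def rep (x : Circ) : ℝ := AddCircle.equivIoc (2 * Real.pi) 0 x

@[simp] theorem coe_rep (x : Circ) : ((rep x : ℝ) : Circ) = x := AddCircle.coe_equivIoc

theorem measurePreserving_rep :
    MeasurePreserving rep volume (volume.restrict (Set.Ioc 0 (0 + 2 * Real.pi))) :=
  (measurePreserving_subtype_coe measurableSet_Ioc).comp
    (AddCircle.measurePreserving_equivIoc (2 * Real.pi) (a := 0))

theorem periodic_coe {B : Type*} (f : Circ → B) :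
    Function.Periodic (fun s : ℝ => f (s : Circ)) (2 * Real.pi) := fun s => by
  simp

theorem apply_rep_coe {B : Type*} {f : ℝ → B} (hf : Function.Periodic f (2 * Real.pi)) (s : ℝ) :
    f (rep (s : Circ)) = f s := by
  have h : ((rep (s : Circ) : ℝ) : Circ) = (s : Circ) := coe_rep _
  rw [← hf.lift_coe, ← hf.lift_coe, h]

/-- The line is a countable union of period intervals, each carried onto the circle by a
measure-preserving map. -/
theorem ae_circ_iff {R : Circ → Prop} : (∀ᵐ x, R x) ↔ ∀ᵐ s : ℝ, R (s : Circ) := by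
  constructor
  · intro h
    have h1 : ∀ k : ℤ, ∀ᵐ s : ℝ, s ∈ Set.Ioc (k • (2 * Real.pi)) (k • (2 * Real.pi) + 2 * Real.pi) →
        R (s : Circ) := by
      intro k
      rw [← ae_restrict_iff' measurableSet_Ioc]
      exact (AddCircle.measurePreserving_mk (2 * Real.pi)
        (k • (2 * Real.pi))).quasiMeasurePreserving.ae h
    filter_upwards [ae_all_iff.2 h1] with s hs
    obtain ⟨k, hk, -⟩ := existsUnique_sub_zsmul_mem_Ioc Real.two_pi_pos s 0
    refine hs k ⟨?_, ?_⟩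
    · linarith [hk.1]
    · linarith [hk.2]
  · intro h
    have := measurePreserving_rep.quasiMeasurePreserving.ae (ae_restrict_of_ae h)
    simpa using this

theorem integral_circ {E : Type*} [NormedAddCommGroup E] [NormedSpace ℝ E] (f : Circ → E) :
    ∫ x, f x = ∫ s in (0 : ℝ)..2 * Real.pi, f (s : Circ) := by
  rw [← AddCircle.intervalIntegral_preimage (2 * Real.pi) 0 f, zero_add]

theorem intervalIntegrable_coe {E : Type*} [NormedAddCommGroup E] {f : Circ → E}
    (hf : Integrable f) (a b : ℝ) : IntervalIntegrable (fun s : ℝ => f (s : Circ)) volume a b := by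
  refine (periodic_coe f).intervalIntegrable Real.two_pi_pos.ne' (t := 0) ?_ a b
  rw [intervalIntegrable_iff_integrableOn_Ioc_of_le (by linarith [Real.two_pi_pos])]
  exact (AddCircle.measurePreserving_mk (2 * Real.pi) 0).integrable_comp_of_integrable hf

theorem integrable_of_coe {E : Type*} [NormedAddCommGroup E] {f : Circ → E}
    (hf : IntervalIntegrable (fun s : ℝ => f (s : Circ)) volume 0 (2 * Real.pi)) :
    Integrable f := by
  rw [intervalIntegrable_iff_integrableOn_Ioc_of_le (by linarith [Real.two_pi_pos])] at hf
  have h1 : Integrable (fun s : ℝ => f (s : Circ))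
      (volume.restrict (Set.Ioc 0 (0 + 2 * Real.pi))) := by rw [zero_add]; exact hf
  have := measurePreserving_rep.integrable_comp_of_integrable h1
  simpa [Function.comp_def] using this

/-! ### Fourier uniqueness and the lemma of du Bois-Reymond. -/

theorem hasDerivAt_sin_mul (c x : ℝ) :
    HasDerivAt (fun x => Real.sin (c * x)) (c * Real.cos (c * x)) x := by
  have := (Real.hasDerivAt_sin (c * x)).comp x ((hasDerivAt_id x).const_mul c)
  rw [mul_one, mul_comm] at this
  exact this

theorem hasDerivAt_cos_mul (c x : ℝ) :
    HasDerivAt (fun x => Real.cos (c * x)) (-(c * Real.sin (c * x))) x := by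
  have := (Real.hasDerivAt_cos (c * x)).comp x ((hasDerivAt_id x).const_mul c)
  rw [mul_one, neg_mul, mul_comm] at this
  exact this

theorem integral_cos_int {n : ℤ} (hn : n ≠ 0) :
    ∫ x in (0 : ℝ)..2 * Real.pi, Real.cos (n * x) = 0 := by
  have hn' : (n : ℝ) ≠ 0 := by exact_mod_cast hn
  rw [intervalIntegral.integral_comp_mul_left (fun x => Real.cos x) hn', integral_cos]
  have : Real.sin (n * (2 * Real.pi)) = 0 := by
    have := Real.sin_int_mul_pi (n * 2); push_cast at this; rw [← this]; ring_nf
  simp [this]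

theorem integral_sin_int (n : ℤ) :
    ∫ x in (0 : ℝ)..2 * Real.pi, Real.sin (n * x) = 0 := by
  by_cases hn : n = 0
  · simp [hn]
  have hn' : (n : ℝ) ≠ 0 := by exact_mod_cast hn
  rw [intervalIntegral.integral_comp_mul_left (fun x => Real.sin x) hn', integral_sin]
  simp [Real.cos_int_mul_two_pi]

/-- A continuous periodic function orthogonal to all nonconstant trigonometric monomials is
constant. -/
theorem const_of_fourier {H : ℝ → ℝ} (hc : Continuous H) (hp : Function.Periodic H (2 * Real.pi))
    (h1 : ∀ n : ℤ, n ≠ 0 → ∫ x in (0 : ℝ)..2 * Real.pi, Real.cos (n * x) * H x = 0)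
    (h2 : ∀ n : ℤ, n ≠ 0 → ∫ x in (0 : ℝ)..2 * Real.pi, Real.sin (n * x) * H x = 0) (x y : ℝ) :
    H x = H y := by
  have hpc : Function.Periodic (fun s => (H s : ℂ)) (2 * Real.pi) := fun s => by simp [hp s]
  have hcc : Continuous (hpc.lift : Circ → ℂ) := by
    refine continuous_quot_lift _ ?_
    exact Complex.continuous_ofReal.comp hc
  set f : C(Circ, ℂ) := ⟨hpc.lift, hcc⟩ with hf
  have hcoef : ∀ n : ℤ, n ≠ 0 → fourierCoeff f n = 0 := by
    intro n hn
    rw [fourierCoeff_eq_intervalIntegral f n 0, zero_add]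
    have e : ∀ s : ℝ, (fourier (-n) (s : Circ) : ℂ) • f (s : Circ) =
        ((Real.cos (n * s) * H s : ℝ) : ℂ) - Complex.I * ((Real.sin (n * s) * H s : ℝ) : ℂ) := by
      intro s
      have e1 : f (s : Circ) = (H s : ℂ) := hpc.lift_coe s
      rw [e1, fourier_coe_apply]
      have e2 : 2 * (Real.pi : ℂ) * Complex.I * ((-n : ℤ) : ℂ) * s / ((2 * Real.pi : ℝ) : ℂ) =
          ((-(n * s) : ℝ) : ℂ) * Complex.I := by
        have : (Real.pi : ℂ) ≠ 0 := by exact_mod_cast Real.pi_ne_zero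
        push_cast
        field_simp
      rw [e2, Complex.exp_mul_I, ← Complex.ofReal_cos, ← Complex.ofReal_sin, Real.cos_neg,
        Real.sin_neg, smul_eq_mul]
      push_cast
      ring
    simp_rw [e]
    rw [intervalIntegral.integral_sub, intervalIntegral.integral_const_mul,
      intervalIntegral.integral_ofReal, intervalIntegral.integral_ofReal, h1 n hn, h2 n hn]
    · simp
    · exact Continuous.intervalIntegrable (by fun_prop) _ _
    · exact Continuous.intervalIntegrable (by fun_prop) _ _
  -- Only the zeroth coefficient can be nonzero, so the Fourier series is summable and represents
  -- the function pointwise.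
  have hsum : Summable (fourierCoeff f) :=
    summable_of_ne_finset_zero (s := {0}) (fun n hn => hcoef n (by simpa using hn))
  have hx : ∀ x : ℝ, (H x : ℂ) = fourierCoeff f 0 := by
    intro x
    have h := has_pointwise_sum_fourier_series_of_summable hsum (x : Circ)
    have h' : HasSum (fun i => fourierCoeff f i • fourier i (x : Circ))
        (fourierCoeff f 0 • fourier 0 (x : Circ)) :=
      hasSum_single 0 (fun n hn => by rw [hcoef n hn, zero_smul])
    have := h.unique h'
    rw [show f (x : Circ) = (H x : ℂ) from hpc.lift_coe x] at this
    simpa using this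
  exact_mod_cast (hx x).trans (hx y).symm

/-- A periodic integrable function orthogonal to all trigonometric monomials vanishes. -/
theorem ae_zero_of_fourier {h : ℝ → ℝ} (hp : Function.Periodic h (2 * Real.pi))
    (hi : ∀ a b, IntervalIntegrable h volume a b)
    (h1 : ∀ n : ℤ, ∫ x in (0 : ℝ)..2 * Real.pi, Real.cos (n * x) * h x = 0)
    (h2 : ∀ n : ℤ, ∫ x in (0 : ℝ)..2 * Real.pi, Real.sin (n * x) * h x = 0) :
    ∀ᵐ x, h x = 0 := by
  -- The primitive is periodic because `n = 0` in `h1` gives mean zero; integration by parts passes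
  -- the orthogonality on to it, so it is constant and its derivative vanishes.
  set H : ℝ → ℝ := fun x => ∫ t in (0 : ℝ)..x, h t with hH
  have hprim : IsPrimitive H h := ⟨hi, fun a b => by
    rw [hH]; exact (intervalIntegral.integral_interval_sub_left (hi 0 b) (hi 0 a)).symm⟩
  have h0 : ∫ x in (0 : ℝ)..2 * Real.pi, h x = 0 := by simpa using h1 0
  have hH0 : H 0 = 0 := by simp [hH]
  have hH1 : H (2 * Real.pi) = 0 := h0
  have hper : Function.Periodic H (2 * Real.pi) := by
    intro x
    have e : H (x + 2 * Real.pi) - H x = ∫ t in x..x + 2 * Real.pi, h t := (hprim.2 _ _).symm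
    rw [hp.intervalIntegral_add_eq x 0, zero_add, h0] at e
    linarith
  have key := const_of_fourier hprim.continuous hper ?_ ?_
  · filter_upwards [hprim.ae_hasDerivAt] with x hx
    have e : H = fun _ => H 0 := funext fun y => key y 0
    rw [e] at hx
    exact hx.unique (hasDerivAt_const x _)
  · intro n hn
    have hn' : (n : ℝ) ≠ 0 := by exact_mod_cast hn
    have hs : IsPrimitive (fun x => Real.sin (n * x) / n) (fun x => Real.cos (n * x)) := by
      refine IsPrimitive.of_hasDerivAt (fun x => ?_) (by fun_prop)
      have := (hasDerivAt_sin_mul n x).div_const (n : ℝ)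
      rwa [mul_div_cancel_left₀ _ hn'] at this
    have := hprim.integral_mul hs 0 (2 * Real.pi)
    simp_rw [mul_comm (Real.cos _)]
    rw [this, hH0, hH1]
    have e : ∀ x, h x * (Real.sin (n * x) / n) = (1 / n) * (Real.sin (n * x) * h x) := fun x => by
      ring
    simp_rw [e]
    rw [intervalIntegral.integral_const_mul, h2 n]
    simp
  · intro n hn
    have hn' : (n : ℝ) ≠ 0 := by exact_mod_cast hn
    have hs : IsPrimitive (fun x => -(Real.cos (n * x) / n)) (fun x => Real.sin (n * x)) := by
      refine IsPrimitive.of_hasDerivAt (fun x => ?_) (by fun_prop)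
      have := ((hasDerivAt_cos_mul n x).div_const (n : ℝ)).neg
      rwa [neg_div, neg_neg, mul_div_cancel_left₀ _ hn'] at this
    have := hprim.integral_mul hs 0 (2 * Real.pi)
    simp_rw [mul_comm (Real.sin _)]
    rw [this, hH0, hH1]
    have e : ∀ x, h x * -(Real.cos (n * x) / n) = (-1 / n) * (Real.cos (n * x) * h x) := fun x => by
      ring
    simp_rw [e]
    rw [intervalIntegral.integral_const_mul, h1 n]
    simp

/-- The lemma of du Bois-Reymond, tested with trigonometric monomials. -/
theorem exists_primitive_of_fourier {f g : ℝ → ℝ} (pf : Function.Periodic f (2 * Real.pi))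
    (pg : Function.Periodic g (2 * Real.pi))
    (hf : ∀ a b, IntervalIntegrable f volume a b) (hg : ∀ a b, IntervalIntegrable g volume a b)
    (h1 : ∀ n : ℤ, ∫ x in (0 : ℝ)..2 * Real.pi, (n * Real.cos (n * x)) * f x =
      -∫ x in (0 : ℝ)..2 * Real.pi, Real.sin (n * x) * g x)
    (h2 : ∀ n : ℤ, ∫ x in (0 : ℝ)..2 * Real.pi, (-(n * Real.sin (n * x))) * f x =
      -∫ x in (0 : ℝ)..2 * Real.pi, Real.cos (n * x) * g x) :
    ∃ P : ℝ → ℝ, Function.Periodic P (2 * Real.pi) ∧ IsPrimitive P g ∧ ∀ᵐ x, f x = P x := by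
  set G : ℝ → ℝ := fun x => ∫ t in (0 : ℝ)..x, g t with hG
  have hprim : IsPrimitive G g := ⟨hg, fun a b => by
    rw [hG]; exact (intervalIntegral.integral_interval_sub_left (hg 0 b) (hg 0 a)).symm⟩
  have h0 : ∫ x in (0 : ℝ)..2 * Real.pi, g x = 0 := by simpa using h2 0
  have hper : Function.Periodic G (2 * Real.pi) := by
    intro x
    have e : G (x + 2 * Real.pi) - G x = ∫ t in x..x + 2 * Real.pi, g t := (hprim.2 _ _).symm
    rw [pg.intervalIntegral_add_eq x 0, zero_add, h0] at e
    linarith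
  have hG0 : G 0 = 0 := by simp [hG]
  have hG1 : G (2 * Real.pi) = 0 := h0
  -- The mean of `f - G`: this normalization handles the frequency `n = 0`; the other frequencies
  -- come from integration by parts.
  set c : ℝ := (1 / (2 * Real.pi)) * ∫ x in (0 : ℝ)..2 * Real.pi, (f x - G x) with hc
  have hGi : ∀ a b, IntervalIntegrable G volume a b := fun a b =>
    hprim.continuous.intervalIntegrable a b
  refine ⟨fun x => G x + c, fun x => by simp [hper x], ?_, ?_⟩
  · simpa using hprim.add (IsPrimitive.const c)
  have key : ∀ᵐ x, f x - G x - c = 0 := by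
    refine ae_zero_of_fourier (fun x => by simp [pf x, hper x]) (fun a b =>
      ((hf a b).sub (hGi a b)).sub intervalIntegrable_const) ?_ ?_
    · intro n
      have e : ∀ x, Real.cos (n * x) * (f x - G x - c) =
        Real.cos (n * x) * f x - Real.cos (n * x) * G x - c * Real.cos (n * x) := fun x => by ring
      have cc : ∀ g : ℝ → ℝ, IntervalIntegrable g volume 0 (2 * Real.pi) →
          IntervalIntegrable (fun x => Real.cos (n * x) * g x) volume 0 (2 * Real.pi) := fun g hg =>
        hg.continuousOn_mul (by fun_prop)
      by_cases hn : n = 0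
      · subst hn
        simp only [Int.cast_zero, zero_mul, Real.cos_zero, one_mul]
        rw [intervalIntegral.integral_sub ((hf _ _).sub (hGi _ _)) intervalIntegrable_const,
          intervalIntegral.integral_const, hc]
        have := Real.pi_ne_zero
        simp only [sub_zero, smul_eq_mul]
        field_simp
        ring
      have hn' : (n : ℝ) ≠ 0 := by exact_mod_cast hn
      simp_rw [e]
      rw [intervalIntegral.integral_sub ((cc _ (hf _ _)).sub (cc _ (hGi _ _)))
        (Continuous.intervalIntegrable (by fun_prop) _ _),
        intervalIntegral.integral_sub (cc _ (hf _ _)) (cc _ (hGi _ _)),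
        intervalIntegral.integral_const_mul, integral_cos_int hn]
      have hs : IsPrimitive (fun x => Real.sin (n * x)) (fun x => n * Real.cos (n * x)) := by
        exact IsPrimitive.of_hasDerivAt (fun x => hasDerivAt_sin_mul n x) (by fun_prop)
      have h3 := hprim.integral_mul hs 0 (2 * Real.pi)
      rw [hG0, hG1] at h3
      have h4 := h1 n
      simp_rw [mul_assoc] at h4
      rw [intervalIntegral.integral_const_mul] at h4
      have e3 : ∀ x, G x * (n * Real.cos (n * x)) = n * (Real.cos (n * x) * G x) := fun x => by ring
      have e4 : ∀ x, g x * Real.sin (n * x) = Real.sin (n * x) * g x := fun x => by ring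
      simp_rw [e3, e4] at h3
      rw [intervalIntegral.integral_const_mul] at h3
      have : (n : ℝ) * ((∫ x in (0 : ℝ)..2 * Real.pi, Real.cos (n * x) * f x) -
          ∫ x in (0 : ℝ)..2 * Real.pi, Real.cos (n * x) * G x) = 0 := by
        rw [mul_sub, h3, h4]; ring
      rcases mul_eq_zero.1 this with h | h
      · exact absurd h hn'
      · rw [h]; ring
    · intro n
      have e : ∀ x, Real.sin (n * x) * (f x - G x - c) =
        Real.sin (n * x) * f x - Real.sin (n * x) * G x - c * Real.sin (n * x) := fun x => by ring
      have cc : ∀ g : ℝ → ℝ, IntervalIntegrable g volume 0 (2 * Real.pi) →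
          IntervalIntegrable (fun x => Real.sin (n * x) * g x) volume 0 (2 * Real.pi) := fun g hg =>
        hg.continuousOn_mul (by fun_prop)
      by_cases hn : n = 0
      · simp [hn]
      have hn' : (n : ℝ) ≠ 0 := by exact_mod_cast hn
      simp_rw [e]
      rw [intervalIntegral.integral_sub ((cc _ (hf _ _)).sub (cc _ (hGi _ _)))
        (Continuous.intervalIntegrable (by fun_prop) _ _),
        intervalIntegral.integral_sub (cc _ (hf _ _)) (cc _ (hGi _ _)),
        intervalIntegral.integral_const_mul, integral_sin_int n]
      have hs : IsPrimitive (fun x => Real.cos (n * x)) (fun x => -(n * Real.sin (n * x))) := by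
        exact IsPrimitive.of_hasDerivAt (fun x => hasDerivAt_cos_mul n x) (by fun_prop)
      have h3 := hprim.integral_mul hs 0 (2 * Real.pi)
      rw [hG0, hG1] at h3
      have h4 := h2 n
      have e3 : ∀ x, G x * (-(n * Real.sin (n * x))) = (-n) * (Real.sin (n * x) * G x) :=
        fun x => by ring
      have e4 : ∀ x, g x * Real.cos (n * x) = Real.cos (n * x) * g x := fun x => by ring
      have e5 : ∀ x, -(n * Real.sin (n * x)) * f x = (-n) * (Real.sin (n * x) * f x) :=
        fun x => by ring
      simp_rw [e3, e4] at h3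
      simp_rw [e5] at h4
      rw [intervalIntegral.integral_const_mul] at h3 h4
      have : (-n : ℝ) * ((∫ x in (0 : ℝ)..2 * Real.pi, Real.sin (n * x) * f x) -
          ∫ x in (0 : ℝ)..2 * Real.pi, Real.sin (n * x) * G x) = 0 := by
        rw [mul_sub, h3, h4]; ring
      rcases mul_eq_zero.1 this with h | h
      · exact absurd (neg_eq_zero.1 h) hn'
      · rw [h]; ring
  filter_upwards [key] with x hx
  linarith

/-! ### Weak derivatives on the circle and absolutely continuous representatives. -/

theorem integral_apply {f : Circ → E3} (hf : Integrable f) (i : Fin 3) :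
    (∫ x, f x) i = ∫ x, f x i :=
  ((EuclideanSpace.proj i : E3 →L[ℝ] ℝ).integral_comp_comm hf).symm

theorem integrable_apply {f : Circ → E3} (hf : Integrable f) (i : Fin 3) :
    Integrable (fun x => f x i) :=
  (EuclideanSpace.proj i : E3 →L[ℝ] ℝ).integrable_comp hf

theorem integrable_smul_of_continuous {φ : Circ → ℝ} (hφ : Continuous φ) {f : Circ → E3}
    (hf : Integrable f) : Integrable (fun x => φ x • f x) := by
  obtain ⟨C, hC⟩ := isCompact_univ.exists_bound_of_continuousOn hφ.continuousOn
  have hm : AEStronglyMeasurable φ (volume : Measure Circ) := hφ.aestronglyMeasurable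
  have hb : ∀ᵐ x : Circ, ‖φ x‖ ≤ C := Filter.Eventually.of_forall fun x => hC x (Set.mem_univ x)
  exact Integrable.bdd_smul (𝕜 := ℝ) (φ := φ) hf C hm hb

theorem continuous_circ {B : Type*} [TopologicalSpace B] {f : Circ → B}
    (h : Continuous (fun s : ℝ => f (s : Circ))) : Continuous f :=
  (QuotientAddGroup.isQuotientMap_mk (N := AddSubgroup.zmultiples (2 * Real.pi))).continuous_iff.2 h

theorem weakDeriv_test {u v : Circ → E3} (h : IsWeakDeriv u v) {a a' : ℝ → ℝ}
    (pa : Function.Periodic a (2 * Real.pi)) (pa' : Function.Periodic a' (2 * Real.pi))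
    (sa : ContDiff ℝ ∞ a) (ca' : Continuous a') (hd : ∀ s, HasDerivAt a (a' s) s) (i : Fin 3) :
    ∫ s in (0 : ℝ)..2 * Real.pi, a' s * u (s : Circ) i =
      -∫ s in (0 : ℝ)..2 * Real.pi, a s * v (s : Circ) i := by
  have e := h.2.2 (pa.lift : Circ → ℝ) (pa'.lift : Circ → ℝ)
    (by simpa using sa) (by simpa using hd)
  have c1 : Continuous (pa.lift : Circ → ℝ) := continuous_circ (by simpa using sa.continuous)
  have c2 : Continuous (pa'.lift : Circ → ℝ) := continuous_circ (by simpa using ca')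
  have e2 := congrArg (fun w : E3 => w i) e
  simp only [PiLp.neg_apply] at e2
  rw [integral_apply (integrable_smul_of_continuous c2 h.1),
    integral_apply (integrable_smul_of_continuous c1 h.2.1), integral_circ, integral_circ] at e2
  simpa using e2

/-- Sines and cosines of integer frequency are admissible smooth test functions, and they are all
that the du Bois-Reymond lemma needs. -/
theorem IsWeakDeriv.exists_primitive {u v : Circ → E3} (h : IsWeakDeriv u v) (i : Fin 3) :
    ∃ P : ℝ → ℝ, Function.Periodic P (2 * Real.pi) ∧ IsPrimitive P (fun s => v (s : Circ) i) ∧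
      ∀ᵐ s : ℝ, u (s : Circ) i = P s := by
  have ps : ∀ n : ℤ, Function.Periodic (fun s : ℝ => Real.sin (n * s)) (2 * Real.pi) := by
    intro n s
    simp only [mul_add]
    exact Real.sin_add_int_mul_two_pi _ n
  have pc : ∀ n : ℤ, Function.Periodic (fun s : ℝ => Real.cos (n * s)) (2 * Real.pi) := by
    intro n s
    simp only [mul_add]
    exact Real.cos_add_int_mul_two_pi _ n
  refine exists_primitive_of_fourier (periodic_coe fun x => u x i) (periodic_coe fun x => v x i)
    (intervalIntegrable_coe (integrable_apply h.1 i))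
    (intervalIntegrable_coe (integrable_apply h.2.1 i)) (fun n => ?_) (fun n => ?_)
  · refine weakDeriv_test h (ps n) (fun s => by simp [pc n s]) ?_ (by fun_prop) (fun s => ?_) i
    · exact Real.contDiff_sin.comp (contDiff_const.mul contDiff_id)
    · exact hasDerivAt_sin_mul n s
  · refine weakDeriv_test h (pc n) (fun s => by simp [ps n s]) ?_ (by fun_prop) (fun s => ?_) i
    · exact Real.contDiff_cos.comp (contDiff_const.mul contDiff_id)
    · exact hasDerivAt_cos_mul n s

theorem isWeakDeriv_of_primitive {u v : Circ → E3} (hu : Integrable u) (hv : Integrable v)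
    (h : ∀ i, IsPrimitive (fun s : ℝ => u (s : Circ) i) (fun s : ℝ => v (s : Circ) i)) :
    IsWeakDeriv u v := by
  refine ⟨hu, hv, fun φ φ' hφ hd => ?_⟩
  have ed : deriv (fun s : ℝ => φ (s : Circ)) = fun s : ℝ => φ' (s : Circ) :=
    funext fun s => (hd s).deriv
  have c1 : Continuous φ := continuous_circ hφ.continuous
  have c2' : Continuous (fun s : ℝ => φ' (s : Circ)) := by
    rw [← ed]; exact hφ.continuous_deriv (by simp)
  have c2 : Continuous φ' := continuous_circ c2'
  ext i
  rw [integral_apply (integrable_smul_of_continuous c2 hu), PiLp.neg_apply,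
    integral_apply (integrable_smul_of_continuous c1 hv), integral_circ, integral_circ]
  have key := (h i).integral_mul (IsPrimitive.of_hasDerivAt hd c2') 0 (2 * Real.pi)
  have e1 : ((2 * Real.pi : ℝ) : Circ) = ((0 : ℝ) : Circ) := by simp
  rw [e1, sub_self, zero_sub] at key
  simpa [mul_comm] using key

/-- The continuous primitives of both candidates agree almost everywhere, hence everywhere. This
controls `weakDeriv`, which is defined by choice. -/
theorem IsWeakDeriv.ae_unique {u v w : Circ → E3} (h : IsWeakDeriv u v) (h' : IsWeakDeriv u w) :
    ∀ᵐ x, v x = w x := by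
  rw [ae_circ_iff]
  have key : ∀ i, ∀ᵐ s : ℝ, v (s : Circ) i = w (s : Circ) i := by
    intro i
    obtain ⟨P, -, hP, eP⟩ := h.exists_primitive i
    obtain ⟨Q, -, hQ, eQ⟩ := h'.exists_primitive i
    have e : P = Q := by
      refine (Continuous.ae_eq_iff_eq volume hP.continuous hQ.continuous).1 ?_
      filter_upwards [eP, eQ] with s h1 h2
      rw [← h1, ← h2]
    subst e
    filter_upwards [hP.ae_hasDerivAt, hQ.ae_hasDerivAt] with s h1 h2 using h1.unique h2
  filter_upwards [ae_all_iff.2 key] with s hs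
  ext i; exact hs i

end Elastica

/-! ### The moving frame of a spherical curve, its height and its winding number. -/

namespace Elastica

/-- The vectors (x, y, z), (a, b, c), (q, r, t) play the roles of γ, γ', γ'', so that γ'' = −γ + κ γ
× γ'. Taking norms gives κ² = |γ''|² − 1. The third component gives κ (γ × γ')₃ = u'' + u, and (γ ×
γ')₃² = 1 − u² − u'². -/
theorem frame_identities {x y z a b c q r t : ℝ} (h1 : x ^ 2 + y ^ 2 + z ^ 2 = 1)
    (h2 : a ^ 2 + b ^ 2 + c ^ 2 = 1) (h3 : x * a + y * b + z * c = 0)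
    (h4 : q * x + r * y + t * z = -1) (h5 : q * a + r * b + t * c = 0) :
    (q * (y * c - z * b) + r * (z * a - x * c) + t * (x * b - y * a)) ^ 2 =
      q ^ 2 + r ^ 2 + t ^ 2 - 1 ∧
    (q * (y * c - z * b) + r * (z * a - x * c) + t * (x * b - y * a)) ^ 2 * (1 - z ^ 2 - c ^ 2) =
      (t + z) ^ 2 := by
  have e1 : (q * (y * c - z * b) + r * (z * a - x * c) + t * (x * b - y * a)) ^ 2 =
      (q ^ 2 + r ^ 2 + t ^ 2) * ((x ^ 2 + y ^ 2 + z ^ 2) * (a ^ 2 + b ^ 2 + c ^ 2) -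
        (x * a + y * b + z * c) ^ 2) -
      (q * x + r * y + t * z) * ((q * x + r * y + t * z) * (a ^ 2 + b ^ 2 + c ^ 2) -
        (q * a + r * b + t * c) * (x * a + y * b + z * c)) +
      (q * a + r * b + t * c) * ((q * x + r * y + t * z) * (x * a + y * b + z * c) -
        (q * a + r * b + t * c) * (x ^ 2 + y ^ 2 + z ^ 2)) := by ring
  have e2 : (q * (y * c - z * b) + r * (z * a - x * c) + t * (x * b - y * a)) * (x * b - y * a) =
      t * ((x ^ 2 + y ^ 2 + z ^ 2) * (a ^ 2 + b ^ 2 + c ^ 2) - (x * a + y * b + z * c) ^ 2) -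
      (q * x + r * y + t * z) * (z * (a ^ 2 + b ^ 2 + c ^ 2) - c * (x * a + y * b + z * c)) +
      (q * a + r * b + t * c) * (z * (x * a + y * b + z * c) - c * (x ^ 2 + y ^ 2 + z ^ 2)) := by
    ring
  have e3 : (x * b - y * a) ^ 2 = 1 - z ^ 2 - c ^ 2 := by
    have : (x * b - y * a) ^ 2 = (x ^ 2 + y ^ 2 + z ^ 2 - z ^ 2) * (a ^ 2 + b ^ 2 + c ^ 2 - c ^ 2) -
      (x * a + y * b + z * c - z * c) ^ 2 := by ring
    rw [this, h1, h2, h3]; ring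
  rw [h1, h2, h3, h4, h5] at e1 e2
  constructor
  · rw [e1]; ring
  · rw [← e3, ← mul_pow, e2]; ring

theorem sum_sq_three (v : E3) : ‖v‖ = 1 → v 0 ^ 2 + v 1 ^ 2 + v 2 ^ 2 = 1 := by
  intro h
  have := EuclideanSpace.norm_sq_eq v
  rw [h, Fin.sum_univ_three] at this
  simpa using this.symm

theorem eq_of_ae_of_continuous {f g : ℝ → ℝ} (hf : Continuous f) (hg : Continuous g)
    (h : ∀ᵐ s, f s = g s) (s : ℝ) : f s = g s :=
  congrFun ((Continuous.ae_eq_iff_eq volume hf hg).1 h) s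

/-- Classical description of the curves in `Y ε`. -/
theorem exists_lift_of_mem_Y {ε : ℝ} {γ : Circ → E3} (h : γ ∈ Y ε) :
    ∃ P Q : Fin 3 → ℝ → ℝ, (∀ i, IsPer2 (fun s => γ (s : Circ) i) (P i) (Q i)) ∧
      (∀ s : ℝ, γ (s : Circ) 0 ^ 2 + γ (s : Circ) 1 ^ 2 + γ (s : Circ) 2 ^ 2 = 1) ∧
      (∀ s : ℝ, P 0 s ^ 2 + P 1 s ^ 2 + P 2 s ^ 2 = 1) ∧
      (∀ s : ℝ, γ (s : Circ) 0 * P 0 s + γ (s : Circ) 1 * P 1 s + γ (s : Circ) 2 * P 2 s = 0) ∧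
      energy γ = ∫ s in (0 : ℝ)..2 * Real.pi, (Q 0 s ^ 2 + Q 1 s ^ 2 + Q 2 s ^ 2 - 1) ∧
      ∀ᵐ s : ℝ, 0 ≤ Q 0 s ^ 2 + Q 1 s ^ 2 + Q 2 s ^ 2 - 1 ∧
        (Q 0 s ^ 2 + Q 1 s ^ 2 + Q 2 s ^ 2 - 1) * (1 - γ (s : Circ) 2 ^ 2 - P 2 s ^ 2) =
          (Q 2 s + γ (s : Circ) 2) ^ 2 := by
  obtain ⟨hc, ⟨-, hw1, -, hw2, hm2⟩, hs, hn, -⟩ := h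
  have w1 := isWeakDeriv_weakDeriv hw1
  have w2 := isWeakDeriv_weakDeriv hw2
  choose R hRp hR hRe using fun i => w1.exists_primitive i
  choose P hPp hP hPe using fun i => w2.exists_primitive i
  set Q : Fin 3 → ℝ → ℝ := fun i s => weakDeriv (weakDeriv γ) (s : Circ) i with hQ
  have cγ : ∀ i, Continuous (fun s : ℝ => γ (s : Circ) i) := fun i =>
    (EuclideanSpace.proj i : E3 →L[ℝ] ℝ).continuous.comp
      (hc.comp (AddCircle.continuous_mk' (2 * Real.pi)))
  -- Both sides are continuous, so almost everywhere equality becomes equality. The same principle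
  -- makes γ of class C¹ and the unit-speed identity valid everywhere.
  have hRγ : ∀ i, R i = fun s : ℝ => γ (s : Circ) i := fun i =>
    ((Continuous.ae_eq_iff_eq volume (cγ i) (hR i).continuous).1 (hRe i)).symm
  have hγP : ∀ i s, HasDerivAt (fun s : ℝ => γ (s : Circ) i) (P i s) s := by
    intro i s
    have := (hR i).congr (hPe i)
    rw [hRγ i] at this
    exact this.hasDerivAt (hP i).continuous s
  have per : ∀ i, IsPer2 (fun s => γ (s : Circ) i) (P i) (Q i) := by
    intro i
    refine ⟨periodic_coe fun x => γ x i, hPp i, periodic_coe fun x => weakDeriv (weakDeriv γ) x i,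
      hγP i, hP i, ?_⟩
    have h1 : MemLp (fun x => weakDeriv (weakDeriv γ) x i) 2 :=
      (EuclideanSpace.proj i : E3 →L[ℝ] ℝ).comp_memLp' hm2
    exact intervalIntegrable_coe h1.integrable_sq
  have s1 : ∀ s : ℝ, γ (s : Circ) 0 ^ 2 + γ (s : Circ) 1 ^ 2 + γ (s : Circ) 2 ^ 2 = 1 := fun s =>
    sum_sq_three _ (by simpa using hs (s : Circ))
  have s2 : ∀ s : ℝ, P 0 s ^ 2 + P 1 s ^ 2 + P 2 s ^ 2 = 1 := by
    refine eq_of_ae_of_continuous ?_ continuous_const ?_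
    · exact (((hP 0).continuous.pow 2).add ((hP 1).continuous.pow 2)).add ((hP 2).continuous.pow 2)
    · filter_upwards [ae_circ_iff.1 hn, hPe 0, hPe 1, hPe 2] with s h0 h1 h2 h3
      rw [← h1, ← h2, ← h3]
      exact sum_sq_three _ h0
  have s3 : ∀ s : ℝ, γ (s : Circ) 0 * P 0 s + γ (s : Circ) 1 * P 1 s + γ (s : Circ) 2 * P 2 s = 0 := by
    intro s
    have d := (((hγP 0 s).pow 2).add ((hγP 1 s).pow 2)).add ((hγP 2 s).pow 2)
    have e : ((fun s : ℝ => γ (s : Circ) 0) ^ 2 + (fun s : ℝ => γ (s : Circ) 1) ^ 2 +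
      (fun s : ℝ => γ (s : Circ) 2) ^ 2) = fun _ => (1 : ℝ) := funext s1
    rw [e] at d
    have := d.unique (hasDerivAt_const s 1)
    simp only [Nat.cast_ofNat, Nat.add_one_sub_one, pow_one] at this
    linarith
  have ae1 : ∀ᵐ s : ℝ, geodesicCurvature γ (s : Circ) ^ 2 =
        Q 0 s ^ 2 + Q 1 s ^ 2 + Q 2 s ^ 2 - 1 ∧
      geodesicCurvature γ (s : Circ) ^ 2 * (1 - γ (s : Circ) 2 ^ 2 - P 2 s ^ 2) =
          (Q 2 s + γ (s : Circ) 2) ^ 2 := by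
    filter_upwards [hPe 0, hPe 1, hPe 2, (hP 0).ae_hasDerivAt, (hP 1).ae_hasDerivAt,
      (hP 2).ae_hasDerivAt] with s e0 e1 e2 d0 d1 d2
    -- Differentiating γ·γ' = 0 and |γ'|² = 1 gives γ''·γ = −1 and γ''·γ' = 0 almost everywhere.
    have h4 : Q 0 s * γ (s : Circ) 0 + Q 1 s * γ (s : Circ) 1 + Q 2 s * γ (s : Circ) 2 = -1 := by
      have d := (((hγP 0 s).mul d0).add ((hγP 1 s).mul d1)).add ((hγP 2 s).mul d2)
      have e : ((fun s : ℝ => γ (s : Circ) 0) * P 0 + (fun s : ℝ => γ (s : Circ) 1) * P 1 +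
        (fun s : ℝ => γ (s : Circ) 2) * P 2) = fun _ => (0 : ℝ) := funext s3
      rw [e] at d
      have := d.unique (hasDerivAt_const s 0)
      have := s2 s
      simp only [hQ]
      linarith
    have h5 : Q 0 s * P 0 s + Q 1 s * P 1 s + Q 2 s * P 2 s = 0 := by
      have d := ((d0.pow 2).add (d1.pow 2)).add (d2.pow 2)
      have e : (P 0 ^ 2 + P 1 ^ 2 + P 2 ^ 2) = fun _ => (1 : ℝ) := funext s2
      rw [e] at d
      have := d.unique (hasDerivAt_const s 1)
      simp only [Nat.cast_ofNat, Nat.add_one_sub_one, pow_one] at this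
      simp only [hQ]
      linarith
    have key := frame_identities (s1 s) (s2 s) (s3 s) h4 h5
    have eκ : geodesicCurvature γ (s : Circ) =
        Q 0 s * (γ (s : Circ) 1 * P 2 s - γ (s : Circ) 2 * P 1 s) +
        Q 1 s * (γ (s : Circ) 2 * P 0 s - γ (s : Circ) 0 * P 2 s) +
        Q 2 s * (γ (s : Circ) 0 * P 1 s - γ (s : Circ) 1 * P 0 s) := by
      rw [geodesicCurvature, cross_apply, Matrix.vec3_dotProduct]
      simp only [Matrix.cons_val_zero, Matrix.cons_val_one, Matrix.cons_val, hQ]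
      rw [e0, e1, e2]
    rw [eκ]
    exact key
  refine ⟨P, Q, per, s1, s2, s3, ?_, ?_⟩
  · rw [energy, integral_circ]
    refine intervalIntegral.integral_congr_ae ?_
    filter_upwards [ae1] with s hs _ using hs.1
  · filter_upwards [ae1] with s hs
    rw [← hs.1]
    exact ⟨sq_nonneg _, hs.2⟩

/-- The winding number of a closed plane curve avoiding the origin is an integer. -/
theorem exists_winding {x y x' y' : ℝ → ℝ} (hx : ∀ s, HasDerivAt x (x' s) s)
    (hy : ∀ s, HasDerivAt y (y' s) s) (cx' : Continuous x') (cy' : Continuous y')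
    (px : Function.Periodic x (2 * Real.pi)) (py : Function.Periodic y (2 * Real.pi))
    (h0 : ∀ s, 0 < x s ^ 2 + y s ^ 2) :
    ∃ k : ℤ, ∫ s in (0 : ℝ)..2 * Real.pi, (x s * y' s - y s * x' s) / (x s ^ 2 + y s ^ 2) =
      2 * Real.pi * k := by
  have cx : Continuous x := continuous_iff_continuousAt.2 fun s => (hx s).continuousAt
  have cy : Continuous y := continuous_iff_continuousAt.2 fun s => (hy s).continuousAt
  set α : ℝ → ℝ := fun s => (x s * x' s + y s * y' s) / (x s ^ 2 + y s ^ 2) with hα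
  set β : ℝ → ℝ := fun s => (x s * y' s - y s * x' s) / (x s ^ 2 + y s ^ 2) with hβ
  have cα : Continuous α := by
    refine Continuous.div (by fun_prop) (by fun_prop) fun s => (h0 s).ne'
  have cβ : Continuous β := by
    refine Continuous.div (by fun_prop) (by fun_prop) fun s => (h0 s).ne'
  set w : ℝ → ℂ := fun s => (α s : ℂ) + Complex.I * β s with hw
  have cw : Continuous w := by fun_prop
  set W : ℝ → ℂ := fun s => ∫ t in (0 : ℝ)..s, w t with hW
  have dW : ∀ s, HasDerivAt W (w s) s := fun s => (cw.integral_hasStrictDerivAt 0 s).hasDerivAt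
  set z : ℝ → ℂ := fun s => (x s : ℂ) + Complex.I * y s with hz
  have dz : ∀ s, HasDerivAt z ((x' s : ℂ) + Complex.I * y' s) s := fun s =>
    (hx s).ofReal_comp.add ((hy s).ofReal_comp.const_mul Complex.I)
  have ez : ∀ s, ((x' s : ℂ) + Complex.I * y' s) = z s * w s := by
    intro s
    have hr : ((x s : ℂ) ^ 2 + (y s : ℂ) ^ 2) ≠ 0 := by exact_mod_cast (h0 s).ne'
    simp only [hz, hw, hα, hβ]
    push_cast
    field_simp
    ring_nf
    simp only [Complex.I_sq]
    ring
  -- With z = x + iy and w = z'/z, the product z exp(−∫ w) is constant. Periodicity of z makes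
  -- exp(−∫ w) equal to 1 over a period, and the imaginary part of w is the angular speed.
  have dq : ∀ s, HasDerivAt (fun s => z s * Complex.exp (-W s)) 0 s := by
    intro s
    have := (dz s).mul (dW s).neg.cexp
    exact this.congr_deriv (by rw [ez s, Pi.neg_apply]; ring)
  have hconst := is_const_of_deriv_eq_zero (fun s => (dq s).differentiableAt)
    (fun s => (dq s).deriv) (2 * Real.pi) 0
  have hz1 : z (2 * Real.pi) = z 0 := by
    have e1 := px 0
    have e2 := py 0
    rw [zero_add] at e1 e2
    simp [hz, e1, e2]
  have hz0 : z 0 ≠ 0 := by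
    intro h
    have hre : x 0 = 0 := by simpa [hz] using congrArg Complex.re h
    have him : y 0 = 0 := by simpa [hz] using congrArg Complex.im h
    have := h0 0
    rw [hre, him] at this
    norm_num at this
  have hW0 : W 0 = 0 := by simp [hW]
  simp only [hz1, hW0, neg_zero, Complex.exp_zero, mul_one] at hconst
  have h1 : Complex.exp (-W (2 * Real.pi)) = 1 := mul_left_cancel₀ hz0 (by rw [hconst, mul_one])
  obtain ⟨n, hn⟩ := Complex.exp_eq_one_iff.1 h1
  refine ⟨-n, ?_⟩
  have eW : W (2 * Real.pi) = ((∫ s in (0 : ℝ)..2 * Real.pi, α s : ℝ) : ℂ) +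
      Complex.I * ((∫ s in (0 : ℝ)..2 * Real.pi, β s : ℝ) : ℂ) := by
    simp only [hW, hw]
    rw [intervalIntegral.integral_add, intervalIntegral.integral_const_mul,
      intervalIntegral.integral_ofReal, intervalIntegral.integral_ofReal]
    · exact Continuous.intervalIntegrable (by fun_prop) _ _
    · exact Continuous.intervalIntegrable (by fun_prop) _ _
  rw [eW] at hn
  have him := congrArg Complex.im hn
  simp at him
  push_cast
  linarith

/-- The total horizontal rotation of a curve on the sphere with height `u` and slope `p`. -/
noncomputable def rotation (u p : ℝ → ℝ) : ℝ :=
  ∫ s in (0 : ℝ)..2 * Real.pi, √(1 - u s ^ 2 - p s ^ 2) / (1 - u s ^ 2)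

/-- The energy of a curve on the sphere in terms of its height. -/
noncomputable def heightEnergy (u p q : ℝ → ℝ) : ℝ :=
  ∫ s in (0 : ℝ)..2 * Real.pi, (q s + u s) ^ 2 / (1 - u s ^ 2 - p s ^ 2)

/-- The square of x y' − y x' is 1 − u² − p² > 0, so this continuous function keeps one sign and
`rotation` is plus or minus the winding integral. -/
theorem rotation_eq_of_frame {x y u x' y' p : ℝ → ℝ} (hx : ∀ s, HasDerivAt x (x' s) s)
    (hy : ∀ s, HasDerivAt y (y' s) s) (cx' : Continuous x') (cy' : Continuous y')
    (px : Function.Periodic x (2 * Real.pi)) (py : Function.Periodic y (2 * Real.pi))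
    (h1 : ∀ s, x s ^ 2 + y s ^ 2 + u s ^ 2 = 1) (h2 : ∀ s, x' s ^ 2 + y' s ^ 2 + p s ^ 2 = 1)
    (h3 : ∀ s, x s * x' s + y s * y' s + u s * p s = 0)
    (hm : ∀ s, 0 < 1 - u s ^ 2 - p s ^ 2) : ∃ k : ℤ, rotation u p = 2 * Real.pi * k := by
  have er : ∀ s, x s ^ 2 + y s ^ 2 = 1 - u s ^ 2 := fun s => by linarith [h1 s]
  obtain ⟨k, hk⟩ := exists_winding hx hy cx' cy' px py (fun s => by
    rw [er]; nlinarith [hm s, sq_nonneg (p s)])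
  have cx : Continuous x := continuous_iff_continuousAt.2 fun s => (hx s).continuousAt
  have cy : Continuous y := continuous_iff_continuousAt.2 fun s => (hy s).continuousAt
  set N : ℝ → ℝ := fun s => x s * y' s - y s * x' s with hN
  have cN : Continuous N := by fun_prop
  have N2 : ∀ s, N s ^ 2 = 1 - u s ^ 2 - p s ^ 2 := by
    intro s
    have : N s ^ 2 = (x s ^ 2 + y s ^ 2 + u s ^ 2 - u s ^ 2) *
      (x' s ^ 2 + y' s ^ 2 + p s ^ 2 - p s ^ 2) -
      (x s * x' s + y s * y' s + u s * p s - u s * p s) ^ 2 := by simp only [hN]; ring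
    rw [this, h1, h2, h3]; ring
  have N0 : ∀ s, N s ≠ 0 := fun s h => by
    have := hm s
    rw [← N2, h] at this
    norm_num at this
  have sign : (∀ s, 0 < N s) ∨ (∀ s, N s < 0) := by
    by_contra hcon
    push Not at hcon
    obtain ⟨⟨s, hs⟩, ⟨t, ht⟩⟩ := hcon
    obtain ⟨r, -, hr⟩ := intermediate_value_univ s t cN |>.trans (Set.range_subset_iff.2
      (fun r => Set.mem_image_of_mem N (Set.mem_univ r))) ⟨hs, ht⟩
    exact N0 r hr
  have eN : ∀ s, √(1 - u s ^ 2 - p s ^ 2) = |N s| := fun s => by rw [← N2, Real.sqrt_sq_eq_abs]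
  rcases sign with hs | hs
  · refine ⟨k, ?_⟩
    rw [← hk, rotation]
    refine intervalIntegral.integral_congr fun s _ => ?_
    simp only [eN, er]
    rw [abs_of_pos (hs s)]
  · refine ⟨-k, ?_⟩
    push_cast
    rw [mul_neg, ← hk, rotation, ← intervalIntegral.integral_neg]
    refine intervalIntegral.integral_congr fun s _ => ?_
    simp only [eN, er]
    rw [abs_of_neg (hs s), neg_div]

end Elastica

/-! ### The H¹ calculus and reconstruction of a curve from its height. -/

namespace Elastica

theorem exists_pos_le_of_periodic {m : ℝ → ℝ} (hc : Continuous m)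
    (hp : Function.Periodic m (2 * Real.pi)) (h0 : ∀ s, 0 < m s) : ∃ c, 0 < c ∧ ∀ s, c ≤ m s := by
  obtain ⟨x, -, hx⟩ := isCompact_Icc.exists_isMinOn (s := Set.Icc (0 : ℝ) (0 + 2 * Real.pi))
    ⟨0, by simp [Real.pi_pos.le]⟩ hc.continuousOn
  refine ⟨m x, h0 x, fun s => ?_⟩
  obtain ⟨y, hy, e⟩ := hp.exists_mem_Ico Real.two_pi_pos s 0
  rw [e]
  exact hx ⟨hy.1, hy.2.le⟩

theorem integrable_add_sq {g h : ℝ → ℝ} {a b : ℝ} (hg : IntervalIntegrable g volume a b)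
    (hh : IntervalIntegrable h volume a b)
    (hg2 : IntervalIntegrable (fun x => g x ^ 2) volume a b)
    (hh2 : IntervalIntegrable (fun x => h x ^ 2) volume a b) :
    IntervalIntegrable (fun x => (g x + h x) ^ 2) volume a b := by
  rw [intervalIntegrable_iff] at *
  have h1 := (memLp_two_iff_integrable_sq hg.aestronglyMeasurable).2 hg2
  have h2 := (memLp_two_iff_integrable_sq hh.aestronglyMeasurable).2 hh2
  exact (h1.add h2).integrable_sq

/-- `f` has the weak derivative `g`, which is locally square integrable. -/
def IsH1 (f g : ℝ → ℝ) : Prop :=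
  IsPrimitive f g ∧ ∀ a b, IntervalIntegrable (fun x => g x ^ 2) volume a b

namespace IsH1

variable {f g f₁ g₁ : ℝ → ℝ}

theorem of_hasDerivAt (h : ∀ x, HasDerivAt f (g x) x) (hg : Continuous g) : IsH1 f g :=
  ⟨.of_hasDerivAt h hg, fun a b => (hg.pow 2).intervalIntegrable a b⟩

theorem sq_mul_continuous (h : IsH1 f g) {c : ℝ → ℝ} (hc : Continuous c) (a b : ℝ) :
    IntervalIntegrable (fun x => (c x * g x) ^ 2) volume a b := by
  simp_rw [mul_pow]
  exact (h.2 a b).continuousOn_mul (hc.pow 2).continuousOn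

theorem mul (h : IsH1 f g) (h₁ : IsH1 f₁ g₁) :
    IsH1 (fun x => f x * f₁ x) (fun x => g x * f₁ x + f x * g₁ x) := by
  refine ⟨h.1.mul h₁.1, fun a b => integrable_add_sq
    ((h.1.1 a b).mul_continuousOn h₁.1.continuous.continuousOn)
    ((h₁.1.1 a b).continuousOn_mul h.1.continuous.continuousOn) ?_
    (h₁.sq_mul_continuous h.1.continuous a b)⟩
  have := h.sq_mul_continuous h₁.1.continuous a b
  simpa only [mul_comm] using this

theorem add (h : IsH1 f g) (h₁ : IsH1 f₁ g₁) :
    IsH1 (fun x => f x + f₁ x) (fun x => g x + g₁ x) :=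
  ⟨h.1.add h₁.1, fun a b => integrable_add_sq (h.1.1 a b) (h₁.1.1 a b) (h.2 a b) (h₁.2 a b)⟩

theorem const_mul (h : IsH1 f g) (c : ℝ) : IsH1 (fun x => c * f x) (fun x => c * g x) :=
  ⟨h.1.const_mul c, h.sq_mul_continuous continuous_const⟩

theorem sqrt (h : IsH1 f g) {c : ℝ} (hc : 0 < c) (hf : ∀ x, c ≤ f x) :
    IsH1 (fun x => √(f x)) (fun x => 1 / (2 * √(f x)) * g x) := by
  refine ⟨h.1.sqrt hc hf, h.sq_mul_continuous ?_⟩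
  have := h.1.continuous
  exact Continuous.div continuous_const (by fun_prop) fun x => by
    have := Real.sqrt_pos.2 (hc.trans_le (hf x)); positivity

theorem inv (h : IsH1 f g) {c : ℝ} (hc : 0 < c) (hf : ∀ x, c ≤ f x) :
    IsH1 (fun x => (f x)⁻¹) (fun x => -((f x) ^ 2)⁻¹ * g x) := by
  refine ⟨h.1.inv hc hf, h.sq_mul_continuous ?_⟩
  have := h.1.continuous
  exact ((this.pow 2).inv₀ fun x => pow_ne_zero 2 (hc.trans_le (hf x)).ne').neg

/-- The derivative of a periodic function may be taken periodic. -/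
theorem periodize (h : IsH1 f g) (hf : Function.Periodic f (2 * Real.pi)) :
    ∃ g', Function.Periodic g' (2 * Real.pi) ∧ IsH1 f g' := by
  have hp : Function.Periodic (fun s : ℝ => g (rep (s : Circ))) (2 * Real.pi) :=
    periodic_coe fun x => g (rep x)
  have e : Set.EqOn (fun s : ℝ => g (rep (s : Circ))) g (Set.Ioc 0 (0 + 2 * Real.pi)) := by
    intro s hs
    simp only [rep]
    rw [AddCircle.equivIoc_coe_of_mem hs]
  have hle : (0 : ℝ) ≤ 0 + 2 * Real.pi := by linarith [Real.two_pi_pos]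
  refine ⟨_, hp, ?_, fun a b => ?_⟩
  · refine IsPrimitive.of_base Real.two_pi_pos hf hp (t := 0) ?_ fun x hx => ?_
    · refine (h.1.1 0 (0 + 2 * Real.pi)).congr (fun s hs => (e ?_).symm)
      rwa [Set.uIoc_of_le hle] at hs
    · rw [← h.1.2]
      refine intervalIntegral.integral_congr_ae (ae_of_all _ fun s hs => e ?_)
      rw [Set.uIoc_of_le hx.1] at hs
      exact ⟨hs.1, hs.2.trans hx.2⟩
  · refine (hp.comp fun y => y ^ 2).intervalIntegrable Real.two_pi_pos.ne' (t := 0) ?_ a b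
    refine (h.2 0 (0 + 2 * Real.pi)).congr (fun s hs => ?_)
    rw [Set.uIoc_of_le hle] at hs
    simp only [Function.comp, e hs]

end IsH1

theorem IsPer2.isH1 {u p q : ℝ → ℝ} (h : IsPer2 u p q) : IsH1 p q := ⟨h.prim, h.sq⟩

theorem IsPer2.cont_p {u p q : ℝ → ℝ} (h : IsPer2 u p q) : Continuous p := h.prim.continuous

theorem IsPer2.cont_u {u p q : ℝ → ℝ} (h : IsPer2 u p q) : Continuous u :=
  continuous_iff_continuousAt.2 fun s => (h.deriv_u s).continuousAt

theorem IsPer2.isH1_u {u p q : ℝ → ℝ} (h : IsPer2 u p q) : IsH1 u p :=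
  .of_hasDerivAt h.deriv_u h.cont_p

/-- The vector-valued function on the circle with the given periodic components. -/
noncomputable def ofComponents (X : Fin 3 → ℝ → ℝ) (x : Circ) : E3 :=
  WithLp.toLp 2 fun i => X i (rep x)

theorem ofComponents_coe {X : Fin 3 → ℝ → ℝ} (hX : ∀ i, Function.Periodic (X i) (2 * Real.pi))
    (s : ℝ) (i : Fin 3) : ofComponents X (s : Circ) i = X i s := apply_rep_coe (hX i) s

theorem integrable_comp_rep {f : ℝ → ℝ} (hf : Function.Periodic f (2 * Real.pi))
    (hi : IntervalIntegrable f volume 0 (2 * Real.pi)) : Integrable (fun x : Circ => f (rep x)) := by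
  refine integrable_of_coe ?_
  simp_rw [apply_rep_coe hf]
  exact hi

theorem integrable_ofComponents {X : Fin 3 → ℝ → ℝ}
    (hX : ∀ i, Function.Periodic (X i) (2 * Real.pi))
    (hi : ∀ i, IntervalIntegrable (X i) volume 0 (2 * Real.pi)) : Integrable (ofComponents X) := by
  have e : ofComponents X = fun x => ∑ i : Fin 3, X i (rep x) • EuclideanSpace.single i (1 : ℝ) := by
    funext x
    ext j
    simp [ofComponents, Pi.single_apply]
  rw [e]
  exact integrable_finsetSum _ fun i _ => (integrable_comp_rep (hX i) (hi i)).smul_const _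

theorem memLp_ofComponents {X : Fin 3 → ℝ → ℝ}
    (hX : ∀ i, Function.Periodic (X i) (2 * Real.pi))
    (hi : ∀ i, IntervalIntegrable (X i) volume 0 (2 * Real.pi))
    (hi2 : ∀ i, IntervalIntegrable (fun s => X i s ^ 2) volume 0 (2 * Real.pi)) :
    MemLp (ofComponents X) 2 := by
  rw [memLp_two_iff_integrable_sq_norm (integrable_ofComponents hX hi).aestronglyMeasurable]
  simp_rw [EuclideanSpace.norm_sq_eq, Real.norm_eq_abs, sq_abs]
  refine integrable_finsetSum _ fun i _ => ?_
  have := integrable_comp_rep (f := fun s => X i s ^ 2) ((hX i).comp fun y => y ^ 2) (hi2 i)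
  exact this

theorem IsWeakDeriv.congr_left {u u' v : Circ → E3} (h : IsWeakDeriv u v) (e : ∀ᵐ x, u x = u' x) :
    IsWeakDeriv u' v := by
  refine ⟨h.1.congr e, h.2.1, fun φ φ' hφ hd => ?_⟩
  rw [← h.2.2 φ φ' hφ hd]
  refine integral_congr_ae ?_
  filter_upwards [e] with x hx
  rw [hx]

/-- The weak derivatives of the membership condition are chosen representatives, so unit speed and
square integrability are carried over from `X'` and `X''` by uniqueness almost everywhere. -/
theorem ofComponents_mem_Y {ε : ℝ} {X X' X'' : Fin 3 → ℝ → ℝ}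
    (h : ∀ i, IsPer2 (X i) (X' i) (X'' i)) (h1 : ∀ s, X 0 s ^ 2 + X 1 s ^ 2 + X 2 s ^ 2 = 1)
    (h2 : ∀ s, X' 0 s ^ 2 + X' 1 s ^ 2 + X' 2 s ^ 2 = 1) (hε : ∀ s, ε ≤ X 2 s) :
    ofComponents X ∈ Y ε := by
  have p0 := fun i => (h i).per_u
  have p1 := fun i => (h i).per_p
  have p2 := fun i => (h i).per_q
  have i0 : ∀ i, IntervalIntegrable (X i) volume 0 (2 * Real.pi) := fun i =>
    (h i).cont_u.intervalIntegrable _ _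
  have i1 : ∀ i, IntervalIntegrable (X' i) volume 0 (2 * Real.pi) := fun i =>
    (h i).cont_p.intervalIntegrable _ _
  have i2 : ∀ i, IntervalIntegrable (X'' i) volume 0 (2 * Real.pi) := fun i => (h i).prim.1 _ _
  have w1 : IsWeakDeriv (ofComponents X) (ofComponents X') := by
    refine isWeakDeriv_of_primitive (integrable_ofComponents p0 i0)
      (integrable_ofComponents p1 i1) fun i => ?_
    simp_rw [ofComponents_coe p0, ofComponents_coe p1]
    exact (h i).isH1_u.1
  have w2 : IsWeakDeriv (ofComponents X') (ofComponents X'') := by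
    refine isWeakDeriv_of_primitive (integrable_ofComponents p1 i1)
      (integrable_ofComponents p2 i2) fun i => ?_
    simp_rw [ofComponents_coe p1, ofComponents_coe p2]
    exact (h i).prim
  have hw : HasWeakDeriv (ofComponents X) := ⟨_, w1⟩
  have e1 : ∀ᵐ x, ofComponents X' x = weakDeriv (ofComponents X) x :=
    w1.ae_unique (isWeakDeriv_weakDeriv hw)
  have w2' : IsWeakDeriv (weakDeriv (ofComponents X)) (ofComponents X'') := w2.congr_left e1
  have hw2 : HasWeakDeriv (weakDeriv (ofComponents X)) := ⟨_, w2'⟩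
  have e2 : ∀ᵐ x, ofComponents X'' x = weakDeriv (weakDeriv (ofComponents X)) x :=
    w2'.ae_unique (isWeakDeriv_weakDeriv hw2)
  have norm_one : ∀ Z : Fin 3 → ℝ → ℝ, (∀ s, Z 0 s ^ 2 + Z 1 s ^ 2 + Z 2 s ^ 2 = 1) →
      ∀ x, ‖ofComponents Z x‖ = 1 := by
    intro Z hZ x
    have := EuclideanSpace.norm_sq_eq (ofComponents Z x)
    simp only [Real.norm_eq_abs, sq_abs, Fin.sum_univ_three] at this
    have e : ‖ofComponents Z x‖ ^ 2 = 1 := this.trans (hZ (rep x))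
    exact (pow_eq_one_iff_of_nonneg (norm_nonneg _) two_ne_zero).1 e
  refine ⟨?_, ⟨?_, hw, ?_, hw2, ?_⟩, ?_, ?_, fun x => hε (rep x)⟩
  · refine continuous_circ ?_
    have : (fun s : ℝ => ofComponents X (s : Circ)) = fun s => WithLp.toLp 2 fun i => X i s := by
      funext s
      ext i
      exact ofComponents_coe p0 s i
    rw [this]
    exact (PiLp.continuous_toLp 2 _).comp (continuous_pi fun i => (h i).cont_u)
  · exact memLp_ofComponents p0 i0 fun i => ((h i).cont_u.pow 2).intervalIntegrable _ _
  · exact (memLp_congr_ae e1).1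
      (memLp_ofComponents p1 i1 fun i => ((h i).cont_p.pow 2).intervalIntegrable _ _)
  · exact (memLp_congr_ae e2).1 (memLp_ofComponents p2 i2 fun i => (h i).sq _ _)
  · intro x
    simpa using norm_one X h1 x
  · filter_upwards [e1] with x hx
    rw [← hx]
    exact norm_one X' h2 x

theorem IsPer2.slope_unique {u p q p' q' : ℝ → ℝ} (h : IsPer2 u p q) (h' : IsPer2 u p' q') :
    p = p' := funext fun s => (h.deriv_u s).unique (h'.deriv_u s)

/-- The energy of a curve over the upper half sphere in terms of its height. -/
theorem energy_eq_heightEnergy {ε : ℝ} {γ : Circ → E3} (hγ : γ ∈ Y ε) {u p q : ℝ → ℝ}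
    (hu : ∀ s : ℝ, γ (s : Circ) 2 = u s) (h : IsPer2 u p q) (hm : ∀ s, 0 < 1 - u s ^ 2 - p s ^ 2) :
    energy γ = heightEnergy u p q := by
  obtain ⟨P, Q, hP, -, -, -, hE, hκ⟩ := exists_lift_of_mem_Y hγ
  have h2 := hP 2
  simp_rw [hu] at h2 hκ
  have e := h2.slope_unique h
  rw [hE, heightEnergy]
  refine intervalIntegral.integral_congr_ae ?_
  filter_upwards [hκ, h2.prim.ae_hasDerivAt, h.prim.ae_hasDerivAt] with s hs d1 d2 _
  rw [e] at d1 hs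
  rw [d1.unique d2] at hs ⊢
  rw [eq_div_iff (hm s).ne']
  rw [← hs.2]

/-- A height function with total rotation `2π` is the height of a closed curve. -/
theorem exists_curve {u p q : ℝ → ℝ} {ε : ℝ} (h : IsPer2 u p q) (hε : ∀ s, ε ≤ u s)
    (hm : ∀ s, 0 < 1 - u s ^ 2 - p s ^ 2) (hr : rotation u p = 2 * Real.pi) :
    ∃ γ ∈ Y ε, energy γ = heightEnergy u p q := by
  have cu := h.cont_u
  have cp := h.cont_p
  obtain ⟨c, hc, hcm⟩ := exists_pos_le_of_periodic (m := fun s => 1 - u s ^ 2 - p s ^ 2)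
    (by fun_prop) (fun s => by simp only [h.per_u s, h.per_p s]) hm
  have hcr : ∀ s, c ≤ 1 - u s ^ 2 := fun s => by nlinarith [hcm s, sq_nonneg (p s)]
  have hr0 : ∀ s, 0 < 1 - u s ^ 2 := fun s => hc.trans_le (hcr s)
  set r : ℝ → ℝ := fun s => √(1 - u s ^ 2) with hrdef
  set n : ℝ → ℝ := fun s => √(1 - u s ^ 2 - p s ^ 2) with hndef
  have rpos : ∀ s, 0 < r s := fun s => Real.sqrt_pos.2 (hr0 s)
  have r2 : ∀ s, r s ^ 2 = 1 - u s ^ 2 := fun s => Real.sq_sqrt (hr0 s).le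
  have n2 : ∀ s, n s ^ 2 = 1 - u s ^ 2 - p s ^ 2 := fun s => Real.sq_sqrt (hm s).le
  have cr : Continuous r := by fun_prop
  have cn : Continuous n := by fun_prop
  -- In cylindrical coordinates unit speed reads r'² + r²θ'² + p² = 1 with r' = −u p/r, which solves
  -- to θ' = n/r².
  set w : ℝ → ℝ := fun s => n s / (1 - u s ^ 2) with hw
  have cw : Continuous w := Continuous.div cn (by fun_prop) fun s => (hr0 s).ne'
  set θ : ℝ → ℝ := fun s => ∫ t in (0 : ℝ)..s, w t with hθ
  have dθ : ∀ s, HasDerivAt θ (w s) s := fun s => (cw.integral_hasStrictDerivAt 0 s).hasDerivAt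
  have pw : Function.Periodic w (2 * Real.pi) := fun s => by
    simp only [hw, hndef, h.per_u s, h.per_p s]
  -- The rotation condition is used here: the angle gains exactly 2π per period, so the curve closes
  -- up.
  have pθ : ∀ s, θ (s + 2 * Real.pi) = θ s + 2 * Real.pi := by
    intro s
    have e := pw.intervalIntegral_add_eq_add 0 s (fun a b => cw.intervalIntegrable a b)
    rw [zero_add] at e
    simp only [hθ, e]
    congr 1
  have cθ : Continuous θ := continuous_iff_continuousAt.2 fun s => (dθ s).continuousAt
  have hru : IsH1 (fun s => 1 - u s ^ 2) (fun s => -(2 * u s * p s)) := by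
    refine .of_hasDerivAt (fun s => ?_) (by fun_prop)
    have := ((h.deriv_u s).pow 2).const_sub 1
    exact this.congr_deriv (by norm_num)
  have hrinv := (hru.sqrt hc hcr).inv (Real.sqrt_pos.2 hc) (fun s => Real.sqrt_le_sqrt (hcr s))
  have hn1 : ∃ g, IsH1 n g := by
    have e := hru.add ((h.isH1.mul h.isH1).const_mul (-1))
    have e' : (fun s => 1 - u s ^ 2 + -1 * (p s * p s)) = fun s => 1 - u s ^ 2 - p s ^ 2 := by
      funext s; ring
    rw [e'] at e
    exact ⟨_, e.sqrt hc hcm⟩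
  obtain ⟨gn, hgn⟩ := hn1
  have hβ := hgn.mul hrinv
  have hα := ((h.isH1_u.mul h.isH1).mul hrinv).const_mul (-1)
  have hcos : IsH1 (fun s => Real.cos (θ s)) (fun s => -Real.sin (θ s) * w s) :=
    .of_hasDerivAt (fun s => (dθ s).cos) (by fun_prop)
  have hsin : IsH1 (fun s => Real.sin (θ s)) (fun s => Real.cos (θ s) * w s) :=
    .of_hasDerivAt (fun s => (dθ s).sin) (by fun_prop)
  have hx1 := (hα.mul hcos).add ((hβ.mul hsin).const_mul (-1))
  have hy1 := (hα.mul hsin).add (hβ.mul hcos)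
  have dr : ∀ s, HasDerivAt r (-(2 * u s * p s) / (2 * √(1 - u s ^ 2))) s := fun s =>
    ((((h.deriv_u s).pow 2).const_sub 1).congr_deriv (by norm_num)).sqrt (hr0 s).ne'
  have pcos : ∀ s, Real.cos (θ (s + 2 * Real.pi)) = Real.cos (θ s) := fun s => by
    rw [pθ, Real.cos_add_two_pi]
  have psin : ∀ s, Real.sin (θ (s + 2 * Real.pi)) = Real.sin (θ s) := fun s => by
    rw [pθ, Real.sin_add_two_pi]
  -- The second derivative supplied by the H¹ calculus is determined only almost everywhere and need
  -- not be periodic, while `IsPer2` asks for a periodic one.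
  obtain ⟨qx, pqx, hqx⟩ := hx1.periodize (fun s => by
    simp only [h.per_u s, h.per_p s, pcos, psin, hndef])
  obtain ⟨qy, pqy, hqy⟩ := hy1.periodize (fun s => by
    simp only [h.per_u s, h.per_p s, pcos, psin, hndef])
  have Px : IsPer2 (fun s => r s * Real.cos (θ s))
      (fun s => -1 * (u s * p s * (r s)⁻¹) * Real.cos (θ s) +
        -1 * (n s * (r s)⁻¹ * Real.sin (θ s))) qx := by
    refine ⟨fun s => ?_, fun s => ?_, pqx, fun s => ?_, hqx.1, hqx.2⟩
    · simp only [pcos, hrdef, h.per_u s]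
    · simp only [h.per_u s, h.per_p s, pcos, psin, hndef, hrdef]
    · refine ((dr s).mul (dθ s).cos).congr_deriv ?_
      have := rpos s
      change _ / (2 * r s) * _ + _ = -1 * (u s * p s * (r s)⁻¹) * _ + -1 * (n s * (r s)⁻¹ * _)
      simp only [hw, ← r2]
      field_simp
  have Py : IsPer2 (fun s => r s * Real.sin (θ s))
      (fun s => -1 * (u s * p s * (r s)⁻¹) * Real.sin (θ s) +
        n s * (r s)⁻¹ * Real.cos (θ s)) qy := by
    refine ⟨fun s => ?_, fun s => ?_, pqy, fun s => ?_, hqy.1, hqy.2⟩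
    · simp only [psin, hrdef, h.per_u s]
    · simp only [h.per_u s, h.per_p s, pcos, psin, hndef, hrdef]
    · refine ((dr s).mul (dθ s).sin).congr_deriv ?_
      have := rpos s
      change _ / (2 * r s) * _ + _ = -1 * (u s * p s * (r s)⁻¹) * _ + (n s * (r s)⁻¹ * _)
      simp only [hw, ← r2]
      field_simp
  have mem := ofComponents_mem_Y (ε := ε)
    (X := ![fun s => r s * Real.cos (θ s), fun s => r s * Real.sin (θ s), u])
    (X' := ![fun s => -1 * (u s * p s * (r s)⁻¹) * Real.cos (θ s) +
        -1 * (n s * (r s)⁻¹ * Real.sin (θ s)), fun s =>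
        -1 * (u s * p s * (r s)⁻¹) * Real.sin (θ s) + n s * (r s)⁻¹ * Real.cos (θ s), p]) (X'' := ![qx, qy, q]) (by
      intro i
      fin_cases i
      · exact Px
      · exact Py
      · exact h) ?_ ?_ hε
  · refine ⟨_, mem, energy_eq_heightEnergy mem (fun s => ?_) h hm⟩
    exact apply_rep_coe h.per_u s
  · intro s
    have := Real.sin_sq_add_cos_sq (θ s)
    have := r2 s
    simp only [Matrix.cons_val_zero, Matrix.cons_val_one, Matrix.cons_val]
    linear_combination (1 : ℝ) * this + r s ^ 2 * Real.sin_sq_add_cos_sq (θ s)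
  · intro s
    have e3 := r2 s
    have e4 := n2 s
    have e5 := rpos s
    simp only [Matrix.cons_val_zero, Matrix.cons_val_one, Matrix.cons_val]
    have e : (-1 * (u s * p s * (r s)⁻¹) * Real.cos (θ s) +
        -1 * (n s * (r s)⁻¹ * Real.sin (θ s))) ^ 2 +
        (-1 * (u s * p s * (r s)⁻¹) * Real.sin (θ s) + n s * (r s)⁻¹ * Real.cos (θ s)) ^ 2 =
        (u s ^ 2 * p s ^ 2 + n s ^ 2) * ((r s) ^ 2)⁻¹ := by
      rw [← inv_pow]
      linear_combination (u s ^ 2 * p s ^ 2 + n s ^ 2) * ((r s)⁻¹) ^ 2 *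
        Real.sin_sq_add_cos_sq (θ s)
    refine (congrArg (· + p s ^ 2) e).trans ?_
    rw [e4, e3]
    have := (hr0 s).ne'
    field_simp
    ring

end Elastica

/-! ### Taylor estimates for energy and rotation, and an abstract multiplier rule. -/

namespace Elastica

/-- Half the first variation of `heightEnergy`. -/
noncomputable def energyVar (u p q φ φ' φ'' : ℝ → ℝ) : ℝ :=
  ∫ s in (0 : ℝ)..2 * Real.pi, ((q s + u s) * (φ'' s + φ s) / (1 - u s ^ 2 - p s ^ 2) +
    (q s + u s) ^ 2 * (u s * φ s + p s * φ' s) / (1 - u s ^ 2 - p s ^ 2) ^ 2)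

/-- The first variation of `rotation`. -/
noncomputable def rotationVar (u p φ φ' : ℝ → ℝ) : ℝ :=
  ∫ s in (0 : ℝ)..2 * Real.pi,
    (-(u s * φ s + p s * φ' s) / (√(1 - u s ^ 2 - p s ^ 2) * (1 - u s ^ 2)) +
      2 * u s * √(1 - u s ^ 2 - p s ^ 2) * φ s / (1 - u s ^ 2) ^ 2)

theorem speed_lower {u p η ζ τ : ℝ} (hu : |u| ≤ 1 / 4) (hp : |p| ≤ 1 / 4) (hτ : τ ≤ 1 / 8)
    (hη : |η| ≤ τ) (hζ : |ζ| ≤ τ) : 1 / 2 ≤ 1 - (u + η) ^ 2 - (p + ζ) ^ 2 := by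
  have h1 : |u + η| ≤ 3 / 8 := (abs_add_le _ _).trans (by linarith)
  have h2 : |p + ζ| ≤ 3 / 8 := (abs_add_le _ _).trans (by linarith)
  have h3 : (u + η) ^ 2 ≤ (3 / 8) ^ 2 := sq_le_sq' (by linarith [abs_le.1 h1]) (abs_le.1 h1).2
  have h4 : (p + ζ) ^ 2 ≤ (3 / 8) ^ 2 := sq_le_sq' (by linarith [abs_le.1 h2]) (abs_le.1 h2).2
  linarith

theorem inv_expansion {m d : ℝ} (hm : m ≠ 0) (hm' : m - d ≠ 0) :
    (m - d)⁻¹ = m⁻¹ + d * m⁻¹ ^ 2 + d ^ 2 * m⁻¹ ^ 2 * (m - d)⁻¹ := by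
  field_simp
  ring

theorem sqrt_expansion {S S' d : ℝ} (hS : 0 < S) (hS' : 0 < S') (h : S' ^ 2 = S ^ 2 - d) :
    S' - S = -d * (S + S')⁻¹ ∧
      S' - S + d * S⁻¹ / 2 = -(d ^ 2 * S⁻¹ * (S + S')⁻¹ ^ 2) / 2 := by
  obtain rfl : d = S ^ 2 - S' ^ 2 := by linarith
  have h1 : S + S' ≠ 0 := by positivity
  constructor
  · field_simp
    ring
  · field_simp
    ring

/-- An upper bound is enough, because minimality is only tested from above. The error is quadratic
in the perturbation: `a` may be merely square integrable, whereas `η` and `ζ` are uniformly small.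
-/
theorem energy_density_taylor {A a u p η ζ τ : ℝ} (hu : |u| ≤ 1 / 4) (hp : |p| ≤ 1 / 4)
    (hτ : τ ≤ 1 / 8) (hη : |η| ≤ τ) (hζ : |ζ| ≤ τ) :
    (A + a) ^ 2 / (1 - (u + η) ^ 2 - (p + ζ) ^ 2) ≤ A ^ 2 / (1 - u ^ 2 - p ^ 2) +
      2 * (A * a / (1 - u ^ 2 - p ^ 2) + A ^ 2 * (u * η + p * ζ) / (1 - u ^ 2 - p ^ 2) ^ 2) +
      (48 * τ ^ 2 * A ^ 2 + 10 * a ^ 2) := by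
  have hτ0 : 0 ≤ τ := (abs_nonneg _).trans hη
  have b1 := speed_lower hu hp hτ hη hζ
  have b0 := speed_lower (η := 0) (ζ := 0) (τ := 0) hu hp (by norm_num) (by simp) (by simp)
  simp only [add_zero] at b0
  set m := 1 - u ^ 2 - p ^ 2 with hm
  set d := 2 * (u * η + p * ζ) + (η ^ 2 + ζ ^ 2) with hd
  have em : 1 - (u + η) ^ 2 - (p + ζ) ^ 2 = m - d := by simp only [hm, hd]; ring
  rw [em] at b1 ⊢
  have hη2 : η ^ 2 ≤ τ ^ 2 := sq_le_sq' (by linarith [abs_le.1 hη]) (abs_le.1 hη).2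
  have hζ2 : ζ ^ 2 ≤ τ ^ 2 := sq_le_sq' (by linarith [abs_le.1 hζ]) (abs_le.1 hζ).2
  have hd1 : |d| ≤ 2 * τ := by
    have e1 : |u * η| ≤ 1 / 4 * τ := by rw [abs_mul]; gcongr
    have e2 : |p * ζ| ≤ 1 / 4 * τ := by rw [abs_mul]; gcongr
    have := abs_le.1 e1
    have := abs_le.1 e2
    rw [abs_le]
    constructor <;> nlinarith [sq_nonneg η, sq_nonneg ζ]
  have hd2 : d ^ 2 ≤ (2 * τ) ^ 2 := sq_le_sq' (by linarith [abs_le.1 hd1]) (abs_le.1 hd1).2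
  have hR0 : 0 < m⁻¹ := by positivity
  have hR : m⁻¹ ≤ 2 := by
    rw [inv_le_comm₀ (by linarith) (by norm_num)]; linarith
  have hR0' : 0 < (m - d)⁻¹ := inv_pos.2 (by linarith)
  have hR' : (m - d)⁻¹ ≤ 2 := by
    rw [inv_le_comm₀ (by linarith) (by norm_num)]; linarith
  have e := inv_expansion (m := m) (d := d) (by linarith) (by linarith)
  set R := m⁻¹
  set R' := (m - d)⁻¹
  have hdiff : R' - R = d * R * R' := by
    have h1 : m ≠ 0 := by linarith
    have h2 : m - d ≠ 0 := by linarith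
    simp only [R, R']
    field_simp
    ring
  have g1 : (A + a) ^ 2 / (m - d) = (A + a) ^ 2 * R' := div_eq_mul_inv _ _
  have g2 : A ^ 2 / m = A ^ 2 * R := div_eq_mul_inv _ _
  have g3 : A * a / m = A * a * R := div_eq_mul_inv _ _
  have g4 : A ^ 2 * (u * η + p * ζ) / m ^ 2 = A ^ 2 * (u * η + p * ζ) * R ^ 2 := by
    rw [div_eq_mul_inv, inv_pow]
  rw [g1, g2, g3, g4]
  clear g1 g2 g3 g4 em hm
  clear_value d R R' m
  -- The reciprocal's remainder takes 40 of the 48 in the coefficient of `A ^ 2`; the other 8 are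
  -- reserved for the cross term `k3`.
  have k1 : R' - R - 2 * (u * η + p * ζ) * R ^ 2 ≤ 48 * τ ^ 2 - 8 * τ ^ 2 := by
    have : R' - R - 2 * (u * η + p * ζ) * R ^ 2 = (η ^ 2 + ζ ^ 2) * R ^ 2 + d ^ 2 * R ^ 2 * R' := by
      linear_combination e + R ^ 2 * hd
    rw [this]
    have f1 : R ^ 2 ≤ 2 ^ 2 := by gcongr
    have f2 : (η ^ 2 + ζ ^ 2) * R ^ 2 ≤ (τ ^ 2 + τ ^ 2) * 2 ^ 2 := by gcongr
    have f3 : d ^ 2 * R ^ 2 * R' ≤ (2 * τ) ^ 2 * 2 ^ 2 * 2 := by gcongr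
    linarith
  have k2 : |R' - R| ≤ 8 * τ := by
    rw [hdiff, abs_mul, abs_mul, abs_of_pos hR0, abs_of_pos hR0']
    calc |d| * R * R' ≤ (2 * τ) * 2 * 2 := by gcongr
      _ = 8 * τ := by ring
  have k3 : 2 * A * a * (R' - R) ≤ 8 * (A ^ 2 * τ ^ 2 + a ^ 2) := by
    have f1 : 2 * A * a * (R' - R) ≤ 2 * (|A| * τ) * |a| * 8 := by
      calc 2 * A * a * (R' - R) ≤ |2 * A * a * (R' - R)| := le_abs_self _
        _ = 2 * |A| * |a| * |R' - R| := by simp [abs_mul]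
        _ ≤ 2 * |A| * |a| * (8 * τ) := by gcongr
        _ = _ := by ring
    have f2 := sq_nonneg (|A| * τ - |a|)
    have f3 : (|A| * τ) ^ 2 = A ^ 2 * τ ^ 2 := by rw [mul_pow, sq_abs]
    have f4 : |a| ^ 2 = a ^ 2 := sq_abs a
    linarith
  have k4 : a ^ 2 * R' ≤ a ^ 2 * 2 := by gcongr
  have k5 : A ^ 2 * (R' - R - 2 * (u * η + p * ζ) * R ^ 2) ≤ A ^ 2 * (48 * τ ^ 2 - 8 * τ ^ 2) := by
    gcongr
  linarith

/-- The algebraic core of `rotation_density_taylor`, with square roots and reciprocals abstracted: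
`T` stands for 1/S, `V` for 1/(S + S'), and `ρ`, `ρ'` for the reciprocals of 1 − u² before and after
perturbation. The four remainder terms are bounded by 4, 8, 8 and 12 times τ². -/
theorem rotation_remainder {S S' T V ρ ρ' d d₂ u p η ζ τ : ℝ} (hη2 : η ^ 2 ≤ τ ^ 2)
    (hζ2 : ζ ^ 2 ≤ τ ^ 2) (hd : d = 2 * (u * η + p * ζ) + (η ^ 2 + ζ ^ 2))
    (hd₂ : d₂ = 2 * u * η + η ^ 2) (hd1 : |d| ≤ 2 * τ) (hd₂1 : |d₂| ≤ τ) (hS1 : 0 ≤ S)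
    (hS2 : S ≤ 1) (hρ0 : 0 < ρ) (hρ : ρ ≤ 2) (hρ0' : 0 < ρ') (hρ' : ρ' ≤ 2) (hT0 : 0 < T)
    (hT : T ≤ 2) (hU0 : 0 < V) (hU : V ≤ 1) (hSd : S' - S = -d * V)
    (hSe : S' - S + d * T / 2 = -(d ^ 2 * T * V ^ 2) / 2) (hdiff : ρ' - ρ = d₂ * ρ * ρ')
    (eρ : ρ' = ρ + d₂ * ρ ^ 2 + d₂ ^ 2 * ρ ^ 2 * ρ') :
    |S' * ρ' - S * ρ - (-(u * η + p * ζ) * T * ρ + 2 * u * S * η * ρ ^ 2)| ≤ 40 * τ ^ 2 := by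
  have hτ0 : 0 ≤ τ := (abs_nonneg _).trans hd₂1
  have hdsq : d ^ 2 ≤ (2 * τ) ^ 2 := sq_le_sq' (by linarith [abs_le.1 hd1]) (abs_le.1 hd1).2
  have hd₂sq : d₂ ^ 2 ≤ τ ^ 2 := sq_le_sq' (by linarith [abs_le.1 hd₂1]) (abs_le.1 hd₂1).2
  have split : S' * ρ' - S * ρ - (-(u * η + p * ζ) * T * ρ + 2 * u * S * η * ρ ^ 2) =
      -((η ^ 2 + ζ ^ 2) * T / 2) * ρ - (d ^ 2 * T * V ^ 2) / 2 * ρ + (S' - S) * (ρ' - ρ) +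
        S * (η ^ 2 * ρ ^ 2 + d₂ ^ 2 * ρ ^ 2 * ρ') := by
    have h1 : S' - S = -(d * T) / 2 - (d ^ 2 * T * V ^ 2) / 2 := by linarith
    have h2 : S' * ρ' - S * ρ = (S' - S) * ρ + (S' - S) * (ρ' - ρ) + S * (ρ' - ρ) := by ring
    have h3 : ρ' - ρ = d₂ * ρ ^ 2 + d₂ ^ 2 * ρ ^ 2 * ρ' := by linarith
    rw [h2]
    nth_rewrite 1 [h1]
    nth_rewrite 2 [h3]
    rw [hd₂]
    linear_combination (-(T * ρ) / 2) * hd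
  rw [split]
  clear split
  have q1 : 0 ≤ (η ^ 2 + ζ ^ 2) * T / 2 * ρ ∧ (η ^ 2 + ζ ^ 2) * T / 2 * ρ ≤ 4 * τ ^ 2 := by
    refine ⟨by positivity, ?_⟩
    calc (η ^ 2 + ζ ^ 2) * T / 2 * ρ ≤ (τ ^ 2 + τ ^ 2) * 2 / 2 * 2 := by gcongr
      _ = 4 * τ ^ 2 := by ring
  have q2 : 0 ≤ (d ^ 2 * T * V ^ 2) / 2 * ρ ∧ (d ^ 2 * T * V ^ 2) / 2 * ρ ≤ 8 * τ ^ 2 := by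
    refine ⟨by positivity, ?_⟩
    calc (d ^ 2 * T * V ^ 2) / 2 * ρ ≤ ((2 * τ) ^ 2 * 2 * 1 ^ 2) / 2 * 2 := by gcongr
      _ = 8 * τ ^ 2 := by ring
  have q3 : |(S' - S) * (ρ' - ρ)| ≤ 8 * τ ^ 2 := by
    rw [hSd, hdiff]
    simp only [abs_mul, abs_neg, abs_of_pos hU0, abs_of_pos hρ0, abs_of_pos hρ0']
    calc |d| * V * (|d₂| * ρ * ρ') ≤ (2 * τ) * 1 * (τ * 2 * 2) := by gcongr
      _ = 8 * τ ^ 2 := by ring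
  have q4 : 0 ≤ S * (η ^ 2 * ρ ^ 2 + d₂ ^ 2 * ρ ^ 2 * ρ') ∧
      S * (η ^ 2 * ρ ^ 2 + d₂ ^ 2 * ρ ^ 2 * ρ') ≤ 12 * τ ^ 2 := by
    refine ⟨by positivity, ?_⟩
    calc S * (η ^ 2 * ρ ^ 2 + d₂ ^ 2 * ρ ^ 2 * ρ') ≤ 1 * (τ ^ 2 * 2 ^ 2 + τ ^ 2 * 2 ^ 2 * 2) := by
          gcongr
      _ = 12 * τ ^ 2 := by ring
  have q3' := abs_le.1 q3
  rw [abs_le]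
  constructor <;> linarith [q1.1, q1.2, q2.1, q2.2, q4.1, q4.2, sq_nonneg τ]

/-- In contrast to the energy, a two-sided bound is needed: the constraint must be restored exactly
by an intermediate value argument. -/
theorem rotation_density_taylor {u p η ζ τ : ℝ} (hu : |u| ≤ 1 / 4) (hp : |p| ≤ 1 / 4)
    (hτ : τ ≤ 1 / 8) (hη : |η| ≤ τ) (hζ : |ζ| ≤ τ) :
    |√(1 - (u + η) ^ 2 - (p + ζ) ^ 2) / (1 - (u + η) ^ 2) - √(1 - u ^ 2 - p ^ 2) / (1 - u ^ 2) -
      (-(u * η + p * ζ) / (√(1 - u ^ 2 - p ^ 2) * (1 - u ^ 2)) +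
        2 * u * √(1 - u ^ 2 - p ^ 2) * η / (1 - u ^ 2) ^ 2)| ≤ 40 * τ ^ 2 := by
  have hτ0 : 0 ≤ τ := (abs_nonneg _).trans hη
  have b1 := speed_lower hu hp hτ hη hζ
  have b0 := speed_lower (η := 0) (ζ := 0) (τ := 0) hu hp (by norm_num) (by simp) (by simp)
  simp only [add_zero] at b0
  have c0 : 1 / 2 ≤ 1 - u ^ 2 := by nlinarith [sq_nonneg p]
  have c1 : 1 / 2 ≤ 1 - (u + η) ^ 2 := by nlinarith [sq_nonneg (p + ζ)]
  set m := 1 - u ^ 2 - p ^ 2 with hm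
  set d := 2 * (u * η + p * ζ) + (η ^ 2 + ζ ^ 2) with hd
  set r := 1 - u ^ 2 with hr
  set d₂ := 2 * u * η + η ^ 2 with hd₂
  have em : 1 - (u + η) ^ 2 - (p + ζ) ^ 2 = m - d := by simp only [hm, hd]; ring
  have er : 1 - (u + η) ^ 2 = r - d₂ := by simp only [hr, hd₂]; ring
  rw [em] at b1 ⊢
  rw [er] at c1 ⊢
  have hη2 : η ^ 2 ≤ τ ^ 2 := sq_le_sq' (by linarith [abs_le.1 hη]) (abs_le.1 hη).2
  have hζ2 : ζ ^ 2 ≤ τ ^ 2 := sq_le_sq' (by linarith [abs_le.1 hζ]) (abs_le.1 hζ).2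
  have e1 : |u * η| ≤ 1 / 4 * τ := by rw [abs_mul]; gcongr
  have e2 : |p * ζ| ≤ 1 / 4 * τ := by rw [abs_mul]; gcongr
  have hd1 : |d| ≤ 2 * τ := by
    have := abs_le.1 e1
    have := abs_le.1 e2
    rw [abs_le]
    constructor <;> nlinarith [sq_nonneg η, sq_nonneg ζ]
  have hd₂1 : |d₂| ≤ τ := by
    have := abs_le.1 e1
    rw [abs_le]
    constructor <;> nlinarith [sq_nonneg η]
  have hS1 : 1 / 2 ≤ √m := Real.le_sqrt_of_sq_le (by nlinarith)
  have hS2 : √m ≤ 1 := Real.sqrt_le_one.2 (by nlinarith [sq_nonneg u, sq_nonneg p])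
  have hS1' : 1 / 2 ≤ √(m - d) := Real.le_sqrt_of_sq_le (by nlinarith)
  have hSS : √m ^ 2 = m := Real.sq_sqrt (by linarith)
  have hSS' : √(m - d) ^ 2 = m - d := Real.sq_sqrt (by linarith)
  set S := √m
  set S' := √(m - d)
  have hρ0 : 0 < r⁻¹ := by positivity
  have hρ : r⁻¹ ≤ 2 := by
    rw [inv_le_comm₀ (by linarith) (by norm_num)]; linarith
  have hρ0' : 0 < (r - d₂)⁻¹ := inv_pos.2 (by linarith)
  have hρ' : (r - d₂)⁻¹ ≤ 2 := by
    rw [inv_le_comm₀ (by linarith) (by norm_num)]; linarith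
  have eρ := inv_expansion (m := r) (d := d₂) (by linarith) (by linarith)
  have hdiff : (r - d₂)⁻¹ - r⁻¹ = d₂ * r⁻¹ * (r - d₂)⁻¹ := by
    have h1 : r ≠ 0 := by linarith
    have h2 : r - d₂ ≠ 0 := by linarith
    field_simp
    ring
  have g1 : S' / (r - d₂) = S' * (r - d₂)⁻¹ := div_eq_mul_inv _ _
  have g2 : S / r = S * r⁻¹ := div_eq_mul_inv _ _
  have g3 : -(u * η + p * ζ) / (S * r) = -(u * η + p * ζ) * S⁻¹ * r⁻¹ := by
    rw [div_eq_mul_inv, mul_inv, mul_assoc]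
  have g4 : 2 * u * S * η / r ^ 2 = 2 * u * S * η * r⁻¹ ^ 2 := by rw [div_eq_mul_inv, inv_pow]
  rw [g1, g2, g3, g4]
  set ρ := r⁻¹
  set ρ' := (r - d₂)⁻¹
  have hT0 : 0 < S⁻¹ := by positivity
  have hT : S⁻¹ ≤ 2 := by
    rw [inv_le_comm₀ (by linarith) (by norm_num)]; linarith
  have hU0 : 0 < (S + S')⁻¹ := by positivity
  have hU : (S + S')⁻¹ ≤ 1 := by
    rw [inv_le_comm₀ (by linarith) (by norm_num)]; linarith
  obtain ⟨hSd, hSe⟩ := sqrt_expansion (S := S) (S' := S') (d := d) (by linarith) (by linarith)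
    (by rw [hSS, hSS'])
  set T := S⁻¹
  set V := (S + S')⁻¹
  clear g1 g2 g3 g4 em er hm hr
  clear_value T V ρ ρ' S S' d d₂ m r
  exact rotation_remainder hη2 hζ2 hd hd₂ hd1 hd₂1 (one_half_pos.le.trans hS1) hS2 hρ0 hρ hρ0' hρ' hT0 hT hU0 hU
    hSd hSe hdiff eρ

/-- First-order condition for a constrained minimum along a two-parameter family. -/
theorem first_order_condition {f g : ℝ → ℝ → ℝ} {r C f₀ g₀ Fs Ft Gs Gt : ℝ} (hr : 0 < r)
    (hg : ∀ s t, |s| ≤ r → |t| ≤ r → |g s t - g₀ - (s * Gs + t * Gt)| ≤ C * (|s| + |t|) ^ 2)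
    (hf : ∀ s t, |s| ≤ r → |t| ≤ r → f s t ≤ f₀ + (s * Fs + t * Ft) + C * (|s| + |t|) ^ 2)
    (hc : ∀ t, |t| ≤ r → ContinuousOn (fun s => g s t) (Set.Icc (-r) r))
    (hmin : ∀ s t, |s| ≤ r → |t| ≤ r → g s t = g₀ → f₀ ≤ f s t) (hGs : Gs ≠ 0) :
    Gs * Ft = Fs * Gt := by
  have hC : 0 ≤ C := by
    have := (abs_nonneg _).trans (hg r 0 (by rw [abs_of_pos hr]) (by simpa using hr.le))
    simp only [abs_zero, add_zero, sq_abs] at this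
    exact nonneg_of_mul_nonneg_left this (by positivity)
  have hG : 0 < |Gs| := abs_pos.2 hGs
  set K := |Gt / Gs| + 1 with hK
  have hK0 : 0 ≤ K := by positivity
  set D := C * (K + 1) ^ 2 with hD
  have hD0 : 0 ≤ D := by positivity
  -- For |t| ≤ t₁ the correction has `w ≤ |t|`, and every `s` considered satisfies |s| ≤ K|t| ≤ r.
  set t₁ := min (r / (K + 1)) (|Gs| / (D + 1)) with ht₁
  have ht₁0 : 0 < t₁ := by positivity
  have key : ∀ t, |t| ≤ t₁ → 0 ≤ t * (Ft - Gt / Gs * Fs) + (D / |Gs| * |Fs| + D) * t ^ 2 := by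
    intro t ht
    have htr : |t| * (K + 1) ≤ r := by
      have := ht.trans (min_le_left _ _)
      rwa [le_div_iff₀ (by positivity)] at this
    have htG : |t| * D ≤ |Gs| := by
      have := ht.trans (min_le_right _ _)
      rw [le_div_iff₀ (by positivity)] at this
      linarith [abs_nonneg t]
    have htr' : |t| ≤ r := by linarith [mul_nonneg (abs_nonneg t) hK0]
    -- The root in `s` of the linearized constraint. Moving by `w` from it changes the linear part
    -- by `D * t ^ 2`, which outweighs the remainder, so the constraint has an exact root within
    -- `w`.
    set s₀ := -(t * (Gt / Gs)) with hs₀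
    set w := D * t ^ 2 / |Gs| with hw
    have hw0 : 0 ≤ w := by positivity
    have hw1 : w ≤ |t| := by
      rw [hw, div_le_iff₀ hG, ← sq_abs t]
      linarith [mul_le_mul_of_nonneg_left htG (abs_nonneg t)]
    have habs0 : |s₀| = |t| * |Gt / Gs| := by rw [hs₀, abs_neg, abs_mul]
    have hs : ∀ s, |s - s₀| ≤ w → |s| ≤ K * |t| := by
      intro s hs
      have : |s| ≤ |s - s₀| + |s₀| := by
        have := abs_add_le (s - s₀) s₀; simpa using this
      rw [hK]
      linarith
    have hsr : ∀ s, |s - s₀| ≤ w → |s| ≤ r := fun s h => by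
      have := hs s h
      linarith [abs_nonneg t]
    have herr : ∀ s, |s - s₀| ≤ w → C * (|s| + |t|) ^ 2 ≤ D * t ^ 2 := by
      intro s h
      have := hs s h
      calc C * (|s| + |t|) ^ 2 ≤ C * (K * |t| + |t|) ^ 2 := by gcongr
        _ = D * t ^ 2 := by rw [hD, ← sq_abs t]; ring
    -- Multiplication by `Gs` normalizes the direction of crossing, whatever the sign of `Gs`.
    have hcont : ContinuousOn (fun s => (g s t - g₀) * Gs) (Set.Icc (s₀ - w) (s₀ + w)) := by
      refine (((hc t htr').mono fun s h => ?_).sub continuousOn_const).mul continuousOn_const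
      exact abs_le.1 (hsr s (abs_le.2 ⟨by linarith [h.1], by linarith [h.2]⟩))
    have e0 : s₀ * Gs + t * Gt = 0 := by rw [hs₀]; field_simp; ring
    have hwG : w * |Gs| = D * t ^ 2 := by rw [hw]; field_simp
    have hGG : |Gs| * |Gs| = Gs * Gs := abs_mul_abs_self Gs
    have hup : 0 ≤ (g (s₀ + w) t - g₀) * Gs := by
      have h1 : |s₀ + w - s₀| ≤ w := by simp [abs_of_nonneg hw0]
      have h2 := (hg _ t (hsr _ h1) htr').trans (herr _ h1)
      have h3 : |(g (s₀ + w) t - g₀ - ((s₀ + w) * Gs + t * Gt)) * Gs| ≤ D * t ^ 2 * |Gs| := by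
        rw [abs_mul]; gcongr
      have h4 := (abs_le.1 h3).1
      have h5 : (s₀ + w) * Gs + t * Gt = w * Gs := by linarith
      rw [h5, sub_mul] at h4
      have h6 : w * Gs * Gs = D * t ^ 2 * |Gs| := by rw [mul_assoc, ← hGG, ← mul_assoc, hwG]
      linarith
    have hlo : (g (s₀ - w) t - g₀) * Gs ≤ 0 := by
      have h1 : |s₀ - w - s₀| ≤ w := by simp [abs_of_nonneg hw0]
      have h2 := (hg _ t (hsr _ h1) htr').trans (herr _ h1)
      have h3 : |(g (s₀ - w) t - g₀ - ((s₀ - w) * Gs + t * Gt)) * Gs| ≤ D * t ^ 2 * |Gs| := by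
        rw [abs_mul]; gcongr
      have h4 := (abs_le.1 h3).2
      have h5 : (s₀ - w) * Gs + t * Gt = -w * Gs := by linarith
      rw [h5, sub_mul] at h4
      have h6 : w * Gs * Gs = D * t ^ 2 * |Gs| := by rw [mul_assoc, ← hGG, ← mul_assoc, hwG]
      linarith
    obtain ⟨s, hsm, hse⟩ := intermediate_value_Icc (by linarith) hcont ⟨hlo, hup⟩
    have hsw : |s - s₀| ≤ w := abs_le.2 ⟨by linarith [hsm.1], by linarith [hsm.2]⟩
    have hg0 : g s t = g₀ := by
      rcases mul_eq_zero.1 hse with h | h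
      · linarith
      · exact absurd h hGs
    have h1 := hmin s t (hsr s hsw) htr' hg0
    have h2 := hf s t (hsr s hsw) htr'
    have h3 := herr s hsw
    have h4 : (s - s₀) * Fs ≤ w * |Fs| := by
      calc (s - s₀) * Fs ≤ |(s - s₀) * Fs| := le_abs_self _
        _ = |s - s₀| * |Fs| := abs_mul _ _
        _ ≤ w * |Fs| := by gcongr
    have h5 : w * |Fs| = D / |Gs| * |Fs| * t ^ 2 := by rw [hw]; ring
    have h6 : s₀ * Fs = -(t * (Gt / Gs * Fs)) := by rw [hs₀]; ring
    linarith
  set X := Ft - Gt / Gs * Fs with hX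
  set N := D / |Gs| * |Fs| + D with hN
  have hN0 : 0 ≤ N := by positivity
  -- The bound `key` at both `t` and `-t` excludes a nonzero linear coefficient, since the other
  -- term is quadratic.
  have hX0 : X = 0 := by
    by_contra hne
    have hXp : 0 < |X| := abs_pos.2 hne
    set t := min t₁ (|X| / (N + 1)) with ht
    have htp : 0 < t := by positivity
    have hle : t * N < |X| := by
      have := min_le_right t₁ (|X| / (N + 1))
      rw [← ht, le_div_iff₀ (by positivity)] at this
      nlinarith
    have h1 := key t (by rw [abs_of_pos htp]; exact min_le_left _ _)
    have h2 := key (-t) (by rw [abs_neg, abs_of_pos htp]; exact min_le_left _ _)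
    have h4 : t * (t * N) < t * |X| := mul_lt_mul_of_pos_left hle htp
    rcases abs_cases X with ⟨h, -⟩ | ⟨h, -⟩ <;> rw [h] at h4 <;> linarith
  have : Ft = Gt / Gs * Fs := by linarith
  rw [this]
  field_simp

end Elastica

/-! ### Integrated Taylor estimates and the Euler–Lagrange equation. -/

namespace Elastica

theorem IsPer2.add {u p q u₁ p₁ q₁ : ℝ → ℝ} (h : IsPer2 u p q) (h₁ : IsPer2 u₁ p₁ q₁) :
    IsPer2 (fun s => u s + u₁ s) (fun s => p s + p₁ s) (fun s => q s + q₁ s) :=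
  ⟨h.per_u.add h₁.per_u, h.per_p.add h₁.per_p, h.per_q.add h₁.per_q,
    fun s => (h.deriv_u s).add (h₁.deriv_u s), h.prim.add h₁.prim, (h.isH1.add h₁.isH1).2⟩

theorem IsPer2.const_mul {u p q : ℝ → ℝ} (h : IsPer2 u p q) (c : ℝ) :
    IsPer2 (fun s => c * u s) (fun s => c * p s) (fun s => c * q s) :=
  ⟨fun s => by simp only [h.per_u s], fun s => by simp only [h.per_p s],
    fun s => by simp only [h.per_q s],
    fun s => (h.deriv_u s).const_mul c, h.prim.const_mul c, (h.isH1.const_mul c).2⟩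

theorem IsPer2.const (c : ℝ) : IsPer2 (fun _ => c) (fun _ => 0) (fun _ => 0) :=
  ⟨fun _ => rfl, fun _ => rfl, fun _ => rfl, fun s => hasDerivAt_const s c, .const 0,
    fun a b => by simp⟩

theorem IsPer2.exists_bound {u p q : ℝ → ℝ} (h : IsPer2 u p q) :
    ∃ B, 0 < B ∧ ∀ s, |u s| ≤ B ∧ |p s| ≤ B := by
  have cu := h.cont_u
  have cp := h.cont_p
  obtain ⟨B, hB⟩ := isCompact_Icc.exists_bound_of_continuousOn (s := Set.Icc (0 : ℝ)
    (0 + 2 * Real.pi)) (f := fun s => |u s| + |p s|) (by fun_prop)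
  refine ⟨|B| + 1, by positivity, fun s => ?_⟩
  have hp : Function.Periodic (fun s => |u s| + |p s|) (2 * Real.pi) := fun s => by
    simp only [h.per_u s, h.per_p s]
  obtain ⟨y, hy, e⟩ := hp.exists_mem_Ico Real.two_pi_pos s 0
  have := hB y ⟨hy.1, hy.2.le⟩
  simp only [Real.norm_eq_abs] at this
  rw [← e, abs_of_nonneg (by positivity)] at this
  have := le_abs_self B
  constructor <;> linarith [abs_nonneg (u s), abs_nonneg (p s)]

theorem IsPer2.int_sum {u p q : ℝ → ℝ} (h : IsPer2 u p q) (a b : ℝ) :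
    IntervalIntegrable (fun s => q s + u s) volume a b :=
  (h.prim.1 a b).add (h.cont_u.intervalIntegrable a b)

theorem IsPer2.int_sum_sq {u p q : ℝ → ℝ} (h : IsPer2 u p q) (a b : ℝ) :
    IntervalIntegrable (fun s => (q s + u s) ^ 2) volume a b :=
  integrable_add_sq (h.prim.1 a b) (h.cont_u.intervalIntegrable a b) (h.sq a b)
    ((h.cont_u.pow 2).intervalIntegrable a b)

theorem integrable_mul_of_sq {g h : ℝ → ℝ} {a b : ℝ} (hg : IntervalIntegrable g volume a b)
    (hh : IntervalIntegrable h volume a b)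
    (hg2 : IntervalIntegrable (fun x => g x ^ 2) volume a b)
    (hh2 : IntervalIntegrable (fun x => h x ^ 2) volume a b) :
    IntervalIntegrable (fun x => g x * h x) volume a b := by
  have := ((integrable_add_sq hg hh hg2 hh2).sub (hg2.add hh2)).const_mul (1 / 2)
  refine this.congr fun x _ => ?_
  ring

theorem IsPer2.int_sum_mul {u p q φ φ' φ'' : ℝ → ℝ} (h : IsPer2 u p q) (h' : IsPer2 φ φ' φ'')
    (a b : ℝ) : IntervalIntegrable (fun s => (q s + u s) * (φ'' s + φ s)) volume a b :=
  integrable_mul_of_sq (h.int_sum a b) (h'.int_sum a b) (h.int_sum_sq a b) (h'.int_sum_sq a b)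

section

variable {u p q φ φ' φ'' : ℝ → ℝ}

theorem int_heightEnergy (h : IsPer2 u p q) (hm : ∀ s, 0 < 1 - u s ^ 2 - p s ^ 2) (a b : ℝ) :
    IntervalIntegrable (fun s => (q s + u s) ^ 2 / (1 - u s ^ 2 - p s ^ 2)) volume a b := by
  have cu := h.cont_u
  have cp := h.cont_p
  simp_rw [div_eq_mul_inv]
  refine (h.int_sum_sq a b).mul_continuousOn (Continuous.continuousOn ?_)
  exact Continuous.inv₀ (by fun_prop) fun s => (hm s).ne'

theorem int_energyVar (h : IsPer2 u p q) (h' : IsPer2 φ φ' φ'')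
    (hm : ∀ s, 0 < 1 - u s ^ 2 - p s ^ 2) (a b : ℝ) :
    IntervalIntegrable (fun s => (q s + u s) * (φ'' s + φ s) / (1 - u s ^ 2 - p s ^ 2) +
      (q s + u s) ^ 2 * (u s * φ s + p s * φ' s) / (1 - u s ^ 2 - p s ^ 2) ^ 2) volume a b := by
  have cu := h.cont_u
  have cp := h.cont_p
  have cφ := h'.cont_u
  have cφ' := h'.cont_p
  refine IntervalIntegrable.add ?_ ?_
  · simp_rw [div_eq_mul_inv]
    refine (h.int_sum_mul h' a b).mul_continuousOn (Continuous.continuousOn ?_)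
    exact Continuous.inv₀ (by fun_prop) fun s => (hm s).ne'
  · simp_rw [mul_div_assoc]
    refine (h.int_sum_sq a b).mul_continuousOn (Continuous.continuousOn ?_)
    exact Continuous.div (by fun_prop) (by fun_prop) fun s => pow_ne_zero 2 (hm s).ne'

theorem cont_rotation (cu : Continuous u) (cp : Continuous p)
    (hm : ∀ s, 0 < 1 - u s ^ 2 - p s ^ 2) :
    Continuous (fun s => √(1 - u s ^ 2 - p s ^ 2) / (1 - u s ^ 2)) :=
  Continuous.div (by fun_prop) (by fun_prop) fun s => by nlinarith [hm s, sq_nonneg (p s)]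

theorem cont_rotationVar (cu : Continuous u) (cp : Continuous p) (cφ : Continuous φ)
    (cφ' : Continuous φ') (hm : ∀ s, 0 < 1 - u s ^ 2 - p s ^ 2) :
    Continuous (fun s => -(u s * φ s + p s * φ' s) / (√(1 - u s ^ 2 - p s ^ 2) * (1 - u s ^ 2)) +
      2 * u s * √(1 - u s ^ 2 - p s ^ 2) * φ s / (1 - u s ^ 2) ^ 2) := by
  have hr : ∀ s, 1 - u s ^ 2 ≠ 0 := fun s => by nlinarith [hm s, sq_nonneg (p s)]
  refine Continuous.add ?_ ?_
  · exact Continuous.div (by fun_prop) (by fun_prop) fun s =>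
      mul_ne_zero (Real.sqrt_pos.2 (hm s)).ne' (hr s)
  · exact Continuous.div (by fun_prop) (by fun_prop) fun s => pow_ne_zero 2 (hr s)

theorem energyVar_linear {ψ ψ' ψ'' : ℝ → ℝ} (h : IsPer2 u p q) (h' : IsPer2 φ φ' φ'')
    (h'' : IsPer2 ψ ψ' ψ'') (hm : ∀ s, 0 < 1 - u s ^ 2 - p s ^ 2) (a b : ℝ) :
    energyVar u p q (fun s => a * ψ s + b * φ s) (fun s => a * ψ' s + b * φ' s)
      (fun s => a * ψ'' s + b * φ'' s) =
      a * energyVar u p q ψ ψ' ψ'' + b * energyVar u p q φ φ' φ'' := by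
  unfold energyVar
  rw [← intervalIntegral.integral_const_mul, ← intervalIntegral.integral_const_mul,
    ← intervalIntegral.integral_add ((int_energyVar h h'' hm _ _).const_mul a)
      ((int_energyVar h h' hm _ _).const_mul b)]
  refine intervalIntegral.integral_congr fun s _ => ?_
  simp only
  ring

theorem rotationVar_linear {ψ ψ' : ℝ → ℝ} (cu : Continuous u) (cp : Continuous p)
    (cφ : Continuous φ) (cφ' : Continuous φ') (cψ : Continuous ψ) (cψ' : Continuous ψ')
    (hm : ∀ s, 0 < 1 - u s ^ 2 - p s ^ 2) (a b : ℝ) :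
    rotationVar u p (fun s => a * ψ s + b * φ s) (fun s => a * ψ' s + b * φ' s) =
      a * rotationVar u p ψ ψ' + b * rotationVar u p φ φ' := by
  unfold rotationVar
  rw [← intervalIntegral.integral_const_mul, ← intervalIntegral.integral_const_mul,
    ← intervalIntegral.integral_add
      (((cont_rotationVar cu cp cψ cψ' hm).intervalIntegrable _ _).const_mul a)
      (((cont_rotationVar cu cp cφ cφ' hm).intervalIntegrable _ _).const_mul b)]
  refine intervalIntegral.integral_congr fun s _ => ?_
  simp only
  ring

theorem speed_pos (hu : ∀ s, |u s| ≤ 1 / 4) (hp : ∀ s, |p s| ≤ 1 / 4) (s : ℝ) :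
    0 < 1 - u s ^ 2 - p s ^ 2 := by
  have := speed_lower (η := 0) (ζ := 0) (τ := 0) (hu s) (hp s) (by norm_num) (by simp) (by simp)
  simp only [add_zero] at this
  linarith

theorem heightEnergy_taylor {η ζ χ : ℝ → ℝ} {τ : ℝ} (h : IsPer2 u p q) (h' : IsPer2 η ζ χ)
    (hu : ∀ s, |u s| ≤ 1 / 4) (hp : ∀ s, |p s| ≤ 1 / 4) (hτ : τ ≤ 1 / 8) (hη : ∀ s, |η s| ≤ τ)
    (hζ : ∀ s, |ζ s| ≤ τ) :
    heightEnergy (fun s => u s + η s) (fun s => p s + ζ s) (fun s => q s + χ s) ≤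
      heightEnergy u p q + 2 * energyVar u p q η ζ χ +
      (48 * τ ^ 2 * (∫ s in (0 : ℝ)..2 * Real.pi, (q s + u s) ^ 2) +
        10 * ∫ s in (0 : ℝ)..2 * Real.pi, (χ s + η s) ^ 2) := by
  have hm := speed_pos hu hp
  have hm' : ∀ s, 0 < 1 - (u s + η s) ^ 2 - (p s + ζ s) ^ 2 := fun s =>
    one_half_pos.trans_le (speed_lower (hu s) (hp s) hτ (hη s) (hζ s))
  unfold heightEnergy energyVar
  rw [← intervalIntegral.integral_const_mul, ← intervalIntegral.integral_const_mul,
    ← intervalIntegral.integral_const_mul,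
    ← intervalIntegral.integral_add (int_heightEnergy h hm _ _)
      ((int_energyVar h h' hm _ _).const_mul 2),
    ← intervalIntegral.integral_add ((h.int_sum_sq _ _).const_mul _)
      ((h'.int_sum_sq _ _).const_mul _),
    ← intervalIntegral.integral_add ((int_heightEnergy h hm _ _).add
      ((int_energyVar h h' hm _ _).const_mul 2)) (((h.int_sum_sq _ _).const_mul _).add
      ((h'.int_sum_sq _ _).const_mul _))]
  refine intervalIntegral.integral_mono_on Real.two_pi_pos.le (int_heightEnergy (h.add h') hm' _ _)
    (((int_heightEnergy h hm _ _).add ((int_energyVar h h' hm _ _).const_mul 2)).add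
      (((h.int_sum_sq _ _).const_mul _).add ((h'.int_sum_sq _ _).const_mul _))) fun s _ => ?_
  have := energy_density_taylor (A := q s + u s) (a := χ s + η s) (hu s) (hp s) hτ (hη s) (hζ s)
  have e : q s + χ s + (u s + η s) = q s + u s + (χ s + η s) := by ring
  rw [e]
  exact this

theorem rotation_taylor {η ζ : ℝ → ℝ} {τ : ℝ} (cu : Continuous u) (cp : Continuous p)
    (cη : Continuous η) (cζ : Continuous ζ)
    (hu : ∀ s, |u s| ≤ 1 / 4) (hp : ∀ s, |p s| ≤ 1 / 4) (hτ : τ ≤ 1 / 8) (hη : ∀ s, |η s| ≤ τ)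
    (hζ : ∀ s, |ζ s| ≤ τ) :
    |rotation (fun s => u s + η s) (fun s => p s + ζ s) - rotation u p - rotationVar u p η ζ| ≤
      40 * τ ^ 2 * (2 * Real.pi) := by
  have hm := speed_pos hu hp
  have hm' : ∀ s, 0 < 1 - (u s + η s) ^ 2 - (p s + ζ s) ^ 2 := fun s =>
    one_half_pos.trans_le (speed_lower (hu s) (hp s) hτ (hη s) (hζ s))
  have i1 := (cont_rotation (u := fun s => u s + η s) (p := fun s => p s + ζ s) (cu.add cη)
    (cp.add cζ) hm').intervalIntegrable 0 (2 * Real.pi) (μ := volume)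
  have i2 := (cont_rotation cu cp hm).intervalIntegrable 0 (2 * Real.pi) (μ := volume)
  have i3 := (cont_rotationVar cu cp cη cζ hm).intervalIntegrable 0 (2 * Real.pi) (μ := volume)
  unfold rotation rotationVar
  rw [← intervalIntegral.integral_sub i1 i2, ← intervalIntegral.integral_sub (i1.sub i2) i3]
  have := intervalIntegral.norm_integral_le_of_norm_le_const (a := 0) (b := 2 * Real.pi)
    (C := 40 * τ ^ 2) (f := fun s => √(1 - (u s + η s) ^ 2 - (p s + ζ s) ^ 2) /
      (1 - (u s + η s) ^ 2) - √(1 - u s ^ 2 - p s ^ 2) / (1 - u s ^ 2) -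
      (-(u s * η s + p s * ζ s) / (√(1 - u s ^ 2 - p s ^ 2) * (1 - u s ^ 2)) +
        2 * u s * √(1 - u s ^ 2 - p s ^ 2) * η s / (1 - u s ^ 2) ^ 2))
    (fun s _ => rotation_density_taylor (hu s) (hp s) hτ (hη s) (hζ s))
  rwa [sub_zero, abs_of_pos Real.two_pi_pos] at this

/-- `u` minimizes `heightEnergy` among the height functions above `ε` with the same rotation. -/
def IsHeightMinimizer (ε : ℝ) (u p q : ℝ → ℝ) : Prop :=
  ∀ v v' v'' : ℝ → ℝ, IsPer2 v v' v'' → (∀ s, ε ≤ v s) → (∀ s, 0 < 1 - v s ^ 2 - v' s ^ 2) →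
    rotation v v' = rotation u p → heightEnergy u p q ≤ heightEnergy v v' v''

/-- The Euler–Lagrange equation, tested with functions vanishing on the contact set. -/
theorem IsHeightMinimizer.euler_lagrange {ε B : ℝ} {ψ ψ' ψ'' : ℝ → ℝ} (h : IsPer2 u p q)
    (hu : ∀ s, |u s| ≤ 1 / 4) (hp : ∀ s, |p s| ≤ 1 / 4) (hmin : IsHeightMinimizer ε u p q)
    (hε : ∀ s, ε ≤ u s)
    (hψ : IsPer2 ψ ψ' ψ'') (hφ : IsPer2 φ φ' φ'') (bψ : ∀ s, |ψ s| ≤ B * (u s - ε))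
    (bφ : ∀ s, |φ s| ≤ B * (u s - ε)) (hne : rotationVar u p ψ ψ' ≠ 0) :
    rotationVar u p ψ ψ' * energyVar u p q φ φ' φ'' =
      energyVar u p q ψ ψ' ψ'' * rotationVar u p φ φ' := by
  have cu := h.cont_u
  have cp := h.cont_p
  have cψ := hψ.cont_u
  have cψ' := hψ.cont_p
  have cφ := hφ.cont_u
  have cφ' := hφ.cont_p
  obtain ⟨B₁, hB₁, b₁⟩ := hψ.exists_bound
  obtain ⟨B₂, hB₂, b₂⟩ := hφ.exists_bound
  have hm := speed_pos hu hp
  set D := B₁ + B₂ with hD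
  have hD0 : 0 < D := by positivity
  -- The first bound keeps perturbations and their slopes below 1/8, as the Taylor estimates
  -- require. The second keeps the perturbation below `u - ε`, so the obstacle condition is
  -- preserved with either sign.
  set r := min (1 / (16 * D)) (1 / (4 * (|B| + 1))) with hr
  have hr0 : 0 < r := by positivity
  have hrD : r * (16 * D) ≤ 1 := by
    have := min_le_left (1 / (16 * D)) (1 / (4 * (|B| + 1)))
    rwa [← hr, le_div_iff₀ (by positivity)] at this
  have hrB : r * (4 * (|B| + 1)) ≤ 1 := by
    have := min_le_right (1 / (16 * D)) (1 / (4 * (|B| + 1)))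
    rwa [← hr, le_div_iff₀ (by positivity)] at this
  have comb : ∀ {x y X Y s t : ℝ}, |x| ≤ X → |y| ≤ Y → |s * x + t * y| ≤ (X + Y) * (|s| + |t|) := by
    intro x y X Y s t hx hy
    have hX := (abs_nonneg _).trans hx
    have hY := (abs_nonneg _).trans hy
    calc |s * x + t * y| ≤ |s| * |x| + |t| * |y| := by
          rw [← abs_mul, ← abs_mul]; exact abs_add_le _ _
      _ ≤ |s| * X + |t| * Y := by gcongr
      _ ≤ (X + Y) * (|s| + |t|) := by
          linarith [mul_nonneg (abs_nonneg t) hX, mul_nonneg (abs_nonneg s) hY]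
  have hτ : ∀ s t, |s| ≤ r → |t| ≤ r → D * (|s| + |t|) ≤ 1 / 8 := by
    intro s t hs ht
    have : D * (|s| + |t|) ≤ D * (r + r) := by gcongr
    linarith
  have hη : ∀ s t x, |s * ψ x + t * φ x| ≤ D * (|s| + |t|) := fun s t x => comb (b₁ x).1 (b₂ x).1
  have hζ : ∀ s t x, |s * ψ' x + t * φ' x| ≤ D * (|s| + |t|) := fun s t x =>
    comb (b₁ x).2 (b₂ x).2
  set I₀ := ∫ s in (0 : ℝ)..2 * Real.pi, (q s + u s) ^ 2 with hI₀
  set I₁ := ∫ s in (0 : ℝ)..2 * Real.pi, (ψ'' s + ψ s) ^ 2 with hI₁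
  set I₂ := ∫ s in (0 : ℝ)..2 * Real.pi, (φ'' s + φ s) ^ 2 with hI₂
  have hI₀' : 0 ≤ I₀ := intervalIntegral.integral_nonneg Real.two_pi_pos.le fun s _ => sq_nonneg _
  have hI₁' : 0 ≤ I₁ := intervalIntegral.integral_nonneg Real.two_pi_pos.le fun s _ => sq_nonneg _
  have hI₂' : 0 ≤ I₂ := intervalIntegral.integral_nonneg Real.two_pi_pos.le fun s _ => sq_nonneg _
  set C := 40 * D ^ 2 * (2 * Real.pi) + 48 * D ^ 2 * I₀ + 20 * (I₁ + I₂) with hC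
  have hπ := Real.pi_pos
  have key := first_order_condition (r := r) (C := C)
    (f := fun s t => heightEnergy (fun x => u x + (s * ψ x + t * φ x))
      (fun x => p x + (s * ψ' x + t * φ' x)) (fun x => q x + (s * ψ'' x + t * φ'' x)))
    (g := fun s t => rotation (fun x => u x + (s * ψ x + t * φ x))
      (fun x => p x + (s * ψ' x + t * φ' x)))
    (f₀ := heightEnergy u p q) (g₀ := rotation u p) (Fs := 2 * energyVar u p q ψ ψ' ψ'')
    (Ft := 2 * energyVar u p q φ φ' φ'') (Gs := rotationVar u p ψ ψ')
    (Gt := rotationVar u p φ φ') hr0 ?_ ?_ ?_ ?_ hne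
  · linarith
  · intro s t hs ht
    have := rotation_taylor (η := fun x => s * ψ x + t * φ x) (ζ := fun x => s * ψ' x + t * φ' x)
      cu cp (by fun_prop) (by fun_prop) hu hp (hτ s t hs ht) (hη s t) (hζ s t)
    rw [rotationVar_linear cu cp cφ cφ' cψ cψ' hm] at this
    refine this.trans ?_
    have e : 40 * (D * (|s| + |t|)) ^ 2 * (2 * Real.pi) =
      40 * D ^ 2 * (2 * Real.pi) * (|s| + |t|) ^ 2 := by ring
    rw [e, hC]
    gcongr
    have : 0 ≤ 48 * D ^ 2 * I₀ := by positivity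
    linarith
  · intro s t hs ht
    have := heightEnergy_taylor h ((hψ.const_mul s).add (hφ.const_mul t)) hu hp (hτ s t hs ht)
      (hη s t) (hζ s t)
    rw [energyVar_linear h hφ hψ hm] at this
    refine this.trans ?_
    have e1 : (∫ x in (0 : ℝ)..2 * Real.pi, (s * ψ'' x + t * φ'' x + (s * ψ x + t * φ x)) ^ 2) ≤
        2 * (|s| + |t|) ^ 2 * (I₁ + I₂) := by
      have i1 := hψ.int_sum_sq 0 (2 * Real.pi)
      have i2 := hφ.int_sum_sq 0 (2 * Real.pi)
      rw [hI₁, hI₂, ← intervalIntegral.integral_add i1 i2, ← intervalIntegral.integral_const_mul]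
      refine intervalIntegral.integral_mono_on Real.two_pi_pos.le
        (((hψ.const_mul s).add (hφ.const_mul t)).int_sum_sq _ _) ((i1.add i2).const_mul _)
        fun x _ => ?_
      have e2 : s * ψ'' x + t * φ'' x + (s * ψ x + t * φ x) =
        s * (ψ'' x + ψ x) + t * (φ'' x + φ x) := by ring
      rw [e2]
      set a := ψ'' x + ψ x
      set b := φ'' x + φ x
      have f1 : (s * a + t * b) ^ 2 ≤ 2 * (s ^ 2 * a ^ 2 + t ^ 2 * b ^ 2) := by
        nlinarith [sq_nonneg (s * a - t * b)]
      have f2 : s ^ 2 ≤ (|s| + |t|) ^ 2 := by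
        rw [← sq_abs s]; gcongr; linarith [abs_nonneg t]
      have f3 : t ^ 2 ≤ (|s| + |t|) ^ 2 := by
        rw [← sq_abs t]; gcongr; linarith [abs_nonneg s]
      have f4 : s ^ 2 * a ^ 2 ≤ (|s| + |t|) ^ 2 * a ^ 2 := by gcongr
      have f5 : t ^ 2 * b ^ 2 ≤ (|s| + |t|) ^ 2 * b ^ 2 := by gcongr
      linarith
    have e3 : 0 ≤ 40 * D ^ 2 * (2 * Real.pi) * (|s| + |t|) ^ 2 := by positivity
    rw [hC]
    linarith
  · intro t ht
    -- The maximum with 1/2 makes the integrand continuous for all parameters; for |s| ≤ r it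
    -- changes nothing.
    set g : ℝ → ℝ → ℝ := fun s x => √(1 - (u x + (s * ψ x + t * φ x)) ^ 2 -
      (p x + (s * ψ' x + t * φ' x)) ^ 2) / max (1 / 2) (1 - (u x + (s * ψ x + t * φ x)) ^ 2) with hg
    have cg : Continuous (Function.uncurry g) := by
      refine Continuous.div ?_ ?_ fun z => ?_
      · fun_prop
      · fun_prop
      · exact (one_half_pos.trans_le (le_max_left _ _)).ne'
    refine (intervalIntegral.continuous_parametric_intervalIntegral_of_continuous' (μ := volume) cg 0
      (2 * Real.pi)).continuousOn.congr fun s hs => ?_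
    refine intervalIntegral.integral_congr fun x _ => ?_
    have := speed_lower (hu x) (hp x) (hτ s t (abs_le.2 hs) ht) (hη s t x) (hζ s t x)
    simp only [hg]
    rw [max_eq_right]
    nlinarith [sq_nonneg (p x + (s * ψ' x + t * φ' x))]
  · intro s t hs ht hst
    refine hmin _ _ _ (h.add ((hψ.const_mul s).add (hφ.const_mul t))) (fun x => ?_) (fun x => ?_)
      hst
    · have h0 : 0 ≤ u x - ε := sub_nonneg.2 (hε x)
      have h1 : ∀ {y}, |y| ≤ B * (u x - ε) → |y| ≤ |B| * (u x - ε) := fun hy =>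
        hy.trans (mul_le_mul_of_nonneg_right (le_abs_self B) h0)
      have h2 := comb (s := s) (t := t) (h1 (bψ x)) (h1 (bφ x))
      have h3 : (|B| * (u x - ε) + |B| * (u x - ε)) * (|s| + |t|) ≤
          (|B| * (u x - ε) + |B| * (u x - ε)) * (r + r) := by gcongr
      have h4 : (r * (4 * (|B| + 1))) * (u x - ε) ≤ 1 * (u x - ε) := by gcongr
      have h5 := mul_nonneg hr0.le h0
      linarith [(abs_le.1 h2).1]
    · exact one_half_pos.trans_le (speed_lower (hu x) (hp x) (hτ s t hs ht) (hη s t x) (hζ s t x))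

end

end Elastica

/-! ### Localization of test functions and bounds on the coefficients. -/

namespace Elastica

/-- Restriction of a periodic function to the translates of `[a, b)`, extended by zero. -/
noncomputable def cut (a b : ℝ) (f : ℝ → ℝ) (x : ℝ) : ℝ :=
  if toIcoMod Real.two_pi_pos a x < b then f x else 0

section

variable {a b : ℝ} {f g : ℝ → ℝ}

theorem cut_periodic (hf : Function.Periodic f (2 * Real.pi)) :
    Function.Periodic (cut a b f) (2 * Real.pi) := fun x => by
  simp only [cut, toIcoMod_add_right, hf x]

theorem cut_of_lt {x : ℝ} (hab : b ≤ a + 2 * Real.pi) (hx : x ∈ Set.Ico a b) : cut a b f x = f x := by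
  have : toIcoMod Real.two_pi_pos a x = x :=
    (toIcoMod_eq_self Real.two_pi_pos).2 ⟨hx.1, hx.2.trans_le hab⟩
  rw [cut, this, if_pos hx.2]

theorem cut_of_ge {x : ℝ} (hab : a < b) (hx : x ∈ Set.Ico b (a + 2 * Real.pi)) :
    cut a b f x = 0 := by
  have : toIcoMod Real.two_pi_pos a x = x :=
    (toIcoMod_eq_self Real.two_pi_pos).2 ⟨hab.le.trans hx.1, hx.2⟩
  rw [cut, this, if_neg (not_lt.2 hx.1)]

theorem integral_of_cut {F G : ℝ → ℝ} (hab : a < b) (hb : b ≤ a + 2 * Real.pi)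
    (pF : Function.Periodic F (2 * Real.pi)) (hF : ∀ a b, IntervalIntegrable F volume a b)
    (h1 : ∀ x ∈ Set.Ico a b, F x = G x) (h2 : ∀ x ∈ Set.Ico b (a + 2 * Real.pi), F x = 0) :
    ∫ x in (0 : ℝ)..2 * Real.pi, F x = ∫ x in a..b, G x := by
  have e := pF.intervalIntegral_add_eq 0 a
  rw [zero_add] at e
  rw [e, ← intervalIntegral.integral_add_adjacent_intervals (hF a b) (hF b _)]
  have e1 : ∫ x in a..b, F x = ∫ x in a..b, G x := by
    refine intervalIntegral.integral_congr_uIoo fun x hx => ?_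
    rw [Set.uIoo_of_le hab.le] at hx
    exact h1 x ⟨hx.1.le, hx.2⟩
  have e2 : ∫ x in b..a + 2 * Real.pi, F x = 0 := by
    rw [intervalIntegral.integral_congr_uIoo (g := fun _ => (0 : ℝ)) fun x hx => ?_]
    · simp
    · rw [Set.uIoo_of_le hb] at hx
      exact h2 x ⟨hx.1.le, hx.2⟩
  rw [e1, e2, add_zero]

theorem intervalIntegrable_cut (hab : a < b) (hb : b ≤ a + 2 * Real.pi)
    (hf : IntervalIntegrable f volume a b) :
    IntervalIntegrable (cut a b f) volume a (a + 2 * Real.pi) := by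
  refine IntervalIntegrable.trans (b := b) ?_ ?_
  · refine hf.congr_uIoo fun x hx => ?_
    rw [Set.uIoo_of_le hab.le] at hx
    exact (cut_of_lt hb ⟨hx.1.le, hx.2⟩).symm
  · refine (intervalIntegrable_const (c := (0 : ℝ))).congr_uIoo fun x hx => ?_
    rw [Set.uIoo_of_le hb] at hx
    exact (cut_of_ge hab ⟨hx.1.le, hx.2⟩).symm

/-- Vanishing at both ends prevents jumps, so the zero extension has the cut-off derivative with no
singular part. -/
theorem IsPrimitive.cut (hab : a < b) (hb : b ≤ a + 2 * Real.pi) (h : IsPrimitive f g)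
    (pf : Function.Periodic f (2 * Real.pi)) (pg : Function.Periodic g (2 * Real.pi))
    (fa : f a = 0) (fb : f b = 0) : IsPrimitive (cut a b f) (cut a b g) := by
  have key1 : ∀ x ∈ Set.Icc a b, ∫ y in a..x, Elastica.cut a b g y = f x := by
    intro x hx
    have := h.2 a x
    rw [fa, sub_zero] at this
    rw [← this]
    refine intervalIntegral.integral_congr_uIoo fun y hy => ?_
    rw [Set.uIoo_of_le hx.1] at hy
    exact cut_of_lt hb ⟨hy.1.le, hy.2.trans_le hx.2⟩
  have hi := intervalIntegrable_cut hab hb (h.1 a b)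
  have ca : Elastica.cut a b f a = 0 := by rw [cut_of_lt hb ⟨le_rfl, hab⟩, fa]
  refine .of_base Real.two_pi_pos (cut_periodic pf) (cut_periodic pg) (t := a) hi fun x hx => ?_
  rw [ca, sub_zero]
  rcases lt_or_ge x b with hxb | hxb
  · rw [key1 x ⟨hx.1, hxb.le⟩, cut_of_lt hb ⟨hx.1, hxb⟩]
  · have i1 : IntervalIntegrable (Elastica.cut a b g) volume a b := hi.mono_set (by
      rw [Set.uIcc_of_le hab.le, Set.uIcc_of_le (hab.le.trans hb)]
      exact Set.Icc_subset_Icc le_rfl hb)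
    have i2 : IntervalIntegrable (Elastica.cut a b g) volume b x := hi.mono_set (by
      rw [Set.uIcc_of_le hxb, Set.uIcc_of_le (hab.le.trans hb)]
      exact Set.Icc_subset_Icc hab.le hx.2)
    rw [← intervalIntegral.integral_add_adjacent_intervals i1 i2, key1 b ⟨hab.le, le_rfl⟩, fb,
      zero_add, intervalIntegral.integral_congr_uIoo (g := fun _ => (0 : ℝ)) fun y hy => ?_]
    · rw [intervalIntegral.integral_zero]
      rcases hx.2.lt_or_eq with hlt | heq
      · rw [cut_of_ge hab ⟨hxb, hlt⟩]
      · rw [heq, cut_periodic pf a, ca]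
    · rw [Set.uIoo_of_le hxb] at hy
      exact cut_of_ge hab ⟨hy.1.le, hy.2.trans_le hx.2⟩

/-- Two applications of the zero extension, to `u` and to `p`. Both must vanish at the ends for the
result to stay in W^{2,2}; this is why the ends are later taken at contact points. -/
theorem IsPer2.cut {u p q : ℝ → ℝ} (hab : a < b) (hb : b ≤ a + 2 * Real.pi) (h : IsPer2 u p q)
    (ua : u a = 0) (ub : u b = 0) (pa : p a = 0) (pb : p b = 0) :
    IsPer2 (cut a b u) (cut a b p) (cut a b q) := by
  have h1 := h.isH1_u.1.cut hab hb h.per_u h.per_p ua ub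
  have h2 := h.prim.cut hab hb h.per_p h.per_q pa pb
  refine ⟨cut_periodic h.per_u, cut_periodic h.per_p, cut_periodic h.per_q,
    h1.hasDerivAt h2.continuous, h2, fun c d => ?_⟩
  have e : (fun x => Elastica.cut a b q x ^ 2) = Elastica.cut a b (fun x => q x ^ 2) := by
    funext x
    simp only [Elastica.cut]
    split_ifs <;> simp
  rw [e]
  exact (cut_periodic (h.per_q.comp fun y => y ^ 2)).intervalIntegrable Real.two_pi_pos.ne'
    (intervalIntegrable_cut hab hb (h.sq a b)) c d

end

set_option maxHeartbeats 1000000 in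
/-- Bounds for the coefficients of the first variations. -/
theorem coefficient_bounds {u p δ : ℝ} (hδ : δ ≤ 1 / 4) (hu : |u| ≤ δ) (hp : |p| ≤ δ) :
    1 ≤ (1 - u ^ 2 - p ^ 2)⁻¹ ∧ (1 - u ^ 2 - p ^ 2)⁻¹ ≤ 1 + 4 * δ ^ 2 ∧
    1 ≤ (√(1 - u ^ 2 - p ^ 2) * (1 - u ^ 2))⁻¹ ∧
    (√(1 - u ^ 2 - p ^ 2) * (1 - u ^ 2))⁻¹ ≤ 1 + 6 * δ ^ 2 ∧
    |2 * √(1 - u ^ 2 - p ^ 2) / (1 - u ^ 2) ^ 2 - (√(1 - u ^ 2 - p ^ 2) * (1 - u ^ 2))⁻¹ - 1| ≤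
      14 * δ ^ 2 ∧
    |√(1 - u ^ 2 - p ^ 2) / (1 - u ^ 2) - 1 - (u ^ 2 - p ^ 2) / 2| ≤ 4 * δ ^ 4 := by
  have hδ0 : 0 ≤ δ := (abs_nonneg _).trans hu
  have hδ2 : δ ^ 2 ≤ 1 / 16 := by
    calc δ ^ 2 ≤ (1 / 4) ^ 2 := by gcongr
      _ = 1 / 16 := by norm_num
  have hu2 : u ^ 2 ≤ δ ^ 2 := sq_le_sq' (by linarith [abs_le.1 hu]) (abs_le.1 hu).2
  have hp2 : p ^ 2 ≤ δ ^ 2 := sq_le_sq' (by linarith [abs_le.1 hp]) (abs_le.1 hp).2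
  have e4 : δ ^ 4 = δ ^ 2 * δ ^ 2 := by ring
  rw [e4]
  have hx0 := sq_nonneg u
  have hy0 := sq_nonneg p
  -- Only squares occur, so the claims become elementary inequalities for 0 ≤ x, y ≤ D ≤ 1/16.
  generalize u ^ 2 = x at *
  generalize p ^ 2 = y at *
  generalize δ ^ 2 = D at *
  have hD0 : 0 ≤ D := hx0.trans hu2
  have hm0 : 0 < 1 - x - y := by linarith
  have hS : √(1 - x - y) ^ 2 = 1 - x - y := Real.sq_sqrt hm0.le
  have hS1 : √(1 - x - y) ≤ 1 - (x + y) / 2 := by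
    rw [Real.sqrt_le_left (by linarith)]
    nlinarith [sq_nonneg (x + y)]
  have hS2 : 1 - (x + y) / 2 - (x + y) ^ 2 / 2 ≤ √(1 - x - y) := by
    refine Real.le_sqrt_of_sq_le ?_
    have hw : x + y ≤ 1 / 8 := by linarith
    have hw0 : 0 ≤ x + y := by linarith
    have e : (1 - (x + y) / 2 - (x + y) ^ 2 / 2) ^ 2 = 1 - (x + y) -
      (x + y) ^ 2 * (3 / 4 - (x + y) / 2 - (x + y) ^ 2 / 4) := by ring
    rw [e]
    have : 0 ≤ (x + y) ^ 2 * (3 / 4 - (x + y) / 2 - (x + y) ^ 2 / 4) := by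
      refine mul_nonneg (sq_nonneg _) ?_
      nlinarith
    linarith
  have hw2 : (x + y) ^ 2 ≤ 4 * (D * D) := by nlinarith
  have hDD : D * D ≤ D / 16 := by nlinarith
  set S := √(1 - x - y)
  have hS3 : 1 - 2 * D ≤ S := by linarith
  have hS4 : S ≤ 1 := by linarith
  have hS0 : 0 < S := by linarith
  have hR0 : 0 < 1 - x := by linarith
  have hSx : S * x ≤ 1 * x := mul_le_mul_of_nonneg_right hS4 hx0
  have hSx0 : 0 ≤ S * x := mul_nonneg hS0.le hx0
  have hSR : 1 - 3 * D ≤ S * (1 - x) := by linarith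
  have hSR1 : S * (1 - x) ≤ 1 := by linarith
  have hSR0 : 0 < S * (1 - x) := by positivity
  have k3 : 1 ≤ (S * (1 - x))⁻¹ := (one_le_inv₀ hSR0).2 hSR1
  have k4 : (S * (1 - x))⁻¹ ≤ 1 + 6 * D := by
    rw [inv_le_comm₀ hSR0 (by positivity), inv_le_iff_one_le_mul₀ (by positivity)]
    have := mul_le_mul_of_nonneg_right hSR (show 0 ≤ 1 + 6 * D by linarith)
    linarith
  have hq0 : 0 < (1 - x) ^ 2 := by positivity
  have k5 : 2 * S / (1 - x) ^ 2 ≤ 2 + 8 * D := by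
    rw [div_le_iff₀ hq0]
    have h1 : 1 - 2 * x ≤ (1 - x) ^ 2 := by linarith [mul_nonneg hx0 hx0, sq x, sq_nonneg x,
      show (1 - x) ^ 2 = 1 - 2 * x + x ^ 2 by ring]
    have h2 : (2 + 8 * D) * (1 - 2 * x) ≤ (2 + 8 * D) * (1 - x) ^ 2 :=
      mul_le_mul_of_nonneg_left h1 (by linarith)
    have h3 : D * x ≤ D * (1 / 16) := mul_le_mul_of_nonneg_left (by linarith) hD0
    linarith [show (2 + 8 * D) * (1 - 2 * x) = 2 + 8 * D - 4 * x - 16 * (D * x) by ring]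
  have k6 : 2 - 4 * D ≤ 2 * S / (1 - x) ^ 2 := by
    rw [le_div_iff₀ hq0]
    have h1 : (1 - x) ^ 2 ≤ 1 := pow_le_one₀ hR0.le (by linarith)
    have h2 : (2 - 4 * D) * (1 - x) ^ 2 ≤ (2 - 4 * D) * 1 :=
      mul_le_mul_of_nonneg_left h1 (by linarith)
    linarith
  refine ⟨(one_le_inv₀ hm0).2 (by linarith), ?_, k3, k4, ?_, ?_⟩
  · rw [inv_le_comm₀ hm0 (by positivity), inv_le_iff_one_le_mul₀ (by positivity)]
    have := mul_le_mul_of_nonneg_right (show 1 - 2 * D ≤ 1 - x - y by linarith)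
      (show 0 ≤ 1 + 4 * D by linarith)
    linarith
  · rw [abs_le]
    constructor <;> linarith
  · have e : S / (1 - x) - 1 - (x - y) / 2 =
        (S - (1 - x) * (1 + (x - y) / 2)) / (1 - x) := by field_simp; ring
    rw [e, abs_le, div_le_iff₀ hR0, le_div_iff₀ hR0]
    have hxD : x * x ≤ D * D := mul_le_mul hu2 hu2 hx0 hD0
    have hyD : x * y ≤ D * D := mul_le_mul hu2 hp2 hy0 hD0
    have hDDx : D * D * x ≤ D * D * (1 / 16) :=
      mul_le_mul_of_nonneg_left (by linarith) (mul_nonneg hD0 hD0)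
    have hxx := mul_nonneg hx0 hx0
    have hxy := mul_nonneg hx0 hy0
    have hDD0 := mul_nonneg hD0 hD0
    have e1 : (1 - x) * (1 + (x - y) / 2) = 1 - (x + y) / 2 - (x * x) / 2 + (x * y) / 2 := by ring
    have e2 : 4 * (D * D) * (1 - x) = 4 * (D * D) - 4 * (D * D * x) := by ring
    rw [neg_mul, e1, e2]
    clear_value S
    clear e k3 k4 k5 k6 hSR hSR1 hSx hSx0 hq0 hR0 hSR0 hDD hS3 hS4 hS0 hS hm0
    constructor <;> linarith

end Elastica

/-! ### Leading order of the first variations near the equator. -/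

namespace Elastica

theorem abs_integral_sub_le {F G H : ℝ → ℝ} {a b : ℝ} (hab : a ≤ b)
    (hF : IntervalIntegrable F volume a b) (hG : IntervalIntegrable G volume a b)
    (hH : IntervalIntegrable H volume a b) (h : ∀ x, |F x - G x| ≤ H x) :
    |(∫ x in a..b, F x) - ∫ x in a..b, G x| ≤ ∫ x in a..b, H x := by
  rw [← intervalIntegral.integral_sub hF hG]
  exact (intervalIntegral.abs_integral_le_integral_abs hab).trans
    (intervalIntegral.integral_mono_on hab (hF.sub hG).abs hH fun x _ => h x)

/-- The second-order part of the rotation density is (u² − p²)/2, whose first variation is `u * φ -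
p * φ'`. -/
theorem rotation_density_approx {u p φ φ' δ : ℝ} (hδ : δ ≤ 1 / 4) (hu : |u| ≤ δ) (hp : |p| ≤ δ) :
    |-(u * φ + p * φ') / (√(1 - u ^ 2 - p ^ 2) * (1 - u ^ 2)) +
      2 * u * √(1 - u ^ 2 - p ^ 2) * φ / (1 - u ^ 2) ^ 2 - (u * φ - p * φ')| ≤
      14 * δ ^ 2 * |u * φ| + 6 * δ ^ 2 * |p * φ'| := by
  obtain ⟨-, -, h3, h4, h5, -⟩ := coefficient_bounds hδ hu hp
  have e : -(u * φ + p * φ') / (√(1 - u ^ 2 - p ^ 2) * (1 - u ^ 2)) +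
      2 * u * √(1 - u ^ 2 - p ^ 2) * φ / (1 - u ^ 2) ^ 2 - (u * φ - p * φ') =
      (2 * √(1 - u ^ 2 - p ^ 2) / (1 - u ^ 2) ^ 2 - (√(1 - u ^ 2 - p ^ 2) * (1 - u ^ 2))⁻¹ - 1) *
        (u * φ) - ((√(1 - u ^ 2 - p ^ 2) * (1 - u ^ 2))⁻¹ - 1) * (p * φ') := by
    simp only [div_eq_mul_inv]
    ring
  rw [e]
  refine (abs_sub _ _).trans ?_
  rw [abs_mul _ (u * φ), abs_mul _ (p * φ')]
  refine add_le_add (mul_le_mul_of_nonneg_right h5 (abs_nonneg _))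
    (mul_le_mul_of_nonneg_right ?_ (abs_nonneg _))
  rw [abs_of_nonneg (by linarith)]
  linarith

theorem energy_density_approx {A a c u p δ : ℝ} (hδ : δ ≤ 1 / 4) (hu : |u| ≤ δ) (hp : |p| ≤ δ) :
    |A * a / (1 - u ^ 2 - p ^ 2) + A ^ 2 * c / (1 - u ^ 2 - p ^ 2) ^ 2 - A * a| ≤
      4 * δ ^ 2 * |A * a| + 2 * A ^ 2 * |c| := by
  obtain ⟨h1, h2, -⟩ := coefficient_bounds hδ hu hp
  have hδ0 : 0 ≤ δ := (abs_nonneg _).trans hu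
  have hδ2 : δ ^ 2 ≤ 1 / 16 := by
    calc δ ^ 2 ≤ (1 / 4) ^ 2 := by gcongr
      _ = 1 / 16 := by norm_num
  simp only [div_eq_mul_inv, ← inv_pow]
  generalize (1 - u ^ 2 - p ^ 2)⁻¹ = i at *
  have e : A * a * i + A ^ 2 * c * i ^ 2 - A * a = (i - 1) * (A * a) + i ^ 2 * A ^ 2 * c := by ring
  have hi : i ^ 2 ≤ 2 := by
    calc i ^ 2 ≤ (5 / 4) ^ 2 := by gcongr; linarith
      _ ≤ 2 := by norm_num
  rw [e]
  refine (abs_add_le _ _).trans ?_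
  rw [abs_mul _ (A * a), abs_mul _ c, abs_of_nonneg (show 0 ≤ i - 1 by linarith),
    abs_of_nonneg (show 0 ≤ i ^ 2 * A ^ 2 by positivity)]
  gcongr
  linarith

theorem rotation_approx {u p : ℝ → ℝ} {δ : ℝ} (cu : Continuous u) (cp : Continuous p)
    (hδ : δ ≤ 1 / 4) (hu : ∀ s, |u s| ≤ δ) (hp : ∀ s, |p s| ≤ δ) :
    |rotation u p - 2 * Real.pi - (∫ s in (0 : ℝ)..2 * Real.pi, (u s ^ 2 - p s ^ 2)) / 2| ≤
      8 * Real.pi * δ ^ 4 := by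
  have i1 := (cont_rotation cu cp (speed_pos (fun s => (hu s).trans hδ)
    fun s => (hp s).trans hδ)).intervalIntegrable (μ := volume) 0 (2 * Real.pi)
  have i2 : IntervalIntegrable (fun s => 1 + (u s ^ 2 - p s ^ 2) / 2) volume 0 (2 * Real.pi) :=
    Continuous.intervalIntegrable (by fun_prop) _ _
  have key := abs_integral_sub_le Real.two_pi_pos.le i1 i2 (intervalIntegrable_const (c := 4 * δ ^ 4))
    fun s => by
      obtain ⟨-, -, -, -, -, h6⟩ := coefficient_bounds hδ (hu s) (hp s)
      rwa [← sub_sub]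
  rw [intervalIntegral.integral_add (by simp) (Continuous.intervalIntegrable (by fun_prop) _ _),
    intervalIntegral.integral_div] at key
  simp only [intervalIntegral.integral_const, smul_eq_mul, sub_zero, mul_one, ← sub_sub] at key
  refine key.trans (le_of_eq (by ring))

/-- Height functions of curves close to the equator, with the curve above height `ε`. -/
structure NearEquator (ε δ : ℝ) (u p q : ℝ → ℝ) : Prop where
  per : IsPer2 u p q
  pos : 0 < ε
  le_u : ∀ s, ε ≤ u s
  u_le : ∀ s, u s ≤ δ
  p_le : ∀ s, |p s| ≤ δ
  small : δ ≤ 1 / 4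
  energy_le : ∫ s in (0 : ℝ)..2 * Real.pi, (q s + u s) ^ 2 ≤ ε * δ
  rot : rotation u p = 2 * Real.pi

namespace NearEquator

variable {ε δ : ℝ} {u p q : ℝ → ℝ}

theorem le_delta (h : NearEquator ε δ u p q) : ε ≤ δ := (h.le_u 0).trans (h.u_le 0)

theorem delta_pos (h : NearEquator ε δ u p q) : 0 < δ := h.pos.trans_le h.le_delta

theorem abs_u_le (h : NearEquator ε δ u p q) (s : ℝ) : |u s| ≤ δ := by
  rw [abs_of_pos (h.pos.trans_le (h.le_u s))]
  exact h.u_le s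

theorem speed_pos (h : NearEquator ε δ u p q) (s : ℝ) : 0 < 1 - u s ^ 2 - p s ^ 2 :=
  Elastica.speed_pos (fun s => (h.abs_u_le s).trans h.small) (fun s => (h.p_le s).trans h.small) s

/-- The difference of the height and the obstacle. -/
theorem per_sub (h : NearEquator ε δ u p q) : IsPer2 (fun s => u s - ε) p q := by
  simpa [sub_eq_add_neg] using h.per.add (IsPer2.const (-ε))

theorem integral_sum (h : IsPer2 u p q) :
    ∫ s in (0 : ℝ)..2 * Real.pi, (q s + u s) = ∫ s in (0 : ℝ)..2 * Real.pi, u s := by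
  rw [intervalIntegral.integral_add (h.prim.1 _ _) (h.cont_u.intervalIntegrable _ _), h.prim.2]
  have := h.per_p 0
  rw [zero_add] at this
  rw [this]
  ring

/-- The rotation is exactly 2π, so its quadratic part is no larger than the quartic error of
`rotation_approx`. -/
theorem integral_sq_sub_sq (h : NearEquator ε δ u p q) :
    |∫ s in (0 : ℝ)..2 * Real.pi, (u s ^ 2 - p s ^ 2)| ≤ 16 * Real.pi * δ ^ 4 := by
  have key := rotation_approx h.per.cont_u h.per.cont_p h.small h.abs_u_le h.p_le
  rw [h.rot, sub_self] at key
  rw [abs_le] at key ⊢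
  constructor <;> linarith [key.1, key.2]

/-- In the direction u − ε the leading density is u² − p² − εu, and the quadratic part integrates to
O(δ⁴). The constant 56π is 40π from the density error plus 16π from the constraint. -/
theorem rotationVar_approx (h : NearEquator ε δ u p q) :
    |rotationVar u p (fun s => u s - ε) p + ε * ∫ s in (0 : ℝ)..2 * Real.pi, u s| ≤
      56 * Real.pi * δ ^ 4 := by
  have cu := h.per.cont_u
  have cp := h.per.cont_p
  have hδ := h.delta_pos
  have i1 := (cont_rotationVar cu cp h.per_sub.cont_u cp h.speed_pos).intervalIntegrable
    (μ := volume) 0 (2 * Real.pi)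
  have i2 : IntervalIntegrable (fun s => u s * (u s - ε) - p s * p s) volume 0 (2 * Real.pi) :=
    Continuous.intervalIntegrable (by fun_prop) _ _
  have key := abs_integral_sub_le Real.two_pi_pos.le i1 i2 (intervalIntegrable_const (c := 20 * δ ^ 4))
    fun s => by
      refine (rotation_density_approx h.small (h.abs_u_le s) (h.p_le s)).trans ?_
      have h1 : |u s * (u s - ε)| ≤ δ * δ := by
        rw [abs_mul]
        refine mul_le_mul (h.abs_u_le s) ?_ (abs_nonneg _) hδ.le
        rw [abs_of_nonneg (by linarith [h.le_u s])]
        linarith [h.u_le s, h.pos]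
      have h2 : |p s * p s| ≤ δ * δ := by
        rw [abs_mul]
        exact mul_le_mul (h.p_le s) (h.p_le s) (abs_nonneg _) hδ.le
      calc _ ≤ 14 * δ ^ 2 * (δ * δ) + 6 * δ ^ 2 * (δ * δ) := by gcongr
        _ = 20 * δ ^ 4 := by ring
  have e : ∫ s in (0 : ℝ)..2 * Real.pi, (u s * (u s - ε) - p s * p s) =
      (∫ s in (0 : ℝ)..2 * Real.pi, (u s ^ 2 - p s ^ 2)) - ε * ∫ s in (0 : ℝ)..2 * Real.pi, u s := by
    rw [← intervalIntegral.integral_const_mul, ← intervalIntegral.integral_sub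
      (Continuous.intervalIntegrable (by fun_prop) _ _)
      (Continuous.intervalIntegrable (by fun_prop) _ _)]
    congr 1
    funext s
    ring
  rw [e] at key
  have h3 := h.integral_sq_sub_sq
  simp only [intervalIntegral.integral_const, smul_eq_mul, sub_zero] at key
  unfold rotationVar
  rw [abs_le] at key h3 ⊢
  constructor <;> linarith [key.1, key.2, h3.1, h3.2]

/-- The leading density is (q + u)(q + u − ε), and ∫ q = 0 over a period. -/
theorem energyVar_approx (h : NearEquator ε δ u p q) :
    |energyVar u p q (fun s => u s - ε) p q - ((∫ s in (0 : ℝ)..2 * Real.pi, (q s + u s) ^ 2) -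
      ε * ∫ s in (0 : ℝ)..2 * Real.pi, u s)| ≤ 23 * δ ^ 4 := by
  have cu := h.per.cont_u
  have cp := h.per.cont_p
  have hδ := h.delta_pos
  have i1 := int_energyVar h.per h.per_sub h.speed_pos 0 (2 * Real.pi)
  have j1 := h.per.int_sum_sq 0 (2 * Real.pi)
  have j2 := h.per.int_sum 0 (2 * Real.pi)
  have i2 : IntervalIntegrable (fun s => (q s + u s) ^ 2 - ε * (q s + u s)) volume 0 (2 * Real.pi) :=
    j1.sub (j2.const_mul ε)
  have i3 : IntervalIntegrable (fun s => 10 * δ ^ 2 * (q s + u s) ^ 2 + 2 * δ ^ 4)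
      volume 0 (2 * Real.pi) := (j1.const_mul _).add intervalIntegrable_const
  have key := abs_integral_sub_le Real.two_pi_pos.le i1 i2 i3 fun s => by
    have h0 := energy_density_approx (A := q s + u s) (a := q s + (u s - ε))
      (c := u s * (u s - ε) + p s * p s) h.small (h.abs_u_le s) (h.p_le s)
    have e0 : (q s + u s) * (q s + (u s - ε)) = (q s + u s) ^ 2 - ε * (q s + u s) := by ring
    rw [← e0]
    refine h0.trans ?_
    have h1 : |u s * (u s - ε) + p s * p s| ≤ 2 * δ ^ 2 := by
      have a1 := h.le_u s
      have a2 := h.u_le s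
      have a3 : p s * p s ≤ δ * δ := by
        rw [← abs_mul_abs_self]
        exact mul_le_mul (h.p_le s) (h.p_le s) (abs_nonneg _) hδ.le
      have a4 : u s * (u s - ε) ≤ δ * δ :=
        mul_le_mul a2 (by linarith [h.pos]) (by linarith) hδ.le
      have a5 : 0 ≤ u s * (u s - ε) := mul_nonneg (by linarith [h.pos]) (by linarith)
      rw [abs_of_nonneg (add_nonneg a5 (mul_self_nonneg _))]
      linarith
    have h2 : |(q s + u s) * (q s + (u s - ε))| ≤ 3 / 2 * (q s + u s) ^ 2 + δ ^ 2 / 2 := by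
      have a1 : ε ^ 2 ≤ δ ^ 2 := pow_le_pow_left₀ h.pos.le h.le_delta 2
      rw [e0, abs_le]
      constructor <;> nlinarith [sq_nonneg (q s + u s - ε), sq_nonneg (q s + u s + ε),
        sq_nonneg (q s + u s)]
    calc _ ≤ 4 * δ ^ 2 * (3 / 2 * (q s + u s) ^ 2 + δ ^ 2 / 2) +
          2 * (q s + u s) ^ 2 * (2 * δ ^ 2) := by gcongr
      _ = 10 * δ ^ 2 * (q s + u s) ^ 2 + 2 * δ ^ 4 := by ring
  rw [intervalIntegral.integral_sub j1 (j2.const_mul ε), intervalIntegral.integral_const_mul,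
    integral_sum h.per, intervalIntegral.integral_add (j1.const_mul _) (by simp),
    intervalIntegral.integral_const_mul] at key
  simp only [intervalIntegral.integral_const, smul_eq_mul, sub_zero] at key
  refine key.trans ?_
  have h4 : ∫ s in (0 : ℝ)..2 * Real.pi, (q s + u s) ^ 2 ≤ δ ^ 2 :=
    h.energy_le.trans (by nlinarith [h.le_delta])
  have h5 := mul_le_mul_of_nonneg_left h4 (show 0 ≤ 10 * δ ^ 2 by positivity)
  have h6 := mul_le_mul_of_nonneg_right Real.pi_lt_d2.le (show 0 ≤ δ ^ 4 by positivity)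
  have e4 : 10 * δ ^ 2 * δ ^ 2 = 10 * δ ^ 4 := by ring
  linarith [show 0 ≤ δ ^ 4 by positivity]

/-- Needed only if there were no contact: then constants are admissible directions, and both
variations equal ∫ u to leading order. -/
theorem energyVar_one_approx (h : NearEquator ε δ u p q) :
    |energyVar u p q (fun _ => 1) (fun _ => 0) (fun _ => 0) - ∫ s in (0 : ℝ)..2 * Real.pi, u s| ≤
      18 * δ ^ 3 := by
  have cu := h.per.cont_u
  have hδ := h.delta_pos
  have i1 := int_energyVar h.per (IsPer2.const 1) h.speed_pos 0 (2 * Real.pi)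
  have j1 := h.per.int_sum_sq 0 (2 * Real.pi)
  have j2 := h.per.int_sum 0 (2 * Real.pi)
  have i3 : IntervalIntegrable (fun s => 4 * δ * (q s + u s) ^ 2 + 2 * δ ^ 3)
      volume 0 (2 * Real.pi) := (j1.const_mul _).add intervalIntegrable_const
  have key := abs_integral_sub_le Real.two_pi_pos.le i1 j2 i3 fun s => by
    have h0 := energy_density_approx (A := q s + u s) (a := 0 + 1)
      (c := u s * 1 + p s * 0) h.small (h.abs_u_le s) (h.p_le s)
    have e0 : (q s + u s) * (0 + 1) = q s + u s := by ring
    rw [e0] at h0 ⊢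
    refine h0.trans ?_
    have h1 : |u s * 1 + p s * 0| ≤ δ := by simpa using h.abs_u_le s
    have h2 : 2 * δ * |q s + u s| ≤ (q s + u s) ^ 2 + δ ^ 2 := by
      rw [← sq_abs (q s + u s)]
      linarith [sq_nonneg (|q s + u s| - δ)]
    calc _ ≤ 2 * δ * (2 * δ * |q s + u s|) + 2 * (q s + u s) ^ 2 * δ := by
            have := mul_le_mul_of_nonneg_left h1 (show 0 ≤ 2 * (q s + u s) ^ 2 by positivity)
            linarith
      _ ≤ 2 * δ * ((q s + u s) ^ 2 + δ ^ 2) + 2 * (q s + u s) ^ 2 * δ := by gcongr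
      _ = 4 * δ * (q s + u s) ^ 2 + 2 * δ ^ 3 := by ring
  rw [integral_sum h.per, intervalIntegral.integral_add (j1.const_mul _) (by simp),
    intervalIntegral.integral_const_mul] at key
  simp only [intervalIntegral.integral_const, smul_eq_mul, sub_zero] at key
  refine key.trans ?_
  have h4 : ∫ s in (0 : ℝ)..2 * Real.pi, (q s + u s) ^ 2 ≤ δ ^ 2 :=
    h.energy_le.trans (by nlinarith [h.le_delta])
  have h5 := mul_le_mul_of_nonneg_left h4 (show 0 ≤ 4 * δ by positivity)
  have h6 := mul_le_mul_of_nonneg_right Real.pi_lt_d2.le (show 0 ≤ δ ^ 3 by positivity)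
  have e4 : 4 * δ * δ ^ 2 = 4 * δ ^ 3 := by ring
  linarith [show 0 ≤ δ ^ 3 by positivity]

theorem rotationVar_one_approx (h : NearEquator ε δ u p q) :
    |rotationVar u p (fun _ => 1) (fun _ => 0) - ∫ s in (0 : ℝ)..2 * Real.pi, u s| ≤
      90 * δ ^ 3 := by
  have cu := h.per.cont_u
  have cp := h.per.cont_p
  have hδ := h.delta_pos
  have i1 := (cont_rotationVar (φ := fun _ => (1 : ℝ)) (φ' := fun _ => (0 : ℝ)) cu cp
    continuous_const continuous_const h.speed_pos).intervalIntegrable (μ := volume) 0 (2 * Real.pi)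
  have key := abs_integral_sub_le Real.two_pi_pos.le i1 (cu.intervalIntegrable _ _)
    (intervalIntegrable_const (c := 14 * δ ^ 3)) fun s => by
      have h0 := rotation_density_approx (φ := 1) (φ' := 0) h.small (h.abs_u_le s) (h.p_le s)
      simp only [mul_one, mul_zero, sub_zero, abs_zero, add_zero] at h0 ⊢
      refine h0.trans ?_
      calc _ ≤ 14 * δ ^ 2 * δ := by gcongr; exact h.abs_u_le s
        _ = 14 * δ ^ 3 := by ring
  simp only [intervalIntegral.integral_const, smul_eq_mul, sub_zero] at key
  refine key.trans ?_
  have h6 := mul_le_mul_of_nonneg_right Real.pi_lt_d2.le (show 0 ≤ δ ^ 3 by positivity)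
  linarith [show 0 ≤ δ ^ 3 by positivity]

end NearEquator

end Elastica

/-! ### Multiplier bounds and existence of contact. -/

namespace Elastica

/-- Cauchy–Schwarz against the constant 1, read off from ∫ ((b − a) f − y)² ≥ 0. -/
theorem sq_integral_le {f : ℝ → ℝ} {a b : ℝ} (hab : a ≤ b) (hf : IntervalIntegrable f volume a b)
    (hf2 : IntervalIntegrable (fun x => f x ^ 2) volume a b) :
    (∫ x in a..b, f x) ^ 2 ≤ (b - a) * ∫ x in a..b, f x ^ 2 := by
  rcases hab.eq_or_lt with rfl | hlt
  · simp
  set y := ∫ x in a..b, f x with hy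
  have h0 : 0 ≤ ∫ x in a..b, ((b - a) * f x - y) ^ 2 :=
    intervalIntegral.integral_nonneg hab fun x _ => sq_nonneg _
  have e : ∫ x in a..b, ((b - a) * f x - y) ^ 2 =
      (b - a) * ((b - a) * (∫ x in a..b, f x ^ 2) - y ^ 2) := by
    have e1 : (fun x => ((b - a) * f x - y) ^ 2) =
        fun x => (b - a) ^ 2 * f x ^ 2 - 2 * (b - a) * y * f x + y ^ 2 := by
      funext x; ring
    rw [e1, intervalIntegral.integral_add ((hf2.const_mul _).sub (hf.const_mul _)) (by simp),
      intervalIntegral.integral_sub (hf2.const_mul _) (hf.const_mul _),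
      intervalIntegral.integral_const_mul, intervalIntegral.integral_const_mul, ← hy]
    simp only [intervalIntegral.integral_const, smul_eq_mul]
    ring
  rw [e] at h0
  linarith [(mul_nonneg_iff_of_pos_left (sub_pos.2 hlt)).1 h0]

/-- Used with `D` = −M and `P` = L. The square (q + u − ε)² provides q²/2 at the cost of (u − ε)².
The term linear in `q` is kept separate because its integral nearly vanishes. The terms in ε(u − ε)
have combined coefficient close to `D + P`, and `hDP` gives them a sign, so they can be dropped. -/
theorem component_density {D P δ ε u p q : ℝ} (hδ : δ ≤ 1 / 4) (hu : |u| ≤ δ) (hp : |p| ≤ δ)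
    (hε : 0 ≤ ε) (hle : ε ≤ u) (hD : 0 ≤ D) (hDP : 14 * δ ^ 2 * |P| ≤ D + P) :
    D / 2 * q ^ 2 + D * ε * ((1 - u ^ 2 - p ^ 2)⁻¹ * q) -
      ((D + 2 * |P|) * (u - ε) ^ 2 + 2 * |P| * p ^ 2) ≤
    D * ((q + u) * (q + (u - ε)) / (1 - u ^ 2 - p ^ 2) +
      (q + u) ^ 2 * (u * (u - ε) + p * p) / (1 - u ^ 2 - p ^ 2) ^ 2) +
    P * (-(u * (u - ε) + p * p) / (√(1 - u ^ 2 - p ^ 2) * (1 - u ^ 2)) +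
      2 * u * √(1 - u ^ 2 - p ^ 2) * (u - ε) / (1 - u ^ 2) ^ 2) := by
  obtain ⟨h1, -, h3, h4, h5, -⟩ := coefficient_bounds hδ hu hp
  have hδ0 : 0 ≤ δ := (abs_nonneg _).trans hu
  have hδ2 : δ ^ 2 ≤ 1 / 16 := by
    calc δ ^ 2 ≤ (1 / 4) ^ 2 := by gcongr
      _ = 1 / 16 := by norm_num
  have e : -(u * (u - ε) + p * p) / (√(1 - u ^ 2 - p ^ 2) * (1 - u ^ 2)) +
      2 * u * √(1 - u ^ 2 - p ^ 2) * (u - ε) / (1 - u ^ 2) ^ 2 =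
      (2 * √(1 - u ^ 2 - p ^ 2) / (1 - u ^ 2) ^ 2 - (√(1 - u ^ 2 - p ^ 2) * (1 - u ^ 2))⁻¹) *
        (u * (u - ε)) - (√(1 - u ^ 2 - p ^ 2) * (1 - u ^ 2))⁻¹ * p ^ 2 := by
    simp only [div_eq_mul_inv]
    ring
  rw [e]
  simp only [div_eq_mul_inv _ (1 - u ^ 2 - p ^ 2), div_eq_mul_inv _ ((1 - u ^ 2 - p ^ 2) ^ 2),
    ← inv_pow]
  generalize (√(1 - u ^ 2 - p ^ 2) * (1 - u ^ 2))⁻¹ = g at *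
  generalize 2 * √(1 - u ^ 2 - p ^ 2) / (1 - u ^ 2) ^ 2 - g = β at *
  generalize (1 - u ^ 2 - p ^ 2)⁻¹ = i at *
  obtain ⟨w, rfl⟩ : ∃ w, u = ε + w := ⟨u - ε, by ring⟩
  have hw : 0 ≤ w := by linarith
  have eW : ε + w - ε = w := by ring
  rw [eW]
  have k1 : 0 ≤ (q + (ε + w)) ^ 2 * ((ε + w) * w + p * p) * i ^ 2 :=
    mul_nonneg (mul_nonneg (sq_nonneg _) (add_nonneg (mul_nonneg (by linarith) hw)
      (mul_self_nonneg _))) (sq_nonneg _)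
  have k2 : (q + w) ^ 2 ≤ (q + w) ^ 2 * i := le_mul_of_one_le_right (sq_nonneg _) h1
  have k3 : q ^ 2 / 2 - w ^ 2 ≤ (q + w) ^ 2 := by linarith [sq_nonneg (q + 2 * w)]
  have hεw : 0 ≤ ε * w := mul_nonneg hε hw
  have k4 : ε * w ≤ ε * w * i := le_mul_of_one_le_right hεw h1
  have hL : q ^ 2 / 2 - w ^ 2 + ε * (i * q) + ε * w ≤ (q + (ε + w)) * (q + w) * i +
      (q + (ε + w)) ^ 2 * ((ε + w) * w + p * p) * i ^ 2 := by
    linarith [show (q + (ε + w)) * (q + w) * i = (q + w) ^ 2 * i + ε * (i * q) + ε * w * i by ring]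
  have hDL := mul_le_mul_of_nonneg_left hL hD
  have m0 : |P * (β - 1)| ≤ |P| * (14 * δ ^ 2) := by
    rw [abs_mul]; exact mul_le_mul_of_nonneg_left h5 (abs_nonneg _)
  have m1 : |P * β| ≤ 2 * |P| := by
    have : |β| ≤ 2 := by
      rw [abs_le] at h5 ⊢
      constructor <;> linarith [h5.1, h5.2]
    rw [abs_mul, mul_comm 2]; exact mul_le_mul_of_nonneg_left this (abs_nonneg _)
  have m2 : |P * g| ≤ 2 * |P| := by
    rw [abs_mul, mul_comm 2]
    refine mul_le_mul_of_nonneg_left ?_ (abs_nonneg _)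
    rw [abs_of_nonneg (by linarith)]
    linarith
  have n0 := mul_le_mul_of_nonneg_right (abs_le.1 m0).1 hεw
  have n1 := mul_le_mul_of_nonneg_right (abs_le.1 m1).1 (sq_nonneg w)
  have n2 := mul_le_mul_of_nonneg_right (abs_le.1 m2).2 (sq_nonneg p)
  have n3 := mul_le_mul_of_nonneg_right hDP hεw
  linarith

namespace NearEquator

variable {ε δ : ℝ} {u p q : ℝ → ℝ}

theorem integral_u_bounds (h : NearEquator ε δ u p q) :
    2 * Real.pi * ε ≤ ∫ s in (0 : ℝ)..2 * Real.pi, u s ∧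
    ∫ s in (0 : ℝ)..2 * Real.pi, u s ≤ 2 * Real.pi * δ ∧
    2 * ε * (∫ s in (0 : ℝ)..2 * Real.pi, u s) - 2 * Real.pi * ε ^ 2 ≤
      ∫ s in (0 : ℝ)..2 * Real.pi, (q s + u s) ^ 2 := by
  have iu := h.per.cont_u.intervalIntegrable (μ := volume) 0 (2 * Real.pi)
  have j1 := h.per.int_sum_sq 0 (2 * Real.pi)
  have j2 := h.per.int_sum 0 (2 * Real.pi)
  refine ⟨?_, ?_, ?_⟩
  · have := intervalIntegral.integral_mono_on Real.two_pi_pos.le (intervalIntegrable_const (c := ε))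
      iu fun x _ => h.le_u x
    simpa using this
  · have := intervalIntegral.integral_mono_on Real.two_pi_pos.le iu
      (intervalIntegrable_const (c := δ)) fun x _ => h.u_le x
    simpa using this
  -- Integrate (q + u − ε)² ≥ 0 and use ∫ q = 0.
  · have h0 := intervalIntegral.integral_mono_on Real.two_pi_pos.le
      ((j2.const_mul (2 * ε)).sub (intervalIntegrable_const (c := ε ^ 2))) j1 fun x _ => by
        linarith [sq_nonneg (q x + u x - ε)]
    rw [intervalIntegral.integral_sub (j2.const_mul _) (by simp),
      intervalIntegral.integral_const_mul, integral_sum h.per] at h0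
    simpa using h0

/-- The terms ε ∫ u cancel in L − M, leaving ∫ (q + u)² ≥ 2ε ∫ u − 2πε² ≥ 2πε². The errors of order
δ⁴ are absorbed through `h4`, and 2π > 6.28 leaves room for the constant 6. -/
theorem multiplier_bounds (h : NearEquator ε δ u p q) (h4 : 1000000 * δ ^ 4 ≤ ε ^ 2) :
    6 * ε ^ 2 ≤ -rotationVar u p (fun s => u s - ε) p ∧
    6 * ε ^ 2 ≤ -rotationVar u p (fun s => u s - ε) p + energyVar u p q (fun s => u s - ε) p q ∧
    -rotationVar u p (fun s => u s - ε) p ≤ 7 * (ε * δ) ∧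
    |energyVar u p q (fun s => u s - ε) p q| ≤ 9 * (ε * δ) := by
  obtain ⟨b1, b2, b3⟩ := h.integral_u_bounds
  have hM := h.rotationVar_approx
  have hL := h.energyVar_approx
  have hI := h.energy_le
  have hI0 : 0 ≤ ∫ s in (0 : ℝ)..2 * Real.pi, (q s + u s) ^ 2 :=
    intervalIntegral.integral_nonneg Real.two_pi_pos.le fun x _ => sq_nonneg _
  generalize (∫ s in (0 : ℝ)..2 * Real.pi, (q s + u s) ^ 2) = I at *
  generalize (∫ s in (0 : ℝ)..2 * Real.pi, u s) = U at *
  generalize rotationVar u p (fun s => u s - ε) p = M at *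
  generalize energyVar u p q (fun s => u s - ε) p q = L at *
  have c1 := mul_le_mul_of_nonneg_left b1 h.pos.le
  have c2 := mul_le_mul_of_nonneg_left b2 h.pos.le
  have hεδ : ε ^ 2 ≤ ε * δ := by rw [sq]; exact mul_le_mul_of_nonneg_left h.le_delta h.pos.le
  have p1 := Real.pi_gt_d2
  have p2 := Real.pi_lt_d2
  have d4 : 0 ≤ δ ^ 4 := by have := h.delta_pos; positivity
  have e4 : 56 * Real.pi * δ ^ 4 ≤ 200 * δ ^ 4 := by
    have := mul_le_mul_of_nonneg_right p2.le d4
    linarith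
  have e5 : 6.28 * ε ^ 2 ≤ 2 * Real.pi * ε ^ 2 := by
    have := mul_le_mul_of_nonneg_right p1.le (sq_nonneg ε)
    linarith
  have e6 : 2 * Real.pi * (ε * δ) ≤ 6.3 * (ε * δ) := by
    have := mul_le_mul_of_nonneg_right p2.le (mul_nonneg h.pos.le h.delta_pos.le)
    linarith
  rw [abs_le] at hM hL
  obtain ⟨M1, M2⟩ := hM
  obtain ⟨L1, L2⟩ := hL
  have hs := sq_nonneg ε
  clear h
  refine ⟨by linarith, by linarith, by linarith, ?_⟩
  rw [abs_le]
  constructor <;> linarith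

/-- A minimizer touches the obstacle. -/
theorem exists_contact (h : NearEquator ε δ u p q) (h4 : 1000000 * δ ^ 4 ≤ ε ^ 2)
    (h5 : 1000000 * δ ^ 5 ≤ ε ^ 3) (hmin : IsHeightMinimizer ε u p q) : ∃ s, u s = ε := by
  by_contra! hne
  obtain ⟨c, hc, hcu⟩ := exists_pos_le_of_periodic h.per_sub.cont_u h.per_sub.per_u fun s =>
    sub_pos.2 (lt_of_le_of_ne (h.le_u s) (hne s).symm)
  obtain ⟨m1, m2, m3, m4⟩ := h.multiplier_bounds h4
  have hε := h.pos
  have he : 0 < ε ^ 2 := by positivity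
  -- The gap `u - ε ≥ c` makes the constant 1 admissible; the factor `1 + c⁻¹` dominates both test
  -- functions.
  have EL := hmin.euler_lagrange (B := 1 + c⁻¹) h.per (fun s => (h.abs_u_le s).trans h.small)
    (fun s => (h.p_le s).trans h.small) h.le_u h.per_sub (IsPer2.const 1) (fun s => by
      have : 0 ≤ u s - ε := hc.le.trans (hcu s)
      rw [abs_of_nonneg this]
      exact le_mul_of_one_le_left this (by linarith [inv_pos.2 hc])) (fun s => by
      have := mul_le_mul_of_nonneg_left (hcu s) (inv_pos.2 hc).le
      rw [inv_mul_cancel₀ hc.ne'] at this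
      rw [abs_one]
      linarith [hcu s]) (by linarith)
  have k1 := h.energyVar_one_approx
  have k2 := h.rotationVar_one_approx
  obtain ⟨b1, -, -⟩ := h.integral_u_bounds
  have hδ := h.delta_pos
  have hεδ : ε * δ ≤ δ ^ 2 := by rw [sq]; exact mul_le_mul_of_nonneg_right h.le_delta hδ.le
  generalize (∫ s in (0 : ℝ)..2 * Real.pi, u s) = U at *
  generalize rotationVar u p (fun s => u s - ε) p = M at *
  generalize energyVar u p q (fun s => u s - ε) p q = P at *
  generalize energyVar u p q (fun _ => 1) (fun _ => 0) (fun _ => 0) = L1 at *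
  generalize rotationVar u p (fun _ => 1) (fun _ => 0) = M1 at *
  have hU : 6 * ε ≤ U := by
    have := mul_le_mul_of_nonneg_right Real.pi_gt_d2.le hε.le
    linarith
  have hlow : 6 * ε ^ 2 * (6 * ε) ≤ (-M + P) * U :=
    mul_le_mul m2 hU (by positivity) (by linarith)
  -- The multiplier equation M·L1 = P·M1, rewritten around the common leading value `U`. The right
  -- side is at most 1440 δ⁵, against 36 ε³ on the left, contradicting `h5`.
  have e : (-M + P) * U = M * (L1 - U) - P * (M1 - U) := by linear_combination -EL
  have a1 : |M * (L1 - U)| ≤ 7 * δ ^ 2 * (90 * δ ^ 3) := by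
    rw [abs_mul]
    refine mul_le_mul ?_ (k1.trans ?_) (abs_nonneg _) (by positivity)
    · rw [abs_of_nonpos (by linarith)]
      linarith
    · gcongr; norm_num
  have a2 : |P * (M1 - U)| ≤ 9 * δ ^ 2 * (90 * δ ^ 3) := by
    rw [abs_mul]
    exact mul_le_mul (by linarith) k2 (abs_nonneg _) (by positivity)
  have := (abs_le.1 a1).2
  have := (abs_le.1 a2).1
  have : 0 < ε ^ 3 := by positivity
  have e5 : 7 * δ ^ 2 * (90 * δ ^ 3) = 630 * δ ^ 5 := by ring
  have e6 : 9 * δ ^ 2 * (90 * δ ^ 3) = 810 * δ ^ 5 := by ring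
  have e7 : 6 * ε ^ 2 * (6 * ε) = 36 * ε ^ 3 := by ring
  linarith

end NearEquator

end Elastica

/-! ### Lower bound for the length of a non-contact interval. -/

namespace Elastica

namespace NearEquator

variable {ε δ a b : ℝ} {u p q : ℝ → ℝ}

theorem rotationVar_cut (h : NearEquator ε δ u p q) (hab : a < b) (hb : b ≤ a + 2 * Real.pi)
    (hc : IsPer2 (cut a b fun s => u s - ε) (cut a b p) (cut a b q)) :
    rotationVar u p (cut a b fun s => u s - ε) (cut a b p) =
      ∫ s in a..b, (-(u s * (u s - ε) + p s * p s) /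
        (√(1 - u s ^ 2 - p s ^ 2) * (1 - u s ^ 2)) +
        2 * u s * √(1 - u s ^ 2 - p s ^ 2) * (u s - ε) / (1 - u s ^ 2) ^ 2) := by
  refine integral_of_cut hab hb (fun s => ?_) (fun c d => (cont_rotationVar h.per.cont_u h.per.cont_p
    hc.cont_u hc.cont_p h.speed_pos).intervalIntegrable c d) (fun s hs => ?_) fun s hs => ?_
  · simp only [h.per.per_u s, h.per.per_p s, hc.per_u s, hc.per_p s]
  · simp only [cut_of_lt hb hs]
  · simp only [cut_of_ge hab hs]
    simp

theorem energyVar_cut (h : NearEquator ε δ u p q) (hab : a < b) (hb : b ≤ a + 2 * Real.pi)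
    (hc : IsPer2 (cut a b fun s => u s - ε) (cut a b p) (cut a b q)) :
    energyVar u p q (cut a b fun s => u s - ε) (cut a b p) (cut a b q) =
      ∫ s in a..b, ((q s + u s) * (q s + (u s - ε)) / (1 - u s ^ 2 - p s ^ 2) +
        (q s + u s) ^ 2 * (u s * (u s - ε) + p s * p s) / (1 - u s ^ 2 - p s ^ 2) ^ 2) := by
  refine integral_of_cut hab hb (fun s => ?_) (fun c d => int_energyVar h.per hc h.speed_pos c d)
    (fun s hs => ?_) fun s hs => ?_
  · simp only [h.per.per_u s, h.per.per_p s, h.per.per_q s, hc.per_u s, hc.per_p s, hc.per_q s]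
  · simp only [cut_of_lt hb hs]
  · simp only [cut_of_ge hab hs]
    simp

theorem integral_abs_sum_le (h : NearEquator ε δ u p q) (hab : a ≤ b) (hb : b ≤ a + 1) :
    ∫ s in a..b, |q s + u s| ≤ δ := by
  have hδ := h.delta_pos
  have j1 := h.per.int_sum_sq
  have j2 := h.per.int_sum
  have h1 : ∫ s in a..b, (q s + u s) ^ 2 ≤ δ ^ 2 := by
    have e := Function.Periodic.intervalIntegral_add_eq (f := fun s => (q s + u s) ^ 2)
      (T := 2 * Real.pi) (fun s => by simp only [h.per.per_q s, h.per.per_u s]) 0 a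
    rw [zero_add] at e
    calc ∫ s in a..b, (q s + u s) ^ 2 ≤ ∫ s in a..a + 2 * Real.pi, (q s + u s) ^ 2 := by
          refine intervalIntegral.integral_mono_interval le_rfl hab ?_
            (Filter.Eventually.of_forall fun s => sq_nonneg _) (j1 _ _)
          linarith [Real.pi_gt_three]
      _ ≤ ε * δ := by rw [← e]; exact h.energy_le
      _ ≤ δ ^ 2 := by rw [sq]; exact mul_le_mul_of_nonneg_right h.le_delta hδ.le
  have h2 := intervalIntegral.integral_mono_on hab ((j2 a b).abs.const_mul (2 * δ))
    ((j1 a b).add (intervalIntegrable_const (c := δ ^ 2))) fun s _ => by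
      rw [← sq_abs (q s + u s)]
      linarith [sq_nonneg (|q s + u s| - δ)]
  rw [intervalIntegral.integral_const_mul, intervalIntegral.integral_add (j1 _ _) (by simp)] at h2
  simp only [intervalIntegral.integral_const, smul_eq_mul] at h2
  have h3 : (b - a) * δ ^ 2 ≤ 1 * δ ^ 2 := by gcongr; linarith
  have h4 : 2 * δ * ∫ s in a..b, |q s + u s| ≤ 2 * δ * δ := by linarith
  exact le_of_mul_le_mul_left h4 (by positivity)

theorem sq_slope_le (h : NearEquator ε δ u p q) (pa : p a = 0) {x : ℝ} (hx : x ∈ Set.Icc a b) :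
    p x ^ 2 ≤ (b - a) * ∫ s in a..b, q s ^ 2 := by
  have e := h.per.prim.2 a x
  rw [pa, sub_zero] at e
  rw [← e]
  refine (sq_integral_le hx.1 (h.per.prim.1 a x) (h.per.sq a x)).trans ?_
  refine mul_le_mul (by linarith [hx.2]) ?_
    (intervalIntegral.integral_nonneg hx.1 fun _ _ => sq_nonneg _) (by linarith [hx.1, hx.2])
  exact intervalIntegral.integral_mono_interval le_rfl hx.1 hx.2
    (Filter.Eventually.of_forall fun s => sq_nonneg _) (h.per.sq a b)

/-- Poincaré from one end: since u − ε and p vanish at `a`, two integrations of `q` give the third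
power of the length. -/
theorem sq_sub_le (h : NearEquator ε δ u p q) (ua : u a = ε) (pa : p a = 0) {x : ℝ}
    (hx : x ∈ Set.Icc a b) :
    (u x - ε) ^ 2 ≤ (b - a) ^ 2 * ((b - a) * ∫ s in a..b, q s ^ 2) := by
  have cp := h.per.cont_p
  have e := h.per.isH1_u.1.2 a x
  rw [ua] at e
  rw [← e]
  refine (sq_integral_le hx.1 (cp.intervalIntegrable a x)
    ((cp.pow 2).intervalIntegrable (μ := volume) a x)).trans ?_
  have hb : 0 ≤ b - a := by linarith [hx.1, hx.2]
  have h1 := intervalIntegral.integral_mono_on hx.1 ((cp.pow 2).intervalIntegrable (μ := volume) a x)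
    (intervalIntegrable_const (c := (b - a) * ∫ s in a..b, q s ^ 2)) fun s hs =>
      h.sq_slope_le pa ⟨hs.1, hs.2.trans hx.2⟩
  simp only [intervalIntegral.integral_const, smul_eq_mul] at h1
  have h0 : 0 ≤ ∫ s in a..b, q s ^ 2 :=
    intervalIntegral.integral_nonneg (by linarith) fun _ _ => sq_nonneg _
  have hxa : 0 ≤ x - a := by linarith [hx.1]
  have hxb : x - a ≤ b - a := by linarith [hx.2]
  calc _ ≤ (x - a) * ((x - a) * ((b - a) * ∫ s in a..b, q s ^ 2)) := by gcongr; exact h1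
    _ ≤ (b - a) * ((b - a) * ((b - a) * ∫ s in a..b, q s ^ 2)) := by gcongr
    _ = _ := by ring

/-- Integration by parts moves the derivative from p to i = (1 − u² − p²)⁻¹, without boundary terms.
As i' = 2i²p(u + q), the integrand becomes −2i²p²(q + u), and p² is controlled by the length times ∫
q². The term linear in `q` is thus absorbed into the quadratic one. -/
theorem integral_curv_div (h : NearEquator ε δ u p q) (hab : a ≤ b) (hb : b ≤ a + 1)
    (pa : p a = 0) (pb : p b = 0) :
    |∫ s in a..b, (1 - u s ^ 2 - p s ^ 2)⁻¹ * q s| ≤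
      4 * ((b - a) * ∫ s in a..b, q s ^ 2) * δ := by
  have cu := h.per.cont_u
  have cp := h.per.cont_p
  have hprim := (((h.per.isH1_u.1.mul h.per.isH1_u.1).add (h.per.prim.mul h.per.prim)).const_mul
    (-1)).add (IsPrimitive.const 1)
  obtain ⟨c, hc, hm⟩ := exists_pos_le_of_periodic (m := fun s => 1 - u s ^ 2 - p s ^ 2)
    (by fun_prop) (fun s => by simp only [h.per.per_u s, h.per.per_p s]) h.speed_pos
  have hinv := hprim.inv hc fun x => by
    have := hm x
    linarith
  have e := hinv.integral_mul h.per.prim a b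
  rw [pa, pb, mul_zero, mul_zero, sub_zero, zero_sub] at e
  have e1 : ∀ s, -1 * (u s * u s + p s * p s) + 1 = 1 - u s ^ 2 - p s ^ 2 := fun s => by ring
  simp only [e1] at e
  rw [e, abs_neg]
  set S := (b - a) * ∫ s in a..b, q s ^ 2 with hS
  have hS0 : 0 ≤ S := mul_nonneg (by linarith)
    (intervalIntegral.integral_nonneg hab fun _ _ => sq_nonneg _)
  refine (intervalIntegral.abs_integral_le_integral_abs hab).trans ?_
  have j : IntervalIntegrable (fun s => 4 * S * |q s + u s|) volume a b :=
    (h.per.int_sum a b).abs.const_mul _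
  have h2 := intervalIntegral.integral_mono_on hab (by
    have := ((hinv.1 a b).mul_continuousOn cp.continuousOn).abs
    simp only [e1] at this
    exact this) j fun s hs => by
      obtain ⟨h1, h2, -⟩ := coefficient_bounds h.small (h.abs_u_le s) (h.p_le s)
      have hp2 := h.sq_slope_le pa hs
      rw [← hS] at hp2
      have hδ2 : δ ^ 2 ≤ 1 / 16 := by
        calc δ ^ 2 ≤ (1 / 4) ^ 2 := pow_le_pow_left₀ h.delta_pos.le h.small 2
          _ = 1 / 16 := by norm_num
      rw [← inv_pow]
      generalize (1 - u s ^ 2 - p s ^ 2)⁻¹ = i at *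
      have hi : i ^ 2 ≤ 2 := by
        calc i ^ 2 ≤ (5 / 4) ^ 2 := by gcongr; linarith
          _ ≤ 2 := by norm_num
      have e2 : -i ^ 2 * (-1 * (p s * u s + u s * p s + (q s * p s + p s * q s)) + 0) * p s =
          2 * i ^ 2 * p s ^ 2 * (q s + u s) := by ring
      rw [e2, abs_mul, abs_of_nonneg (by positivity)]
      calc _ ≤ 2 * 2 * S * |q s + u s| := by gcongr
        _ = 4 * S * |q s + u s| := by ring
  refine h2.trans ?_
  rw [intervalIntegral.integral_const_mul]
  exact mul_le_mul_of_nonneg_left (h.integral_abs_sum_le hab hb) (by positivity)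

theorem length_component_coeff {D P ε δ l : ℝ} (hε : 0 < ε) (hεδ : ε ≤ δ) (hδ : δ ≤ 1 / 4)
    (hl0 : 0 < l) (hl : l ≤ 1 / 21) (hlδ : 21 * l * δ ≤ ε) (hD : 6 * ε ^ 2 ≤ D)
    (hD' : D ≤ 7 * (ε * δ)) (hP : |P| ≤ 9 * (ε * δ)) :
    0 < D / 2 - D * ε * (4 * l * δ) - ((D + 2 * |P|) * l ^ 2 + 2 * |P|) * l * l := by
  have he : 0 < ε ^ 2 := by positivity
  have hδ0 : 0 < δ := hε.trans_le hεδ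
  have h1 : l * δ ≤ ε / 21 := by linarith
  have h2 : ε * (l * δ) ≤ 1 / 4 * (1 / 84) :=
    mul_le_mul (by linarith) (by linarith) (by positivity) (by norm_num)
  have h3 : D * (ε * (l * δ)) ≤ D * (1 / 4 * (1 / 84)) :=
    mul_le_mul_of_nonneg_left h2 (by linarith)
  have h4 : l * l * (ε * δ) ≤ ε ^ 2 / 441 := by
    calc l * l * (ε * δ) = l * (ε * (l * δ)) := by ring
      _ ≤ 1 / 21 * (ε * (ε / 21)) := by gcongr
      _ = ε ^ 2 / 441 := by ring
  have h5 : l ^ 2 ≤ 1 := pow_le_one₀ hl0.le (by linarith)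
  -- 43 = 7 + 4 · 9, from the upper bounds on `D` and `|P|`. After multiplication by l² and use of
  -- lδ ≤ ε/21 this is at most 43ε²/441, small beside D/2 ≥ 3ε².
  have h6 : (D + 2 * |P|) * l ^ 2 + 2 * |P| ≤ 43 * (ε * δ) := by
    have : (D + 2 * |P|) * l ^ 2 ≤ (D + 2 * |P|) * 1 :=
      mul_le_mul_of_nonneg_left h5 (by linarith [abs_nonneg P])
    linarith
  have h7 : ((D + 2 * |P|) * l ^ 2 + 2 * |P|) * (l * l) ≤ 43 * (ε * δ) * (l * l) :=
    mul_le_mul_of_nonneg_right h6 (by positivity)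
  have e1 : D * ε * (4 * l * δ) = 4 * (D * (ε * (l * δ))) := by ring
  rw [e1, mul_assoc _ l l]
  linarith

/-- Non-contact intervals of a minimizer are long. -/
theorem length_component (h : NearEquator ε δ u p q) (h4 : 1000000 * δ ^ 4 ≤ ε ^ 2)
    (hmin : IsHeightMinimizer ε u p q) (hab : a < b) (ua : u a = ε) (ub : u b = ε)
    (hne : ∃ x ∈ Set.Ioo a b, u x ≠ ε) : 1 / 21 < b - a ∨ ε < 21 * (b - a) * δ := by
  by_contra! hcon
  obtain ⟨hl, hlδ⟩ := hcon
  have hε := h.pos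
  have hδ := h.delta_pos
  have hb : b ≤ a + 2 * Real.pi := by linarith [Real.pi_gt_three]
  -- Contact points are global minima of the height, so the slope vanishes there.
  have slope : ∀ s, u s = ε → p s = 0 := fun s hs =>
    IsLocalMin.hasDerivAt_eq_zero (Filter.Eventually.of_forall fun y => by
      rw [hs]; exact h.le_u y) (h.per.deriv_u s)
  have pa := slope a ua
  have pb := slope b ub
  have hc : IsPer2 (cut a b fun s => u s - ε) (cut a b p) (cut a b q) :=
    h.per_sub.cut hab hb (by linarith) (by linarith) pa pb
  obtain ⟨m1, m2, m3, m4⟩ := h.multiplier_bounds h4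
  have he : 0 < ε ^ 2 := by positivity
  have EL := hmin.euler_lagrange (B := 1) h.per (fun s => (h.abs_u_le s).trans h.small)
    (fun s => (h.p_le s).trans h.small) h.le_u h.per_sub hc (fun s => by
      rw [one_mul, abs_of_nonneg (sub_nonneg.2 (h.le_u s))]) (fun s => by
      have := sub_nonneg.2 (h.le_u s)
      rw [one_mul]
      unfold Elastica.cut
      split_ifs
      · rw [abs_of_nonneg this]
      · rwa [abs_zero]) (by linarith)
  have iM := ((cont_rotationVar h.per.cont_u h.per.cont_p h.per_sub.cont_u h.per.cont_p
    h.speed_pos).intervalIntegrable (μ := volume) a b)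
  have iL := int_energyVar h.per h.per_sub h.speed_pos a b
  rw [h.rotationVar_cut hab hb hc, h.energyVar_cut hab hb hc] at EL
  generalize rotationVar u p (fun s => u s - ε) p = M at *
  generalize energyVar u p q (fun s => u s - ε) p q = P at *
  set S := (b - a) * ∫ s in a..b, q s ^ 2 with hS
  have hQ0 : 0 ≤ ∫ s in a..b, q s ^ 2 := intervalIntegral.integral_nonneg hab.le fun _ _ => sq_nonneg _
  have hDP : 14 * δ ^ 2 * |P| ≤ -M + P := by
    have := mul_le_mul_of_nonneg_left m4 (show 0 ≤ 14 * δ ^ 2 by positivity)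
    have e1 : δ ^ 2 * (ε * δ) ≤ δ ^ 4 := by
      have := mul_le_mul_of_nonneg_left h.le_delta (show 0 ≤ δ ^ 3 by positivity)
      linarith [show δ ^ 2 * (ε * δ) = δ ^ 3 * ε by ring, show δ ^ 3 * δ = δ ^ 4 by ring]
    linarith
  have iq : IntervalIntegrable (fun s => (1 - u s ^ 2 - p s ^ 2)⁻¹ * q s) volume a b := by
    have cu := h.per.cont_u
    have cp := h.per.cont_p
    exact (h.per.prim.1 a b).continuousOn_mul
      (Continuous.continuousOn (Continuous.inv₀ (by fun_prop) fun s => (h.speed_pos s).ne'))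
  have iq2 := h.per.sq a b
  have key := intervalIntegral.integral_mono_on hab.le
    (((iq2.const_mul (-M / 2)).add (iq.const_mul (-M * ε))).sub
      (intervalIntegrable_const (c := ((-M + 2 * |P|) * (b - a) ^ 2 + 2 * |P|) * S)))
    ((iL.const_mul (-M)).add (iM.const_mul P)) fun s hs => by
      refine le_trans ?_ (component_density (D := -M) h.small (h.abs_u_le s) (h.p_le s) hε.le
        (h.le_u s) (by linarith) hDP)
      have s1 := mul_le_mul_of_nonneg_left (h.sq_sub_le ua pa hs)
        (show 0 ≤ -M + 2 * |P| by linarith [abs_nonneg P])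
      have s2 := mul_le_mul_of_nonneg_left (h.sq_slope_le pa hs) (show 0 ≤ 2 * |P| by positivity)
      rw [← hS] at s1 s2
      linarith
  rw [intervalIntegral.integral_sub ((iq2.const_mul _).add (iq.const_mul _)) (by simp),
    intervalIntegral.integral_add (iq2.const_mul _) (iq.const_mul _),
    intervalIntegral.integral_add (iL.const_mul _) (iM.const_mul _)] at key
  simp only [intervalIntegral.integral_const_mul, intervalIntegral.integral_const,
    smul_eq_mul] at key
  have hdiv := (abs_le.1 (h.integral_curv_div hab.le (by linarith) pa pb)).1
  rw [← hS] at hdiv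
  have hdiv' := mul_le_mul_of_nonneg_left hdiv (show 0 ≤ -M * ε from mul_nonneg (by linarith) hε.le)
  have coeff := length_component_coeff hε h.le_delta h.small (sub_pos.2 hab) hl hlδ m1 m3 m4
  generalize (∫ s in a..b, (1 - u s ^ 2 - p s ^ 2)⁻¹ * q s) = X at *
  -- By the Euler–Lagrange equation the integral bounding the density from above is zero. The
  -- remaining lower bound is a multiple of ∫ q², with a positive coefficient on a short interval.
  have hle : (-M / 2 - -M * ε * (4 * (b - a) * δ) -
      ((-M + 2 * |P|) * (b - a) ^ 2 + 2 * |P|) * (b - a) * (b - a)) * (∫ s in a..b, q s ^ 2) ≤ 0 := by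
    simp only [hS] at key hdiv'
    linarith
  have hQ : ∫ s in a..b, q s ^ 2 = 0 := le_antisymm (nonpos_of_mul_nonpos_right hle coeff) hQ0
  obtain ⟨x, hx, hxu⟩ := hne
  have := h.sq_sub_le ua pa ⟨hx.1.le, hx.2.le⟩
  rw [hQ, mul_zero, mul_zero] at this
  have h0 := pow_eq_zero_iff (two_ne_zero) |>.1 (le_antisymm this (sq_nonneg _))
  exact hxu (by linarith)

end NearEquator

end Elastica

/-! ### The low-energy competitor and closeness of minimizers to the equator. -/

namespace Elastica

section

variable (ε b : ℝ)

theorem isPer2_wave : IsPer2 (fun s => ε * (10 + b * Real.cos (2 * s)))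
    (fun s => -(2 * ε * b * Real.sin (2 * s))) (fun s => -(4 * ε * b * Real.cos (2 * s))) := by
  have hc : ∀ s : ℝ, Real.cos (2 * (s + 2 * Real.pi)) = Real.cos (2 * s) := fun s => by
    have := Real.cos_add_nat_mul_two_pi (2 * s) 2
    rw [← this]
    congr 1
    push_cast
    ring
  have hs : ∀ s : ℝ, Real.sin (2 * (s + 2 * Real.pi)) = Real.sin (2 * s) := fun s => by
    have := Real.sin_add_nat_mul_two_pi (2 * s) 2
    rw [← this]
    congr 1
    push_cast
    ring
  refine ⟨fun s => by simp only [hc], fun s => by simp only [hs], fun s => by simp only [hc],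
    fun s => ?_, .of_hasDerivAt (fun s => ?_) (by fun_prop),
    fun c d => Continuous.intervalIntegrable (by fun_prop) _ _⟩
  · exact ((((hasDerivAt_cos_mul 2 s).const_mul b).const_add 10).const_mul ε).congr_deriv (by ring)
  · exact ((hasDerivAt_sin_mul 2 s).const_mul (2 * ε * b)).neg.congr_deriv (by ring)

variable {ε b}

theorem wave_bounds (hε : 0 < ε) (h0 : 0 ≤ b) (h9 : b ≤ 9) (s : ℝ) :
    ε ≤ ε * (10 + b * Real.cos (2 * s)) ∧ |ε * (10 + b * Real.cos (2 * s))| ≤ 19 * ε ∧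
    |-(2 * ε * b * Real.sin (2 * s))| ≤ 19 * ε ∧
    (-(4 * ε * b * Real.cos (2 * s)) + ε * (10 + b * Real.cos (2 * s))) ^ 2 ≤ 1369 * ε ^ 2 := by
  have hc : |b * Real.cos (2 * s)| ≤ 9 := by
    rw [abs_mul, abs_of_nonneg h0]
    calc b * |Real.cos (2 * s)| ≤ 9 * 1 := by gcongr; exact Real.abs_cos_le_one _
      _ = 9 := by norm_num
  have hs : |b * Real.sin (2 * s)| ≤ 9 := by
    rw [abs_mul, abs_of_nonneg h0]
    calc b * |Real.sin (2 * s)| ≤ 9 * 1 := by gcongr; exact Real.abs_sin_le_one _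
      _ = 9 := by norm_num
  have e1 : -(2 * ε * b * Real.sin (2 * s)) = -(2 * ε * (b * Real.sin (2 * s))) := by ring
  have e2 : -(4 * ε * b * Real.cos (2 * s)) + ε * (10 + b * Real.cos (2 * s)) =
      ε * (10 - 3 * (b * Real.cos (2 * s))) := by ring
  rw [e1, e2]
  rw [abs_le] at hc hs
  refine ⟨le_mul_of_one_le_right hε.le (by linarith), ?_, ?_, ?_⟩
  · rw [abs_mul, abs_of_pos hε, mul_comm]
    refine mul_le_mul_of_nonneg_right (abs_le.2 ⟨by linarith, by linarith⟩) hε.le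
  · rw [abs_neg, abs_mul, abs_of_pos (by positivity)]
    have : |b * Real.sin (2 * s)| ≤ 9 := abs_le.2 hs
    calc _ ≤ 2 * ε * 9 := by gcongr
      _ ≤ 19 * ε := by linarith
  · rw [mul_pow, mul_comm]
    refine mul_le_mul_of_nonneg_right ?_ (sq_nonneg _)
    calc _ ≤ (37 : ℝ) ^ 2 := sq_le_sq' (by linarith) (by linarith)
      _ = 1369 := by norm_num

/-- The factor 200 − 3b² is 200 at b = 0 and −43 at b = 9, so the rotation crosses 2π between these
values. Frequency 2 is the lowest that makes ∫ (u² − u'²) decrease with the amplitude. -/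
theorem integral_wave : ∫ s in (0 : ℝ)..2 * Real.pi, ((ε * (10 + b * Real.cos (2 * s))) ^ 2 -
    (-(2 * ε * b * Real.sin (2 * s))) ^ 2) = Real.pi * ε ^ 2 * (200 - 3 * b ^ 2) := by
  have e : (fun s => (ε * (10 + b * Real.cos (2 * s))) ^ 2 - (-(2 * ε * b * Real.sin (2 * s))) ^ 2) =
      fun s => ε ^ 2 * (100 - 3 / 2 * b ^ 2) + (20 * ε ^ 2 * b * Real.cos ((2 : ℤ) * s) +
        5 / 2 * ε ^ 2 * b ^ 2 * Real.cos ((4 : ℤ) * s)) := by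
    funext s
    have h4 : Real.cos ((4 : ℤ) * s) = 2 * Real.cos (2 * s) ^ 2 - 1 := by
      rw [← Real.cos_two_mul]
      congr 1
      push_cast
      ring
    rw [h4, Int.cast_ofNat, neg_sq, mul_pow _ (Real.sin (2 * s)), Real.sin_sq]
    ring
  rw [e, intervalIntegral.integral_add (by simp) (Continuous.intervalIntegrable (by fun_prop) _ _),
    intervalIntegral.integral_add (Continuous.intervalIntegrable (by fun_prop) _ _)
    (Continuous.intervalIntegrable (by fun_prop) _ _)]
  simp only [intervalIntegral.integral_const_mul]
  rw [integral_cos_int (by norm_num), integral_cos_int (by norm_num)]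
  simp only [intervalIntegral.integral_const, smul_eq_mul]
  ring

theorem exists_rotation_wave (hε : 0 < ε) (h : ε ≤ 1 / 1000) :
    ∃ b, 0 ≤ b ∧ b ≤ 9 ∧ rotation (fun s => ε * (10 + b * Real.cos (2 * s)))
      (fun s => -(2 * ε * b * Real.sin (2 * s))) = 2 * Real.pi := by
  -- The amplitude is written as 9 sin² t so that it stays in [0, 9] for every real t; the curve
  -- then remains above ε, as 10 − 9 = 1.
  have hb : ∀ t : ℝ, 0 ≤ 9 * Real.sin t ^ 2 ∧ 9 * Real.sin t ^ 2 ≤ 9 := fun t =>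
    ⟨by positivity, by linarith [Real.sin_sq_le_one t]⟩
  have hm : ∀ t s : ℝ, 0 < 1 - (ε * (10 + 9 * Real.sin t ^ 2 * Real.cos (2 * s))) ^ 2 -
      (-(2 * ε * (9 * Real.sin t ^ 2) * Real.sin (2 * s))) ^ 2 := fun t => speed_pos
    (fun s => (wave_bounds hε (hb t).1 (hb t).2 s).2.1.trans (by linarith))
    (fun s => (wave_bounds hε (hb t).1 (hb t).2 s).2.2.1.trans (by linarith))
  obtain ⟨R, hR⟩ : ∃ R : ℝ → ℝ, ∀ t, R t = rotation
      (fun s => ε * (10 + 9 * Real.sin t ^ 2 * Real.cos (2 * s)))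
      (fun s => -(2 * ε * (9 * Real.sin t ^ 2) * Real.sin (2 * s))) := ⟨_, fun _ => rfl⟩
  have hcont : Continuous R := by
    rw [funext hR]
    refine intervalIntegral.continuous_parametric_intervalIntegral_of_continuous' ?_ _ _
    refine Continuous.div (by fun_prop) (by fun_prop) fun x => ?_
    have := hm x.1 x.2
    have := sq_nonneg (-(2 * ε * (9 * Real.sin x.1 ^ 2) * Real.sin (2 * x.2)))
    linarith
  have key : ∀ t : ℝ, |R t - 2 * Real.pi -
      Real.pi * ε ^ 2 * (200 - 3 * (9 * Real.sin t ^ 2) ^ 2) / 2| ≤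
      8 * Real.pi * (19 * ε) ^ 4 := fun t => by
    have hw := wave_bounds hε (hb t).1 (hb t).2
    have := rotation_approx (isPer2_wave ε (9 * Real.sin t ^ 2)).cont_u
      (isPer2_wave ε (9 * Real.sin t ^ 2)).cont_p (δ := 19 * ε) (by linarith) (fun s => (hw s).2.1)
      fun s => (hw s).2.2.1
    rwa [integral_wave, ← hR] at this
  -- The error must stay below 43/2, half the negative value at b = 9, in units of πε²; 20 suffices.
  have herr : 8 * Real.pi * (19 * ε) ^ 4 ≤ Real.pi * ε ^ 2 * 20 := by
    have h2 : ε ^ 2 ≤ (1 / 1000) ^ 2 := by gcongr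
    have := mul_le_mul_of_nonneg_left h2 (show 0 ≤ Real.pi * ε ^ 2 * (8 * 19 ^ 4) by positivity)
    have h3 : 0 ≤ Real.pi * ε ^ 2 := by positivity
    linarith [show 8 * Real.pi * (19 * ε) ^ 4 = Real.pi * ε ^ 2 * (8 * 19 ^ 4) * ε ^ 2 by ring]
  have h3 : 0 < Real.pi * ε ^ 2 := by positivity
  suffices h : ∃ t : ℝ, rotation (fun s => ε * (10 + 9 * Real.sin t ^ 2 * Real.cos (2 * s)))
      (fun s => -(2 * ε * (9 * Real.sin t ^ 2) * Real.sin (2 * s))) = 2 * Real.pi by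
    obtain ⟨t, ht⟩ := h
    exact ⟨_, (hb t).1, (hb t).2, ht⟩
  simp only [← hR]
  refine mem_range_of_exists_le_of_exists_ge hcont ⟨Real.pi / 2, ?_⟩ ⟨0, ?_⟩
  · have := (abs_le.1 (key (Real.pi / 2))).2
    rw [Real.sin_pi_div_two] at this
    linarith
  · have := (abs_le.1 (key 0)).1
    rw [Real.sin_zero] at this
    linarith

/-- Curves over the obstacle with energy of order `ε ^ 2`. -/
theorem exists_energy_le (hε : 0 < ε) (h : ε ≤ 1 / 1000) : ∃ γ ∈ Y ε, energy γ ≤ 18000 * ε ^ 2 := by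
  obtain ⟨b, h0, h9, hr⟩ := exists_rotation_wave hε h
  have hw := wave_bounds hε h0 h9
  have hu : ∀ s, |ε * (10 + b * Real.cos (2 * s))| ≤ 1 / 4 := fun s =>
    (hw s).2.1.trans (by linarith)
  have hp : ∀ s, |-(2 * ε * b * Real.sin (2 * s))| ≤ 1 / 4 := fun s =>
    (hw s).2.2.1.trans (by linarith)
  have hm := speed_pos hu hp
  obtain ⟨γ, hγ, e⟩ := exists_curve (isPer2_wave ε b) (fun s => (hw s).1) hm hr
  refine ⟨γ, hγ, e.le.trans ?_⟩
  have key := intervalIntegral.integral_mono_on Real.two_pi_pos.le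
    (int_heightEnergy (isPer2_wave ε b) hm 0 (2 * Real.pi))
    (intervalIntegrable_const (c := 1369 * ε ^ 2 * (5 / 4))) fun s _ => by
      obtain ⟨-, h2, -⟩ := coefficient_bounds le_rfl (hu s) (hp s)
      rw [div_eq_mul_inv]
      refine mul_le_mul (hw s).2.2.2 (h2.trans (by norm_num)) (inv_nonneg.2 (hm s).le)
        (by positivity)
  simp only [intervalIntegral.integral_const, smul_eq_mul, sub_zero] at key
  refine key.trans ?_
  have := mul_le_mul_of_nonneg_right Real.pi_lt_d2.le (sq_nonneg ε)
  linarith [sq_nonneg ε]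

end

/-- Minimizers are graph-like over the equator. -/
theorem IsMinimizer.nearEquator {ε : ℝ} {γ : Circ → E3} (hγ : IsMinimizer ε γ) (hε : 0 < ε)
    (h : ε ≤ 1 / 1000000) : ∃ p q : ℝ → ℝ,
      NearEquator ε (18000 * ε) (fun s : ℝ => γ (s : Circ) 2) p q ∧
      IsHeightMinimizer ε (fun s : ℝ => γ (s : Circ) 2) p q := by
  obtain ⟨hY, hmin⟩ := hγ
  obtain ⟨P, Q, hP, n1, n2, n3, hE, hκ⟩ := exists_lift_of_mem_Y hY
  have hle : ∀ s : ℝ, ε ≤ γ (s : Circ) 2 := fun s => hY.2.2.2.2 s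
  have hper := hP 2
  obtain ⟨γ₀, hγ₀, e₀⟩ := exists_energy_le hε (by linarith)
  have hE₀ : energy γ ≤ 18000 * ε ^ 2 := (hmin hγ₀).trans e₀
  set u : ℝ → ℝ := fun s => γ (s : Circ) 2 with hu
  have cu := hper.cont_u
  have iκ : ∀ c d, IntervalIntegrable (fun s => Q 0 s ^ 2 + Q 1 s ^ 2 + Q 2 s ^ 2 - 1) volume c d :=
    fun c d => ((((hP 0).sq c d).add ((hP 1).sq c d)).add ((hP 2).sq c d)).sub
      intervalIntegrable_const
  have j1 := hper.int_sum_sq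
  have j2 := hper.int_sum
  -- Almost everywhere (u'' + u)² = κ²(1 − u² − u'²) ≤ κ²; no graph assumption is needed yet.
  have hA : ∫ s in (0 : ℝ)..2 * Real.pi, (Q 2 s + u s) ^ 2 ≤ 18000 * ε ^ 2 := by
    refine le_trans ?_ hE₀
    rw [hE]
    refine intervalIntegral.integral_mono_ae Real.two_pi_pos.le (j1 _ _) (iκ _ _) ?_
    filter_upwards [hκ] with s hs
    rw [← hs.2]
    exact mul_le_of_le_one_right hs.1 (by linarith [sq_nonneg (γ (s : Circ) 2), sq_nonneg (P 2 s)])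
  have habs : ∫ s in (0 : ℝ)..2 * Real.pi, |Q 2 s + u s| ≤ 340 * ε := by
    refine abs_le_of_sq_le_sq' ?_ (by positivity) |>.2
    refine (sq_integral_le Real.two_pi_pos.le (j2 _ _).abs (by simpa using j1 0 (2 * Real.pi))).trans ?_
    simp only [sq_abs, sub_zero]
    calc _ ≤ 2 * Real.pi * (18000 * ε ^ 2) := by gcongr
      _ ≤ (340 * ε) ^ 2 := by
        have := mul_le_mul_of_nonneg_right Real.pi_lt_d2.le (sq_nonneg ε)
        linarith [sq_nonneg ε, show (340 * ε) ^ 2 = 115600 * ε ^ 2 by ring]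
  have hU : ∫ s in (0 : ℝ)..2 * Real.pi, u s ≤ 340 * ε := by
    rw [← NearEquator.integral_sum hper]
    exact (intervalIntegral.integral_mono_on Real.two_pi_pos.le (j2 _ _) (j2 _ _).abs
      fun s _ => le_abs_self _).trans habs
  have hq : ∫ s in (0 : ℝ)..2 * Real.pi, |Q 2 s| ≤ 680 * ε := by
    have := intervalIntegral.integral_mono_on Real.two_pi_pos.le (hper.prim.1 0 (2 * Real.pi)).abs
      ((j2 0 (2 * Real.pi)).abs.add (cu.intervalIntegrable 0 (2 * Real.pi))) fun s _ => by
        have h1 : |u s| = u s := abs_of_pos (hε.trans_le (hle s))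
        have := abs_sub (Q 2 s + u s) (u s)
        rwa [add_sub_cancel_right, h1] at this
    rw [intervalIntegral.integral_add (j2 _ _).abs (cu.intervalIntegrable _ _)] at this
    linarith
  -- The oscillation of a periodic function is at most its total variation over one period.
  have hosc : ∀ {f g : ℝ → ℝ} {K : ℝ}, IsPrimitive f g → Function.Periodic f (2 * Real.pi) →
      (∫ s in (0 : ℝ)..2 * Real.pi, |g s|) ≤ K → ∀ x y, |f x - f y| ≤ K := by
    intro f g K hfg hf hK x y
    obtain ⟨x', hx', ex⟩ := hf.exists_mem_Ico₀ Real.two_pi_pos x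
    obtain ⟨y', hy', ey⟩ := hf.exists_mem_Ico₀ Real.two_pi_pos y
    rw [ex, ey, ← hfg.2]
    refine (intervalIntegral.norm_integral_le_integral_norm_uIoc (f := g)).trans (le_trans ?_ hK)
    rw [intervalIntegral.integral_of_le Real.two_pi_pos.le]
    refine setIntegral_mono_set ?_ (Filter.Eventually.of_forall fun s => abs_nonneg _) ?_
    · exact ((intervalIntegrable_iff_integrableOn_Ioc_of_le Real.two_pi_pos.le).1 (hfg.1 _ _)).abs
    · refine Filter.Eventually.of_forall fun s hs => ?_
      exact ⟨(le_min hy'.1 hx'.1).trans_lt hs.1, hs.2.trans (max_le hy'.2.le hx'.2.le)⟩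
  have hp : ∀ s, |P 2 s| ≤ 680 * ε := by
    obtain ⟨x, -, hx⟩ := isCompact_Icc.exists_isMinOn (s := Set.Icc (0 : ℝ) (0 + 2 * Real.pi))
      ⟨0, by simp [Real.pi_pos.le]⟩ cu.continuousOn
    have hx0 : P 2 x = 0 := IsLocalMin.hasDerivAt_eq_zero (Filter.Eventually.of_forall fun s => by
      obtain ⟨y, hy, e⟩ := hper.per_u.exists_mem_Ico Real.two_pi_pos s 0
      rw [e]
      exact hx ⟨hy.1, hy.2.le⟩) (hper.deriv_u x)
    intro s
    have := hosc hper.prim hper.per_p hq s x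
    rwa [hx0, sub_zero] at this
  -- The oscillation is at most 2π · 680ε; comparison with ∫ u ≤ 340ε and 2π ≥ 1 bounds the maximum.
  have hu18 : ∀ s, u s ≤ 18000 * ε := by
    have hI : ∫ s in (0 : ℝ)..2 * Real.pi, |P 2 s| ≤ 2 * Real.pi * (680 * ε) := by
      have := intervalIntegral.integral_mono_on Real.two_pi_pos.le
        (hper.cont_p.abs.intervalIntegrable 0 (2 * Real.pi))
        (intervalIntegrable_const (μ := volume) (c := 680 * ε)) fun s _ => hp s
      simpa only [intervalIntegral.integral_const, smul_eq_mul, sub_zero] using this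
    have hd := hosc hper.isH1_u.1 hper.per_u hI
    intro s
    have h1 := intervalIntegral.integral_mono_on Real.two_pi_pos.le
      (intervalIntegrable_const (μ := volume) (c := u s - 2 * Real.pi * (680 * ε)))
      (cu.intervalIntegrable 0 (2 * Real.pi)) fun x _ => by linarith [(abs_le.1 (hd s x)).2]
    simp only [intervalIntegral.integral_const, smul_eq_mul, sub_zero] at h1
    have h2 := mul_le_mul_of_nonneg_right Real.pi_lt_d2.le hε.le
    by_contra! hcon
    have h3 : 1 * (u s - 2 * Real.pi * (680 * ε)) ≤ 2 * Real.pi * (u s - 2 * Real.pi * (680 * ε)) :=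
      mul_le_mul_of_nonneg_right (by linarith [Real.pi_gt_three]) (by linarith)
    linarith
  have hp18 : ∀ s, |P 2 s| ≤ 18000 * ε := fun s => (hp s).trans (by linarith)
  have ha18 : ∀ s, |u s| ≤ 18000 * ε := fun s => by
    rw [abs_of_pos (hε.trans_le (hle s))]; exact hu18 s
  have small : 18000 * ε ≤ 1 / 4 := by linarith
  have hm := speed_pos (fun s => (ha18 s).trans small) (fun s => (hp18 s).trans small)
  -- The rotation is an integer multiple of 2π and is close enough to 2π for that integer to be 1.
  have hrot : rotation u (P 2) = 2 * Real.pi := by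
    obtain ⟨k, hk⟩ := rotation_eq_of_frame (hP 0).deriv_u (hP 1).deriv_u (hP 0).cont_p (hP 1).cont_p
      (hP 0).per_u (hP 1).per_u n1 n2 n3 hm
    have h1 := rotation_approx cu hper.cont_p small ha18 hp18
    have h2 : |∫ s in (0 : ℝ)..2 * Real.pi, (u s ^ 2 - P 2 s ^ 2)| ≤ 2 * Real.pi * (1 / 16) := by
      have := intervalIntegral.norm_integral_le_of_norm_le_const (a := (0 : ℝ)) (b := 2 * Real.pi)
        (f := fun s => u s ^ 2 - P 2 s ^ 2) (C := 1 / 16) fun s _ => by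
          have a1 : u s ^ 2 ≤ (1 / 4) ^ 2 := sq_le_sq' (by linarith [abs_le.1 (ha18 s)])
            ((abs_le.1 (ha18 s)).2.trans small)
          have a2 : P 2 s ^ 2 ≤ (1 / 4) ^ 2 := sq_le_sq' (by linarith [abs_le.1 (hp18 s)])
            ((abs_le.1 (hp18 s)).2.trans small)
          rw [Real.norm_eq_abs, abs_le]
          constructor <;> linarith [sq_nonneg (u s), sq_nonneg (P 2 s)]
      rw [sub_zero, abs_of_pos Real.two_pi_pos] at this
      exact this.trans (le_of_eq (by ring))
    have h3 : (18000 * ε) ^ 4 ≤ (1 / 4) ^ 4 := by gcongr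
    have h4 := mul_le_mul_of_nonneg_left h3 (show 0 ≤ 8 * Real.pi by positivity)
    rw [hk, abs_le] at h1
    rw [abs_le] at h2
    have hpi := Real.pi_pos
    have k1 : (k : ℝ) < 2 := by
      refine lt_of_mul_lt_mul_left (a := Real.pi) ?_ hpi.le
      linarith [h1.2, h2.2]
    have k2 : (0 : ℝ) < k := by
      refine lt_of_mul_lt_mul_left (a := Real.pi) ?_ hpi.le
      linarith [h1.1, h2.1]
    have : k = 1 := by
      have : k < 2 := by exact_mod_cast k1
      have : 0 < k := by exact_mod_cast k2
      omega
    rw [hk, this]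
    simp
  refine ⟨P 2, Q 2, ⟨hper, hε, hle, hu18, hp18, small, hA.trans (le_of_eq (by ring)), hrot⟩, ?_⟩
  intro v v' v'' hv hεv hmv hr
  obtain ⟨γ₁, hγ₁, e₁⟩ := exists_curve hv hεv hmv (hr.trans hrot)
  rw [← energy_eq_heightEnergy hY (fun _ => rfl) hper hm, ← e₁]
  exact hmin hγ₁

end Elastica

/-! ### Components of the non-contact set as arcs of the circle. -/

namespace Elastica

/-- The component of a non-contact point is the arc between its neighbouring contact points. -/
theorem exists_arc_of_contact {ε : ℝ} {γ : Circ → E3} (hc : Continuous γ) (hle : ∀ x, ε ≤ γ x 2)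
    {s₀ : ℝ} (h₀ : γ (s₀ : Circ) 2 = ε) {x : Circ} (hx : x ∈ nonContactSet ε γ) :
    ∃ a b : ℝ, a < b ∧ b ≤ a + 2 * Real.pi ∧ γ (a : Circ) 2 = ε ∧ γ (b : Circ) 2 = ε ∧
      (∃ t ∈ Set.Ioo a b, γ (t : Circ) 2 ≠ ε) ∧
      connectedComponentIn (nonContactSet ε γ) x = (fun s : ℝ => (s : Circ)) '' Set.Ioo a b := by
  have cu : Continuous fun s : ℝ => γ (s : Circ) 2 :=
    (EuclideanSpace.proj (𝕜 := ℝ) (2 : Fin 3)).continuous.comp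
      (hc.comp (AddCircle.continuous_mk' (2 * Real.pi)))
  obtain ⟨t, ht, rfl⟩ : ∃ t ∈ Set.Ico s₀ (s₀ + 2 * Real.pi), (t : Circ) = x := by
    have := AddCircle.coe_image_Ico_eq (2 * Real.pi) s₀
    exact (this.symm ▸ Set.mem_univ x : x ∈ _ '' _)
  have htε : ε < γ (t : Circ) 2 := hx
  have hcl : IsClosed {s : ℝ | γ (s : Circ) 2 = ε} := isClosed_eq cu continuous_const
  have h₁ : γ ((s₀ + 2 * Real.pi : ℝ) : Circ) 2 = ε := by
    rw [← h₀]
    exact congrArg (fun y : E3 => y 2) (periodic_coe γ s₀)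
  -- The last contact before `t` and the first one after it, searched within one period starting at
  -- the known contact `s₀`. If it is the only contact, the arc has full length 2π.
  obtain ⟨a, ⟨⟨ha1, ha2⟩, ha3⟩, hamax⟩ := (isCompact_Icc.inter_right hcl).exists_isGreatest
    (⟨s₀, ⟨le_rfl, ht.1⟩, h₀⟩ : (Set.Icc s₀ t ∩ {s : ℝ | γ (s : Circ) 2 = ε}).Nonempty)
  obtain ⟨b, ⟨⟨hb1, hb2⟩, hb3⟩, hbmin⟩ := (isCompact_Icc.inter_right hcl).exists_isLeast
    (⟨s₀ + 2 * Real.pi, ⟨ht.2.le, le_rfl⟩, h₁⟩ :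
      (Set.Icc t (s₀ + 2 * Real.pi) ∩ {s : ℝ | γ (s : Circ) 2 = ε}).Nonempty)
  change γ (a : Circ) 2 = ε at ha3
  change γ (b : Circ) 2 = ε at hb3
  have hat : a < t := lt_of_le_of_ne ha2 fun e => by rw [e] at ha3; linarith
  have htb : t < b := lt_of_le_of_ne hb1 fun e => by rw [← e] at hb3; linarith
  have hin : ∀ s ∈ Set.Ioo a b, ε < γ (s : Circ) 2 := fun s hs => by
    refine lt_of_le_of_ne (hle _) fun e => ?_
    rcases le_total s t with hst | hst
    · exact absurd (hamax ⟨⟨ha1.trans hs.1.le, hst⟩, e.symm⟩) (not_le.2 hs.1)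
    · exact absurd (hbmin ⟨⟨hst, hs.2.le.trans hb2⟩, e.symm⟩) (not_le.2 hs.2)
  refine ⟨a, b, hat.trans htb, by linarith, ha3, hb3, ⟨t, ⟨hat, htb⟩, htε.ne'⟩, ?_⟩
  have cmk : Continuous fun s : ℝ => (s : Circ) := AddCircle.continuous_mk' (2 * Real.pi)
  have hJx : (t : Circ) ∈ (fun s : ℝ => (s : Circ)) '' Set.Ioo a b := ⟨t, ⟨hat, htb⟩, rfl⟩
  refine subset_antisymm ?_ ?_
  -- The open arc and the complement of the closed arc are disjoint open sets covering the
  -- non-contact set, because the endpoints are contact points; a connected subset meeting the open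
  -- arc stays in it.
  · have hJ : IsOpen ((fun s : ℝ => (s : Circ)) '' Set.Ioo a b) :=
      QuotientAddGroup.isOpenMap_coe _ isOpen_Ioo
    have hK : IsOpen ((fun s : ℝ => (s : Circ)) '' Set.Icc a b)ᶜ :=
      (isCompact_Icc.image cmk).isClosed.isOpen_compl
    refine isPreconnected_connectedComponentIn.subset_left_of_subset_union hJ hK ?_ ?_
      ⟨_, mem_connectedComponentIn hx, hJx⟩
    · exact Set.disjoint_compl_right_iff_subset.2 (Set.image_mono Set.Ioo_subset_Icc_self)
    · refine (connectedComponentIn_subset _ _).trans fun y hy => ?_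
      by_cases hyK : y ∈ (fun s : ℝ => (s : Circ)) '' Set.Icc a b
      · obtain ⟨s, hs, rfl⟩ := hyK
        have hy' : ε < γ (s : Circ) 2 := hy
        refine Or.inl ⟨s, ⟨lt_of_le_of_ne hs.1 fun e => ?_, lt_of_le_of_ne hs.2 fun e => ?_⟩, rfl⟩
        · rw [← e] at hy'; linarith
        · rw [e] at hy'; linarith
      · exact Or.inr hyK
  · refine (isPreconnected_Ioo.image _ cmk.continuousOn).subset_connectedComponentIn hJx ?_
    rintro _ ⟨s, hs, rfl⟩
    exact hin s hs

theorem IsOpenArc.volume_ge {I : Set Circ} {l : ℝ} (h : IsOpenArc I l) :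
    MeasurableSet I ∧ ENNReal.ofReal l ≤ volume I := by
  obtain ⟨-, hl, a, rfl⟩ := h
  have hJ : IsOpen ((fun s : ℝ => (s : Circ)) '' Set.Ioo a (a + l)) :=
    QuotientAddGroup.isOpenMap_coe _ isOpen_Ioo
  refine ⟨hJ.measurableSet, ?_⟩
  rw [← (AddCircle.measurePreserving_mk (2 * Real.pi) a).measure_preimage
    hJ.measurableSet.nullMeasurableSet]
  rw [Measure.restrict_apply
    ((AddCircle.measurePreserving_mk (2 * Real.pi) a).measurable hJ.measurableSet)]
  have hsub : Set.Ioo a (a + l) ⊆ (fun s : ℝ => (s : Circ)) ⁻¹'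
      ((fun s : ℝ => (s : Circ)) '' Set.Ioo a (a + l)) ∩ Set.Ioc a (a + 2 * Real.pi) :=
    fun s hs => ⟨⟨s, hs, rfl⟩, hs.1, hs.2.le.trans (by linarith)⟩
  have hv : ENNReal.ofReal l = volume (Set.Ioo a (a + l)) := by
    rw [Real.volume_Ioo, add_sub_cancel_left]
  exact hv.le.trans (measure_mono hsub)

/-- The components are disjoint, measurable and of measure at least `c`, in a space of finite
measure. -/
theorem components_finite {U : Set Circ} {c : ℝ} (hc : 0 < c)
    (h : ∀ I ∈ components U, ∃ l, IsOpenArc I l ∧ c ≤ l) : (components U).Finite := by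
  have hdis : Pairwise (Function.onFun Disjoint fun I : components U => (I : Set Circ)) := by
    rintro ⟨_, x, hx, rfl⟩ ⟨_, y, hy, rfl⟩ hne
    by_contra hnd
    obtain ⟨z, hz1, hz2⟩ := Set.not_disjoint_iff.1 hnd
    exact hne (Subtype.ext ((connectedComponentIn_eq hz1).trans (connectedComponentIn_eq hz2).symm))
  have key := Measure.finite_const_le_meas_of_disjoint_iUnion (volume : Measure Circ)
    (ENNReal.ofReal_pos.2 hc) (As := fun I : components U => (I : Set Circ)) (fun I => by
      obtain ⟨l, hl, -⟩ := h I I.2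
      exact hl.volume_ge.1) hdis (measure_ne_top _ _)
  have e : {I : components U | ENNReal.ofReal c ≤ volume (I : Set Circ)} = Set.univ := by
    refine Set.eq_univ_of_forall fun I => ?_
    obtain ⟨l, hl, hcl⟩ := h I I.2
    exact (ENNReal.ofReal_le_ofReal hcl).trans hl.volume_ge.2
  rw [e] at key
  exact Set.finite_coe_iff.1 (Set.finite_univ_iff.1 key)

end Elastica

/-! ### Choice of the universal constants. -/

theorem mainTheorem6 :
    ∃ c₀ : ℝ, 0 < c₀ ∧ ∃ ε₀ : ℝ, 0 < ε₀ ∧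
      ∀ ε : ℝ, 0 < ε → ε < ε₀ →
        ∀ γ : Elastica.Circ → Elastica.E3, Elastica.IsMinimizer ε γ →
          (∀ I ∈ Elastica.components (Elastica.nonContactSet ε γ),
            ∃ l : ℝ, Elastica.IsOpenArc I l ∧ c₀ ≤ l) ∧
          (Elastica.components (Elastica.nonContactSet ε γ)).Finite := by
  -- 378000 = 21 · 18000 combines the length threshold with δ/ε, and 10⁻¹⁵ makes 10⁶δ⁴ ≤ ε² and
  -- 10⁶δ⁵ ≤ ε³ for δ = 18000ε.
  refine ⟨1 / 378000, by norm_num, 1 / 10 ^ 15, by norm_num, fun ε hε hε₀ γ hγ => ?_⟩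
  obtain ⟨p, q, hN, hmin⟩ := hγ.nearEquator hε (hε₀.le.trans (by norm_num))
  have h2 : ε ^ 2 ≤ (1 / 10 ^ 15) ^ 2 := pow_le_pow_left₀ hε.le hε₀.le 2
  have h4 : 1000000 * (18000 * ε) ^ 4 ≤ ε ^ 2 := by
    have := mul_le_mul_of_nonneg_left h2 (sq_nonneg ε)
    linarith [sq_nonneg ε, show 1000000 * (18000 * ε) ^ 4 = 1000000 * 18000 ^ 4 * (ε ^ 2 * ε ^ 2) by ring]
  have h5 : 1000000 * (18000 * ε) ^ 5 ≤ ε ^ 3 := by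
    have h3 : 0 ≤ ε ^ 3 := by positivity
    have := mul_le_mul_of_nonneg_left h2 h3
    linarith [show 1000000 * (18000 * ε) ^ 5 = 1000000 * 18000 ^ 5 * (ε ^ 3 * ε ^ 2) by ring]
  obtain ⟨s₀, hs₀⟩ := hN.exists_contact h4 h5 hmin
  have key : ∀ I ∈ Elastica.components (Elastica.nonContactSet ε γ),
      ∃ l : ℝ, Elastica.IsOpenArc I l ∧ 1 / 378000 ≤ l := by
    rintro _ ⟨x, hx, rfl⟩
    obtain ⟨a, b, hab, hb, ua, ub, hne, e⟩ :=
      Elastica.exists_arc_of_contact hγ.1.1 hγ.1.2.2.2.2 hs₀ hx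
    refine ⟨b - a, ⟨by linarith, by linarith, a, by rw [e, add_sub_cancel]⟩, ?_⟩
    rcases hN.length_component h4 hmin hab ua ub hne with h | h
    · linarith
    · have : 1 * ε < 378000 * (b - a) * ε := by linarith
      have := lt_of_mul_lt_mul_right this hε.le
      linarith
  exact ⟨key, Elastica.components_finite (by norm_num) key⟩
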